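/- Let $\omega_1,\omega_2,\omega_3\in\mathbb C\setminus\{0\}$ satisfy $\mathrm{Im}(\omega_1/\omega_2)\ge 0$, $\mathrm{Im}(\omega_3/\omega_1)>0$ and $\mathrm{Im}(\omega_3/\omega_2)>0$. Put $$q=e^{2\pi i\omega_1/\omega_2},\quad p=e^{2\pi i\omega_3/\omega_2},\quad r=e^{2\pi i\omega_3/\omega_1},\quad \tilde q=e^{-2\pi i\omega_2/\omega_1},\quad \tilde p=e^{-2\pi i\omega_2/\omega_3},\quad \tilde r=e^{-2\pi i\omega_1/\omega_3},$$ so that $|p|,|r|,|\tilde p|,|\tilde r|<1$ and $|q|\le 1$. For $|a|<1$ let $(a;a)_\infty=\prod_{n\ge 1}(1-a^n)$, and for $|a|,|b|<1$, $z\ne0$, let $$\Gamma(z;a,b)=\prod_{j,k=0}^\infty\frac{1-z^{-1}a^{j+1}b^{k+1}}{1-za^jb^k}$$ be the elliptic gamma function. The modified elliptic gamma function $G(u;\omega)=G(u;\omega_1,\omega_2,\omega_3)$ is, for $|q|<1$, the meromorphic function of $u\in\mathbb C$ $$G(u;\omega)=\Gamma(e^{2\pi i u/\omega_2};p,q)\,\Gamma(re^{-2\pi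 i u/\omega_1};r,\tilde q),$$ and, for $|q|=1$, $$G(u;\omega)=e^{-\pi i P(u)}\,\Gamma(e^{-2\pi i u/\omega_3};\tilde r,\tilde p),\qquad P\Big(u+\tfrac12\sum_{n=1}^3\omega_n\Big)=\frac{u\big(u^2-\frac14\sum_{k=1}^3\omega_k^2\big)}{3\omega_1\omega_2\omega_3}.$$ Write $G(a\pm b;\omega)=G(a+b;\omega)G(a-b;\omega)$, and let $$\tilde\kappa=-\frac{(q;q)_\infty(p;p)_\infty(r;r)_\infty}{2(\tilde q;\tilde q)_\infty},$$ where for $|q|=1$ the ratio $(q;q)_\infty/(\tilde q;\tilde q)_\infty$, viewed as a function of $\tau=\omega_1/\omega_2$ (with $q=e^{2\pi i\tau}$, $\tilde q=e^{-2\pi i/\tau}$), is understood as its limit from the half-plane $\mathrm{Im}\,\tau>0$. Let $g_1,\dots,g_6\in\mathbb C$ satisfy $\mathrm{Im}(g_j/\omega_3)<0$ for all $j$ and $\sum_{j=1}^6 g_j=\omega_1+\omega_2+\omega_3$. Then the integral below, taken along the straight segment from $-\omega_3/2$ to $\omega_3/2$, converges absolutely, and $$\tilde\kappa\int_{-\omega_3/2}^{\omega_3/2}\frac{\prod_{j=1}^6G(g_j\pm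 u;\omega)}{G(\pm2u;\omega)}\,\frac{du}{\omega_2}=\prod_{1\le j<m\le 6}G(g_j+g_m;\omega).$$ -/

import Mathlib

namespace EllipticBeta

noncomputable section

open Complex Filter Topology

/-- `e2pi x = exp (2 π i x)`. -/
def e2pi (x : ℂ) : ℂ := exp (2 * Real.pi * I * x)

/-- The infinite `q`-shifted factorial `(a; q)_∞ = ∏_{n ≥ 0} (1 - a q ^ n)`, for `|q| < 1`. -/
def qPochInf (a q : ℂ) : ℂ := ∏' n : ℕ, (1 - a * q ^ n)

/-- The standard elliptic gamma function
`Γ(z; p, q) = ∏_{j, k ≥ 0} (1 - z⁻¹ p ^ (j + 1) q ^ (k + 1)) / (1 - z p ^ j q ^ k)`,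
for `|p|, |q| < 1` and `z ≠ 0`. At its poles the value is `0`. -/
def ellGamma (z p q : ℂ) : ℂ :=
  (∏' jk : ℕ × ℕ, (1 - z⁻¹ * p ^ (jk.1 + 1) * q ^ (jk.2 + 1))) /
    ∏' jk : ℕ × ℕ, (1 - z * p ^ jk.1 * q ^ jk.2)

/-- The cubic polynomial `P` with
`P(u + (ω₁ + ω₂ + ω₃) / 2) = u (u² - (ω₁² + ω₂² + ω₃²) / 4) / (3 ω₁ ω₂ ω₃)`. -/
def cubicP (ω₁ ω₂ ω₃ u : ℂ) : ℂ :=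
  let v := u - (ω₁ + ω₂ + ω₃) / 2
  v * (v ^ 2 - (ω₁ ^ 2 + ω₂ ^ 2 + ω₃ ^ 2) / 4) / (3 * ω₁ * ω₂ * ω₃)

/-- The modified elliptic gamma function `G(u; ω₁, ω₂, ω₃)`.

With `q = e^{2πi ω₁/ω₂}`, `p = e^{2πi ω₃/ω₂}`, `r = e^{2πi ω₃/ω₁}`, `q̃ = e^{-2πi ω₂/ω₁}`,
`p̃ = e^{-2πi ω₂/ω₃}`, `r̃ = e^{-2πi ω₁/ω₃}`:
* for `|q| < 1` it is the meromorphic function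
  `Γ(e^{2πi u/ω₂}; p, q) Γ(r e^{-2πi u/ω₁}; r, q̃)` of `u`; the normal form removes the
  removable singularities of this product, where a pole of one factor meets a zero of the other;
* for `|q| = 1`, where that product makes no sense, it is
  `e^{-πi P(u)} Γ(e^{-2πi u/ω₃}; r̃, p̃)`. -/
def modEllGamma (ω₁ ω₂ ω₃ u : ℂ) : ℂ :=
  if 0 < (ω₁ / ω₂).im then
    toMeromorphicNFOn
      (fun v : ℂ =>
        ellGamma (e2pi (v / ω₂)) (e2pi (ω₃ / ω₂)) (e2pi (ω₁ / ω₂)) *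
          ellGamma (e2pi (ω₃ / ω₁) * e2pi (-(v / ω₁))) (e2pi (ω₃ / ω₁)) (e2pi (-(ω₂ / ω₁))))
      Set.univ u
  else
    exp (-(Real.pi * I * cubicP ω₁ ω₂ ω₃ u)) *
      ellGamma (e2pi (-(u / ω₃))) (e2pi (-(ω₁ / ω₃))) (e2pi (-(ω₂ / ω₃)))

/-- The ratio `(q; q)_∞ / (q̃; q̃)_∞` for `q = e^{2πi τ}`, `q̃ = e^{-2πi/τ}`, `Im τ > 0`. -/
def pochRatioUpper (τ : ℂ) : ℂ :=
  qPochInf (e2pi τ) (e2pi τ) / qPochInf (e2pi (-(1 / τ))) (e2pi (-(1 / τ)))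

/-- The ratio `(q; q)_∞ / (q̃; q̃)_∞`, extended to real `τ` (that is, to `|q| = 1`) as the limit
from the upper half-plane. -/
def pochRatio (τ : ℂ) : ℂ :=
  if 0 < τ.im then pochRatioUpper τ
  else limUnder (𝓝[{σ : ℂ | 0 < σ.im}] τ) pochRatioUpper

/-- The constant `κ̃ = - (q; q)_∞ (p; p)_∞ (r; r)_∞ / (2 (q̃; q̃)_∞)`. -/
def kappaTilde (ω₁ ω₂ ω₃ : ℂ) : ℂ :=
  -(pochRatio (ω₁ / ω₂) * qPochInf (e2pi (ω₃ / ω₂)) (e2pi (ω₃ / ω₂)) *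
      qPochInf (e2pi (ω₃ / ω₁)) (e2pi (ω₃ / ω₁))) / 2

/-- The integrand `∏_{j=1}^6 G(g_j ± u; ω) / G(± 2u; ω)`, where
`G(a ± b; ω) = G(a + b; ω) G(a - b; ω)`. -/
def betaIntegrand (ω₁ ω₂ ω₃ : ℂ) (g : Fin 6 → ℂ) (u : ℂ) : ℂ :=
  (∏ j, modEllGamma ω₁ ω₂ ω₃ (g j + u) * modEllGamma ω₁ ω₂ ω₃ (g j - u)) /
    (modEllGamma ω₁ ω₂ ω₃ (2 * u) * modEllGamma ω₁ ω₂ ω₃ (-(2 * u)))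

end

end EllipticBeta

/-! The modified gamma function has one representation valid for |q| < 1 and for |q| = 1: G(u) =
e^{-πiP(u)} Γ(e^{-2πiu/ω₃}; r̃, p̃). For |q| = 1 this is the definition; for |q| < 1 it is the
modular identity of the elliptic gamma function (`modSide_eq_dualSide`). On the segment u = tω₃ the
point z = e^{2πit} runs over the unit circle, the parameters t_j = e^{-2πi g_j/ω₃} lie in the unit
disc and have product r̃p̃, and the cubic exponents add up to a quantity independent of u
(`sum_cubicP_pairs`). The integral is thus an explicit exponential times the standard elliptic beta
integral in the bases r̃, p̃. Three modular transformations of (q;q)_∞ turn κ̃ into the matching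
constant (`kappaTilde_mul`).

The standard integral (`betaInt_eq`) is divided by ∏ Γ(t_j t_m). A partial fraction identity for
theta functions (`theta_four_term`) writes a combination of two q-shifted kernels as a multiple of
V(z/q) - V(z), with V holomorphic between the two circles, so the combination integrates to 0. Hence
the quotient is invariant under t₀ ↦ qt₀, t₅ ↦ t₅/q. In the logarithm of t₀ it is holomorphic on a
strip with the two periods 1 and log q / 2πi; if the strip is higher than the second period, the
maximum principle makes it constant. Permutations and analytic continuation extend this to all
parameters (`betaRatio_eq`). The value of the constant comes from t₀t₁ → 1, where poles pinch the
circle at z = ±i and the rescaled kernel is a Poisson kernel times a continuous factor.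

For the modular identity, the quotient of the two sides has the periods ω₁, ω₂, ω₃, each by a
modular transformation of theta. For suitable irrational ω₃ the periods are dense on a real line, so
the quotient is constant, and it equals 1 at the centre (ω₁+ω₂+ω₃)/2. Density and continuity in ω₃
give the general case. -/

namespace EllipticBeta

noncomputable section

open Complex Filter Topology

/-! ### The exponential with period 1 -/

section Exponential

lemma e2pi_add (x y : ℂ) : e2pi (x + y) = e2pi x * e2pi y := by
  simp only [e2pi, ← Complex.exp_add]; ring_nf

lemma e2pi_neg (x : ℂ) : e2pi (-x) = (e2pi x)⁻¹ := by
  simp only [e2pi, ← Complex.exp_neg]; ring_nf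

lemma e2pi_sub (x y : ℂ) : e2pi (x - y) = e2pi x / e2pi y := by
  rw [sub_eq_add_neg, e2pi_add, e2pi_neg, div_eq_mul_inv]

lemma e2pi_ne_zero (x : ℂ) : e2pi x ≠ 0 := Complex.exp_ne_zero _

@[simp] lemma e2pi_zero : e2pi 0 = 1 := by simp [e2pi]

lemma e2pi_nat_mul (n : ℕ) (x : ℂ) : e2pi (n * x) = e2pi x ^ n := by
  simp only [e2pi, ← Complex.exp_nat_mul]; ring_nf

lemma norm_e2pi (x : ℂ) : ‖e2pi x‖ = Real.exp (-(2 * Real.pi * x.im)) := by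
  rw [e2pi, Complex.norm_exp]; congr 1
  simp [Complex.mul_re, Complex.mul_im]

lemma norm_e2pi_lt_one {x : ℂ} : ‖e2pi x‖ < 1 ↔ 0 < x.im := by
  rw [norm_e2pi, Real.exp_lt_one_iff]
  have := Real.pi_pos
  constructor
  · intro h; by_contra h'; nlinarith
  · intro h; nlinarith [mul_pos this h]

lemma norm_e2pi_real (x : ℝ) : ‖e2pi x‖ = 1 := by simp [norm_e2pi]

lemma e2pi_eq_one_iff {x : ℂ} : e2pi x = 1 ↔ ∃ n : ℤ, x = n := by
  rw [e2pi, Complex.exp_eq_one_iff]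
  have h : (2 * Real.pi * I : ℂ) ≠ 0 := Complex.two_pi_I_ne_zero
  refine exists_congr fun n => ?_
  rw [mul_comm (n : ℂ), mul_right_inj' h]

@[simp] lemma e2pi_one : e2pi 1 = 1 := e2pi_eq_one_iff.2 ⟨1, by simp⟩

lemma e2pi_int (n : ℤ) : e2pi n = 1 := e2pi_eq_one_iff.2 ⟨n, rfl⟩

lemma e2pi_add_one (x : ℂ) : e2pi (x + 1) = e2pi x := by simp [e2pi_add]

@[fun_prop] lemma differentiable_e2pi : Differentiable ℂ e2pi := by
  unfold e2pi; fun_prop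

@[fun_prop] lemma continuous_e2pi : Continuous e2pi := differentiable_e2pi.continuous

lemma hasDerivAt_e2pi (x : ℂ) : HasDerivAt e2pi (2 * Real.pi * I * e2pi x) x := by
  have h := ((hasDerivAt_id x).const_mul (2 * Real.pi * I : ℂ)).cexp
  simp only [mul_one, id] at h
  rw [mul_comm]
  exact h

lemma exists_e2pi_eq {z : ℂ} (hz : z ≠ 0) : ∃ x, e2pi x = z := by
  refine ⟨Complex.log z / (2 * Real.pi * I), ?_⟩
  rw [e2pi, mul_div_cancel₀ _ Complex.two_pi_I_ne_zero, Complex.exp_log hz]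

end Exponential

/-! ### Infinite products -/

section Products

/-- The double infinite product `∏_{j, k ≥ 0} (1 - z p ^ j q ^ k)`. -/
def ellPoch (z p q : ℂ) : ℂ := ∏' jk : ℕ × ℕ, (1 - z * p ^ jk.1 * q ^ jk.2)

/-- The theta function `θ(z; p) = (z; p)_∞ (p / z; p)_∞`. -/
def theta (z p : ℂ) : ℂ := qPochInf z p * qPochInf (p / z) p

lemma summable_geom_geom {a b : ℝ} (ha : 0 ≤ a) (ha1 : a < 1) (hb : 0 ≤ b) (hb1 : b < 1) (M : ℝ) :
    Summable fun jk : ℕ × ℕ => M * a ^ jk.1 * b ^ jk.2 := by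
  have h := (summable_geometric_of_lt_one ha ha1).mul_of_nonneg
    (summable_geometric_of_lt_one hb hb1) (fun n => pow_nonneg ha n) (fun n => pow_nonneg hb n)
  simpa [mul_assoc] using h.mul_left M

lemma summable_norm_ellPoch (z : ℂ) {p q : ℂ} (hp : ‖p‖ < 1) (hq : ‖q‖ < 1) :
    Summable fun jk : ℕ × ℕ => ‖-(z * p ^ jk.1 * q ^ jk.2)‖ := by
  simpa using summable_geom_geom (norm_nonneg p) hp (norm_nonneg q) hq ‖z‖

lemma summable_norm_qPoch (z : ℂ) {q : ℂ} (hq : ‖q‖ < 1) :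
    Summable fun n : ℕ => ‖-(z * q ^ n)‖ := by
  simpa using (summable_geometric_of_lt_one (norm_nonneg q) hq).mul_left ‖z‖

lemma multipliable_ellPoch (z : ℂ) {p q : ℂ} (hp : ‖p‖ < 1) (hq : ‖q‖ < 1) :
    Multipliable fun jk : ℕ × ℕ => 1 - z * p ^ jk.1 * q ^ jk.2 := by
  simpa [sub_eq_add_neg] using multipliable_one_add_of_summable (summable_norm_ellPoch z hp hq)

lemma multipliable_qPoch (z : ℂ) {q : ℂ} (hq : ‖q‖ < 1) :
    Multipliable fun n : ℕ => 1 - z * q ^ n := by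
  simpa [sub_eq_add_neg] using multipliable_one_add_of_summable (summable_norm_qPoch z hq)

lemma qPochInf_eq (z : ℂ) {q : ℂ} (hq : ‖q‖ < 1) :
    qPochInf z q = (1 - z) * qPochInf (z * q) q := by
  have h : Multipliable fun n : ℕ => 1 - z * q ^ (n + 1) := by
    simpa [pow_succ', mul_assoc] using multipliable_qPoch (z * q) hq
  have h2 := tprod_eq_zero_mul' (f := fun n : ℕ => 1 - z * q ^ n) h
  rw [qPochInf, h2, qPochInf]
  simp [pow_succ', mul_assoc]

lemma hasProd_ellPoch (z : ℂ) {p q : ℂ} (hp : ‖p‖ < 1) (hq : ‖q‖ < 1) :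
    HasProd (fun j : ℕ => qPochInf (z * p ^ j) q) (ellPoch z p q) :=
  (multipliable_ellPoch z hp hq).hasProd.prod_fiberwise
    fun j => (multipliable_qPoch (z * p ^ j) hq).hasProd

lemma ellPoch_mul_left (z : ℂ) {p q : ℂ} (hp : ‖p‖ < 1) (hq : ‖q‖ < 1) :
    ellPoch z p q = qPochInf z q * ellPoch (z * p) p q := by
  have h := hasProd_ellPoch (z * p) hp hq
  have h' : (fun j : ℕ => qPochInf (z * p * p ^ j) q) = fun j => qPochInf (z * p ^ (j + 1)) q := by
    ext j; rw [pow_succ']; ring_nf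
  rw [h'] at h
  have h2 := tprod_eq_zero_mul' (f := fun j : ℕ => qPochInf (z * p ^ j) q) h.multipliable
  rw [← (hasProd_ellPoch z hp hq).tprod_eq, h2, h.tprod_eq]
  simp

lemma ellPoch_comm (z p q : ℂ) : ellPoch z p q = ellPoch z q p := by
  rw [ellPoch, ellPoch, ← (Equiv.prodComm ℕ ℕ).tprod_eq]
  refine tprod_congr fun jk => ?_
  simp only [Equiv.prodComm_apply, Prod.fst_swap, Prod.snd_swap]; ring

lemma ellPoch_mul_right (z : ℂ) {p q : ℂ} (hp : ‖p‖ < 1) (hq : ‖q‖ < 1) :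
    ellPoch z p q = qPochInf z p * ellPoch (z * q) p q := by
  rw [ellPoch_comm, ellPoch_mul_left z hq hp, ellPoch_comm _ q p]

lemma ellGamma_eq (z p q : ℂ) : ellGamma z p q = ellPoch (p * q / z) p q / ellPoch z p q := by
  rw [ellGamma, ellPoch, ellPoch]
  congr 1
  refine tprod_congr fun jk => ?_
  rw [pow_succ, pow_succ]; ring

lemma ellPoch_ne_zero {z p q : ℂ} (hp : ‖p‖ < 1) (hq : ‖q‖ < 1)
    (h : ∀ j k : ℕ, z * p ^ j * q ^ k ≠ 1) : ellPoch z p q ≠ 0 := by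
  have := tprod_one_add_ne_zero_of_summable (f := fun jk : ℕ × ℕ => -(z * p ^ jk.1 * q ^ jk.2))
    (fun jk => by rw [← sub_eq_add_neg, sub_ne_zero]; exact (h _ _).symm)
    (summable_norm_ellPoch z hp hq)
  simpa [sub_eq_add_neg, ellPoch] using this

lemma ellPoch_ne_zero_of_norm_lt_one {z p q : ℂ} (hp : ‖p‖ < 1) (hq : ‖q‖ < 1)
    (hz : ‖z‖ < 1) : ellPoch z p q ≠ 0 := by
  refine ellPoch_ne_zero hp hq fun j k h => ?_
  have h1 : ‖z * p ^ j * q ^ k‖ < 1 := by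
    rw [norm_mul, norm_mul, norm_pow, norm_pow]
    have := pow_le_one₀ (n := j) (norm_nonneg p) hp.le
    have := pow_le_one₀ (n := k) (norm_nonneg q) hq.le
    calc ‖z‖ * ‖p‖ ^ j * ‖q‖ ^ k ≤ ‖z‖ * 1 * 1 := by gcongr
      _ < 1 := by simpa
  rw [h] at h1; simp at h1

lemma qPochInf_ne_zero {z q : ℂ} (hq : ‖q‖ < 1) (h : ∀ k : ℕ, z * q ^ k ≠ 1) :
    qPochInf z q ≠ 0 := by
  have := tprod_one_add_ne_zero_of_summable (f := fun k : ℕ => -(z * q ^ k))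
    (fun k => by rw [← sub_eq_add_neg, sub_ne_zero]; exact (h _).symm)
    (summable_norm_qPoch z hq)
  simpa [sub_eq_add_neg, qPochInf] using this

lemma qPochInf_ne_zero_of_norm_lt_one {z q : ℂ} (hq : ‖q‖ < 1) (hz : ‖z‖ < 1) :
    qPochInf z q ≠ 0 := by
  refine qPochInf_ne_zero hq fun k h => ?_
  have h1 : ‖z * q ^ k‖ < 1 := by
    rw [norm_mul, norm_pow]
    have := pow_le_one₀ (n := k) (norm_nonneg q) hq.le
    calc ‖z‖ * ‖q‖ ^ k ≤ ‖z‖ * 1 := by gcongr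
      _ < 1 := by simpa
  rw [h] at h1; simp at h1

end Products

/-! ### Continuity and holomorphy of the products -/

section Regularity

lemma _root_.ContinuousAt.ellPoch {X : Type*} [TopologicalSpace X] {f g h : X → ℂ} {x : X}
    (hf : ContinuousAt f x) (hg : ContinuousAt g x) (hh : ContinuousAt h x)
    (hp : ‖g x‖ < 1) (hq : ‖h x‖ < 1) :
    ContinuousAt (fun y => ellPoch (f y) (g y) (h y)) x := by
  obtain ⟨a, ha, ha1⟩ := exists_between hp
  obtain ⟨b, hb, hb1⟩ := exists_between hq
  have ha0 := (norm_nonneg _).trans_lt ha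
  have hb0 := (norm_nonneg _).trans_lt hb
  have key := tendsto_tprod_one_add_of_dominated_convergence (𝓕 := 𝓝 x)
    (f := fun y (jk : ℕ × ℕ) => -(f y * g y ^ jk.1 * h y ^ jk.2))
    (g := fun jk => -(f x * g x ^ jk.1 * h x ^ jk.2))
    (summable_geom_geom ha0.le ha1 hb0.le hb1 (‖f x‖ + 1))
    (fun jk => (((hf.mul (hg.pow jk.1)).mul (hh.pow jk.2)).neg : ContinuousAt _ x)) ?_
  · simpa only [ContinuousAt, EllipticBeta.ellPoch, sub_eq_add_neg] using key
  · filter_upwards [hf.norm.eventually_lt_const (lt_add_one ‖f x‖),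
      hg.norm.eventually_lt_const ha, hh.norm.eventually_lt_const hb] with y h1 h2 h3 jk
    rw [norm_neg, norm_mul, norm_mul, norm_pow, norm_pow]
    gcongr

lemma differentiable_tprod_one_sub {ι : Type*} (c : ι → ℂ) (hc : Summable fun i => ‖c i‖) :
    Differentiable ℂ fun z => ∏' i, (1 - z * c i) := by
  have h : HasProdLocallyUniformlyOn (fun i (z : ℂ) => 1 + -(z * c i))
      (fun z => ∏' i, (1 + -(z * c i))) Set.univ := by
    refine hasProdLocallyUniformlyOn_of_forall_compact isOpen_univ fun K _ hK => ?_
    obtain ⟨M, hM⟩ := hK.isBounded.exists_norm_le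
    refine (hc.mul_left M).hasProdUniformlyOn_one_add hK (.of_forall fun i z hz => ?_)
      (fun i => by fun_prop)
    rw [norm_neg, norm_mul]
    exact mul_le_mul_of_nonneg_right (hM z hz) (norm_nonneg _)
  have := h.differentiableOn (.of_forall fun s => by
    simpa [Finset.prod_fn] using DifferentiableOn.finsetProd (fun _ _ => by fun_prop)) isOpen_univ
  simpa [sub_eq_add_neg] using differentiableOn_univ.1 this

lemma differentiable_ellPoch {p q : ℂ} (hp : ‖p‖ < 1) (hq : ‖q‖ < 1) :
    Differentiable ℂ fun z => ellPoch z p q := by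
  have := differentiable_tprod_one_sub (fun jk : ℕ × ℕ => p ^ jk.1 * q ^ jk.2)
    (by simpa using summable_norm_ellPoch 1 hp hq)
  simpa [ellPoch, mul_assoc] using this

lemma differentiable_qPochInf {q : ℂ} (hq : ‖q‖ < 1) :
    Differentiable ℂ fun z => qPochInf z q :=
  differentiable_tprod_one_sub (fun k : ℕ => q ^ k)
    (by simpa using summable_norm_qPoch 1 hq)

end Regularity

/-! ### The theta function: quasi-periodicity and simple zeros -/

section Theta

variable {p : ℂ}

lemma theta_eq_one_sub_mul (z : ℂ) (hp : ‖p‖ < 1) :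
    theta z p = (1 - z) * (qPochInf (z * p) p * qPochInf (p / z) p) := by
  rw [theta, qPochInf_eq z hp, mul_assoc]

lemma theta_one (hp : ‖p‖ < 1) : theta 1 p = 0 := by
  rw [theta_eq_one_sub_mul 1 hp]; simp

lemma theta_inv {z : ℂ} (hz : z ≠ 0) (hp : ‖p‖ < 1) : theta z⁻¹ p = -z⁻¹ * theta z p := by
  rw [theta_eq_one_sub_mul z hp, theta_eq_one_sub_mul z⁻¹ hp, div_inv_eq_mul,
    div_eq_mul_inv, mul_comm p z, mul_comm z⁻¹ p]
  field_simp; ring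

lemma theta_div_self {z : ℂ} (hp0 : p ≠ 0) : theta (p / z) p = theta z p := by
  rw [theta, theta, div_div_cancel₀ hp0, mul_comm]

lemma theta_mul_base {z : ℂ} (hz : z ≠ 0) (hp0 : p ≠ 0) (hp : ‖p‖ < 1) :
    theta (z * p) p = -z⁻¹ * theta z p := by
  rw [← theta_inv hz hp, ← theta_div_self (z := z⁻¹) hp0, div_inv_eq_mul, mul_comm]

lemma theta_ne_zero {z : ℂ} (hp : ‖p‖ < 1) (h1 : ∀ k : ℕ, z * p ^ k ≠ 1)
    (h2 : ∀ k : ℕ, p / z * p ^ k ≠ 1) : theta z p ≠ 0 :=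
  mul_ne_zero (qPochInf_ne_zero hp h1) (qPochInf_ne_zero hp h2)

lemma theta_ne_zero_of_norm {z : ℂ} (hp : ‖p‖ < 1) (hz : ‖z‖ < 1) (hpz : ‖p‖ < ‖z‖) :
    theta z p ≠ 0 :=
  mul_ne_zero (qPochInf_ne_zero_of_norm_lt_one hp hz)
    (qPochInf_ne_zero_of_norm_lt_one hp
      (by rwa [norm_div, div_lt_one ((norm_nonneg _).trans_lt hpz)]))

lemma differentiableAt_theta {z : ℂ} (hp : ‖p‖ < 1) (hz : z ≠ 0) :
    DifferentiableAt ℂ (fun z => theta z p) z := by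
  refine DifferentiableAt.mul (differentiable_qPochInf hp z) ?_
  exact (differentiable_qPochInf hp _).comp z ((differentiableAt_const p).div differentiableAt_id hz)

lemma _root_.DifferentiableAt.theta {f : ℂ → ℂ} {x : ℂ} (hf : DifferentiableAt ℂ f x) (hp : ‖p‖ < 1)
    (h0 : f x ≠ 0) : DifferentiableAt ℂ (fun y => theta (f y) p) x :=
  (differentiableAt_theta hp h0).comp x hf

lemma differentiable_theta_e2pi (hp : ‖p‖ < 1) : Differentiable ℂ fun u => theta (e2pi u) p :=
  fun u => (differentiable_e2pi u).theta hp (e2pi_ne_zero u)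

lemma theta_e2pi_add_one (u p : ℂ) : theta (e2pi (u + 1)) p = theta (e2pi u) p := by
  rw [e2pi_add_one]

lemma theta_e2pi_add_base {τ : ℂ} (hτ : 0 < τ.im) (u : ℂ) :
    theta (e2pi (u + τ)) (e2pi τ) = -e2pi (-u) * theta (e2pi u) (e2pi τ) := by
  rw [e2pi_add, theta_mul_base (e2pi_ne_zero _) (e2pi_ne_zero _) (norm_e2pi_lt_one.2 hτ), e2pi_neg]

lemma hasDerivAt_theta_zero (hp : ‖p‖ < 1) :
    HasDerivAt (fun u => theta (e2pi u) p) (-(2 * Real.pi * I) * qPochInf p p ^ 2) 0 := by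
  have h1 : HasDerivAt (fun u => 1 - e2pi u) (-(2 * Real.pi * I)) 0 := by
    simpa using (hasDerivAt_e2pi 0).const_sub 1
  have h2 : DifferentiableAt ℂ (fun u => qPochInf (e2pi u * p) p * qPochInf (p / e2pi u) p) 0 := by
    refine DifferentiableAt.mul ((differentiable_qPochInf hp _).comp (0 : ℂ) (by fun_prop)) ?_
    refine (differentiable_qPochInf hp _).comp (0 : ℂ) ?_
    exact (differentiableAt_const p).div (differentiable_e2pi 0) (e2pi_ne_zero 0)
  have h3 := h1.mul h2.hasDerivAt
  simp only [e2pi_zero, sub_self, zero_mul, add_zero, one_mul, div_one] at h3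
  rw [pow_two]
  refine h3.congr_of_eventuallyEq (.of_forall fun u => ?_)
  simp [theta_eq_one_sub_mul _ hp]

lemma theta_e2pi_eq_zero_iff {τ : ℂ} (hτ : 0 < τ.im) (u : ℂ) :
    theta (e2pi u) (e2pi τ) = 0 ↔ ∃ m n : ℤ, u = m + n * τ := by
  have hp := norm_e2pi_lt_one.2 hτ
  constructor
  · intro h
    by_contra! hne
    refine theta_ne_zero hp (fun k hk => ?_) (fun k hk => ?_) h
    · rw [← e2pi_nat_mul, ← e2pi_add, e2pi_eq_one_iff] at hk
      obtain ⟨n, hn⟩ := hk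
      exact hne n (-k) (by push_cast; linear_combination hn)
    · rw [← e2pi_nat_mul, ← e2pi_sub, ← e2pi_add, e2pi_eq_one_iff] at hk
      obtain ⟨n, hn⟩ := hk
      exact hne (-n) (k + 1) (by push_cast; linear_combination -hn)
  · rintro ⟨m, n, rfl⟩
    rw [add_comm, e2pi_add, e2pi_int, mul_one]
    induction n using Int.induction_on with
    | zero => simp [theta_one hp]
    | succ n ih =>
      push_cast at ih ⊢
      rw [add_mul, one_mul, theta_e2pi_add_base hτ, ih, mul_zero]
    | pred n ih =>
      have h := theta_e2pi_add_base hτ (((-(n : ℤ) - 1 : ℤ) : ℂ) * τ)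
      have e : ((-(n : ℤ) - 1 : ℤ) : ℂ) * τ + τ = ((-(n : ℤ) : ℤ) : ℂ) * τ := by push_cast; ring
      rw [e, ih] at h
      simpa [e2pi_ne_zero] using h.symm

/-- At 0 the derivative is -2πi (p;p)²; the shifts by 1 and τ carry it to every other zero,
multiplied by a nonvanishing factor. -/
lemma deriv_theta_ne_zero {τ : ℂ} (hτ : 0 < τ.im) {u : ℂ}
    (hu : theta (e2pi u) (e2pi τ) = 0) :
    deriv (fun u => theta (e2pi u) (e2pi τ)) u ≠ 0 := by
  have hp := norm_e2pi_lt_one.2 hτ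
  have hd := differentiable_theta_e2pi hp
  set T : ℂ → ℂ := fun u => theta (e2pi u) (e2pi τ) with hT
  have hstep : ∀ v, T v = 0 → deriv T (v + τ) = -e2pi (-v) * deriv T v := by
    intro v hv
    have h1 : HasDerivAt (fun w => T (w + τ)) (deriv T (v + τ)) v := by
      simpa using (hd (v + τ)).hasDerivAt.comp_add_const v τ
    have h2 : HasDerivAt (fun w => -e2pi (-w) * T w)
        (deriv (fun w => -e2pi (-w)) v * T v + -e2pi (-v) * deriv T v) v :=
      HasDerivAt.mul (DifferentiableAt.hasDerivAt (by fun_prop)) (hd v).hasDerivAt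
    rw [hv, mul_zero, zero_add] at h2
    exact h1.unique (h2.congr_of_eventuallyEq
      (.of_forall fun w => theta_e2pi_add_base hτ w))
  have hper : ∀ m : ℤ, ∀ v, deriv T (m + v) = deriv T v := by
    intro m v
    have h1 : HasDerivAt (fun w => T (m + w)) (deriv T (m + v)) v := by
      simpa using (hd (m + v)).hasDerivAt.comp_const_add (m : ℂ) v
    refine (h1.congr_of_eventuallyEq (f₁ := T) (.of_forall fun w => ?_)).deriv.symm
    simp [hT, e2pi_add, e2pi_int]
  obtain ⟨m, n, rfl⟩ := (theta_e2pi_eq_zero_iff hτ u).1 hu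
  rw [hper]
  have hz : ∀ n : ℤ, T (n * τ) = 0 := fun n => (theta_e2pi_eq_zero_iff hτ _).2 ⟨0, n, by simp⟩
  clear hu
  induction n using Int.induction_on with
  | zero =>
    have := (hasDerivAt_theta_zero hp).deriv
    simp only [Int.cast_zero, zero_mul, hT, this]
    exact mul_ne_zero (neg_ne_zero.2 two_pi_I_ne_zero)
      (pow_ne_zero _ (qPochInf_ne_zero_of_norm_lt_one hp hp))
  | succ n ih =>
    have h := hstep _ (hz n)
    have e : ((n : ℤ) + 1 : ℤ) * τ = ((n : ℤ) : ℂ) * τ + τ := by push_cast; ring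
    rw [e, h]
    exact mul_ne_zero (neg_ne_zero.2 (e2pi_ne_zero _)) ih
  | pred n ih =>
    have h := hstep _ (hz (-(n : ℤ) - 1))
    have e : ((-(n : ℤ) - 1 : ℤ) : ℂ) * τ + τ = ((-(n : ℤ) : ℤ) : ℂ) * τ := by push_cast; ring
    rw [e] at h
    rw [h] at ih
    exact right_ne_zero_of_mul ih

end Theta

/-! ### Division of entire functions and doubly periodic functions -/

section Liouville

/-- Entire functions form an integral domain. This removes genericity assumptions: a factor that is
not identically zero can be divided out. -/
lemma eq_zero_of_mul_eq_zero_of_entire {f g : ℂ → ℂ} (hf : Differentiable ℂ f)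
    (hg : Differentiable ℂ g) (h : ∀ u, f u * g u = 0) {u₀ : ℂ} (h0 : f u₀ ≠ 0) (u : ℂ) :
    g u = 0 := by
  have := AnalyticOnNhd.eq_zero_or_eq_zero_of_mul_eq_zero (U := Set.univ)
    (fun x _ => hf.analyticAt x) (fun x _ => hg.analyticAt x) (fun x _ => h x)
    isPreconnected_univ
  rcases this with h1 | h1
  · exact absurd (h1 u₀ trivial) h0
  · exact h1 u trivial

/-- The zeros of the denominator are simple, so near each of them the quotient equals a quotient of
difference quotients whose denominator does not vanish. -/
lemma exists_entire_quotient {f h : ℂ → ℂ} (hf : Differentiable ℂ f) (hh : Differentiable ℂ h)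
    (hz : ∀ u, h u = 0 → f u = 0 ∧ deriv h u ≠ 0) :
    ∃ k : ℂ → ℂ, Differentiable ℂ k ∧ ∀ u, f u = h u * k u := by
  classical
  refine ⟨fun u => if h u = 0 then deriv f u / deriv h u else f u / h u, fun u => ?_, fun u => ?_⟩
  · by_cases hu : h u = 0
    · obtain ⟨hfu, hdu⟩ := hz u hu
      have d1 : DifferentiableAt ℂ (dslope f u) u :=
        ((Complex.differentiableOn_dslope (s := Set.univ) (c := u) univ_mem).2
          hf.differentiableOn).differentiableAt univ_mem
      have d2 : DifferentiableAt ℂ (dslope h u) u :=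
        ((Complex.differentiableOn_dslope (s := Set.univ) (c := u) univ_mem).2
          hh.differentiableOn).differentiableAt univ_mem
      have hne : dslope h u u ≠ 0 := by rwa [dslope_same]
      refine (d1.div d2 hne).congr_of_eventuallyEq ?_
      filter_upwards [d2.continuousAt.eventually_ne hne] with v hv
      simp only [Pi.div_apply]
      rcases eq_or_ne v u with rfl | hvu
      · simp [hu, dslope_same]
      · have e1 : f v = (v - u) * dslope f u v := by
          rw [dslope_of_ne _ hvu, slope_def_field, hfu, sub_zero,
            mul_div_cancel₀ _ (sub_ne_zero.2 hvu)]
        have e2 : h v = (v - u) * dslope h u v := by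
          rw [dslope_of_ne _ hvu, slope_def_field, hu, sub_zero,
            mul_div_cancel₀ _ (sub_ne_zero.2 hvu)]
        have h3 : h v ≠ 0 := by rw [e2]; exact mul_ne_zero (sub_ne_zero.2 hvu) hv
        rw [if_neg h3, e1, e2, mul_div_mul_left _ _ (sub_ne_zero.2 hvu)]
    · refine ((hf u).div (hh u) hu).congr_of_eventuallyEq ?_
      filter_upwards [(hh u).continuousAt.eventually_ne hu] with v hv
      simp [hv]
  · by_cases hu : h u = 0
    · simp [hu, (hz u hu).1]
    · simp [hu, mul_div_cancel₀]

/-- A holomorphic function on a horizontal strip invariant under the shifts by `1` and by `σ`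
is constant, when the strip is higher than `Im σ`. -/
lemma eq_of_doubly_periodic_on_strip {H : ℂ → ℂ} {a b : ℝ} {σ : ℂ} (hσ : 0 < σ.im)
    (hab : σ.im < b - a)
    (hd : DifferentiableOn ℂ H {x | a < x.im ∧ x.im < b})
    (h1 : ∀ x, a < x.im → x.im < b → H (x + 1) = H x)
    (hq : ∀ x, a < x.im → x.im + σ.im < b → H (x + σ) = H x) {x y : ℂ}
    (hx : a < x.im ∧ x.im < b) (hy : a < y.im ∧ y.im < b) : H x = H y := by
  set S : Set ℂ := {x | a < x.im ∧ x.im < b} with hS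
  have hSo : IsOpen S := (isOpen_lt continuous_const continuous_im).inter
    (isOpen_lt continuous_im continuous_const)
  have hSc : IsPreconnected S := ((convex_halfSpace_im_gt a).inter
    (convex_halfSpace_im_lt b)).isPreconnected
  -- A closed rectangle of width 1 and height Im σ fits inside the strip; this is where the height
  -- assumption enters.
  obtain ⟨y0, hy0, hy1⟩ := exists_between (show a < b - σ.im by linarith)
  set K : Set ℂ := Set.Icc 0 1 ×ℂ Set.Icc y0 (y0 + σ.im) with hK
  have hKc : IsCompact K := isCompact_Icc.reProdIm isCompact_Icc
  have hKS : K ⊆ S := fun z hz => by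
    obtain ⟨-, h2, h3⟩ := hz
    exact ⟨hy0.trans_le h2, h3.trans_lt (by linarith)⟩
  have hKn : K.Nonempty := ⟨⟨0, y0⟩, by simp [hK, Complex.mem_reProdIm, hσ.le]⟩
  have hint : ∀ n : ℤ, ∀ z ∈ S, H (z + n) = H z := by
    intro n z hz
    induction n using Int.induction_on with
    | zero => simp
    | succ n ih =>
      have := h1 (z + n) (by simpa using hz.1) (by simpa using hz.2)
      push_cast at ih ⊢
      rw [← add_assoc, this, ih]
    | pred n ih =>
      have := h1 (z + ((-(n : ℤ) - 1 : ℤ) : ℂ)) (by simpa using hz.1) (by simpa using hz.2)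
      rw [← this, ← ih]; push_cast; ring_nf
  have hup : ∀ n : ℕ, ∀ z ∈ S, z.im + n * σ.im < b → H (z + n * σ) = H z := by
    intro n z hz hn
    induction n with
    | zero => simp
    | succ n ih =>
      push_cast at hn ⊢
      have h0 : 0 ≤ n * σ.im := by positivity
      have := hq (z + n * σ) (by simp; linarith [hz.1]) (by simp; linarith)
      rw [← ih (by linarith), ← this]; ring_nf
  -- Every point of the strip can be moved into the compact rectangle without leaving the strip, so
  -- |H| attains its maximum over the open strip.
  have hdown : ∀ z ∈ S, ∃ w ∈ K, H w = H z := by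
    intro z hz
    set n := ⌊(z.im - y0) / σ.im⌋ with hn
    have e1 : (n : ℝ) * σ.im ≤ z.im - y0 := by
      have := Int.floor_le ((z.im - y0) / σ.im); rwa [← hn, le_div_iff₀ hσ] at this
    have e2 : z.im - y0 < (n + 1) * σ.im := by
      have := Int.lt_floor_add_one ((z.im - y0) / σ.im); rwa [← hn, div_lt_iff₀ hσ] at this
    set w := z - n * σ with hw
    have hwim : w.im = z.im - n * σ.im := by simp [hw]
    have hwS : w ∈ S := ⟨by rw [hwim]; linarith, by rw [hwim]; linarith⟩
    have hHw : H w = H z := by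
      obtain ⟨k, hk | hk⟩ := Int.eq_nat_or_neg n
      · rw [← hup k w hwS (by
          have : (n : ℝ) = k := by rw [hk]; simp
          rw [hwim, this]; linarith [hz.2])]
        congr 1
        rw [hw, hk]; push_cast; ring
      · have : (n : ℝ) = -k := by rw [hk]; simp
        rw [← hup k z hz (by have h5 := hwS.2; rw [hwim, this] at h5; linarith)]
        congr 1
        rw [hw, hk]; push_cast; ring
    refine ⟨w + ((-⌊w.re⌋ : ℤ) : ℂ), ?_, by rw [hint _ w hwS, hHw]⟩
    simp only [hK, Complex.mem_reProdIm, Set.mem_Icc]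
    have f1 := Int.floor_le w.re
    have f2 := Int.lt_floor_add_one w.re
    simp only [add_re, intCast_re, add_im, intCast_im, add_zero, hwim]
    push_cast
    refine ⟨⟨by linarith, by linarith⟩, by linarith, by linarith⟩
  obtain ⟨c, hcK, hc⟩ := hKc.exists_isMaxOn hKn ((hd.continuousOn.mono hKS).norm)
  have hmax : IsMaxOn (norm ∘ H) S c := by
    intro z hz
    obtain ⟨w, hw, hwz⟩ := hdown z hz
    have := hc hw
    simpa [hwz] using this
  have key := Complex.eqOn_of_isPreconnected_of_isMaxOn_norm hSc hSo hd (hKS hcK) hmax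
  rw [key hx, key hy]; rfl

lemma eq_of_doubly_periodic {H : ℂ → ℂ} {σ : ℂ} (hσ : 0 < σ.im) (hd : Differentiable ℂ H)
    (h1 : ∀ x, H (x + 1) = H x) (hq : ∀ x, H (x + σ) = H x) (x y : ℂ) : H x = H y := by
  refine eq_of_doubly_periodic_on_strip (a := min x.im y.im - 1)
    (b := max x.im y.im + 1 + σ.im) hσ ?_ hd.differentiableOn (fun x _ _ => h1 x)
    (fun x _ _ => hq x) ⟨?_, ?_⟩ ⟨?_, ?_⟩ <;>
  linarith [min_le_left x.im y.im, min_le_right x.im y.im, le_max_left x.im y.im,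
    le_max_right x.im y.im]

end Liouville

/-! ### Addition formula and partial fractions for theta functions -/

section ThetaIdentities

lemma exists_theta_ne_zero {τ : ℂ} (hτ : 0 < τ.im) : ∃ u, theta (e2pi u) (e2pi τ) ≠ 0 := by
  refine ⟨τ / 2, theta_ne_zero_of_norm (norm_e2pi_lt_one.2 hτ) (norm_e2pi_lt_one.2 (by simpa)) ?_⟩
  rw [norm_e2pi, norm_e2pi, Real.exp_lt_exp]
  have := Real.pi_pos
  simp only [div_ofNat_im]
  nlinarith [mul_pos this hτ]

/-- A quasi-periodic entire function vanishing at `β` is divisible by the theta function with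
zeros at the translates of `β`. -/
lemma exists_eq_theta_mul {τ : ℂ} (hτ : 0 < τ.im) {F μ : ℂ → ℂ} (hF : Differentiable ℂ F)
    (hμ : Differentiable ℂ μ) (hμ0 : ∀ x, μ x ≠ 0) (h1 : ∀ x, F (x + 1) = F x)
    (h2 : ∀ x, F (x + τ) = μ x * F x) {β : ℂ} (hβ : F β = 0) :
    ∃ k : ℂ → ℂ, Differentiable ℂ k ∧ (∀ x, F x = theta (e2pi (x - β)) (e2pi τ) * k x) ∧
      (∀ x, k (x + 1) = k x) ∧ ∀ x, k (x + τ) = -μ x * e2pi (x - β) * k x := by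
  have hp := norm_e2pi_lt_one.2 hτ
  have hd : Differentiable ℂ fun x => theta (e2pi (x - β)) (e2pi τ) :=
    (differentiable_theta_e2pi hp).comp (by fun_prop : Differentiable ℂ fun x => x - β)
  have hτz : ∀ n : ℤ, F (β + n * τ) = 0 := by
    intro n
    induction n using Int.induction_on with
    | zero => simpa
    | succ n ih =>
      have := h2 (β + n * τ)
      push_cast at ih ⊢
      rw [ih, mul_zero] at this
      rw [← this]; ring_nf
    | pred n ih =>
      have := h2 (β + ((-(n : ℤ) - 1 : ℤ) : ℂ) * τ)
      rw [show β + ((-(n : ℤ) - 1 : ℤ) : ℂ) * τ + τ = β + ((-(n : ℤ) : ℤ) : ℂ) * τ by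
        push_cast; ring, ih] at this
      exact (mul_eq_zero.1 this.symm).resolve_left (hμ0 _)
  have hz : ∀ m n : ℤ, F (β + n * τ + m) = 0 := by
    intro m n
    induction m using Int.induction_on with
    | zero => simpa using hτz n
    | succ m ih => push_cast at ih ⊢; rw [← add_assoc, h1, ih]
    | pred m ih => rw [← h1, ← ih]; push_cast; ring_nf
  obtain ⟨k, hk, hFk⟩ := exists_entire_quotient hF hd fun u hu => by
    refine ⟨?_, ?_⟩
    · obtain ⟨m, n, hmn⟩ := (theta_e2pi_eq_zero_iff hτ _).1 hu
      rw [← hz m n]; congr 1; linear_combination hmn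
    · have := deriv_theta_ne_zero hτ hu
      rwa [deriv_comp_sub_const (f := fun x => theta (e2pi x) (e2pi τ))]
  obtain ⟨u₀, hu₀⟩ := exists_theta_ne_zero hτ
  have hne : theta (e2pi (u₀ + β - β)) (e2pi τ) ≠ 0 := by simpa
  refine ⟨k, hk, hFk, fun x => ?_, fun x => ?_⟩
  · refine sub_eq_zero.1 (eq_zero_of_mul_eq_zero_of_entire hd
      (g := fun x => k (x + 1) - k x) (by fun_prop) (fun x => ?_) hne x)
    have := h1 x
    rw [hFk, hFk, show x + 1 - β = x - β + 1 by ring, theta_e2pi_add_one] at this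
    linear_combination this
  · refine sub_eq_zero.1 (eq_zero_of_mul_eq_zero_of_entire hd
      (g := fun x => k (x + τ) - -μ x * e2pi (x - β) * k x) (by fun_prop) (fun x => ?_) hne x)
    have := h2 x
    rw [hFk, hFk, show x + τ - β = x - β + τ by ring, theta_e2pi_add_base hτ, e2pi_neg] at this
    have h0 := e2pi_ne_zero (x - β)
    field_simp at this
    linear_combination -this

lemma theta_e2pi_neg {τ : ℂ} (hτ : 0 < τ.im) (u : ℂ) :
    theta (e2pi (-u)) (e2pi τ) = -e2pi (-u) * theta (e2pi u) (e2pi τ) := by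
  rw [e2pi_neg, theta_inv (e2pi_ne_zero _) (norm_e2pi_lt_one.2 hτ)]

/-- The addition formula for theta functions, in additive notation. -/
lemma theta_addition_e2pi {τ : ℂ} (hτ : 0 < τ.im) (x y u v : ℂ) :
    theta (e2pi (x + y)) (e2pi τ) * theta (e2pi (x - y)) (e2pi τ) *
        (theta (e2pi (u + v)) (e2pi τ) * theta (e2pi (u - v)) (e2pi τ)) -
      theta (e2pi (x + v)) (e2pi τ) * theta (e2pi (x - v)) (e2pi τ) *
        (theta (e2pi (u + y)) (e2pi τ) * theta (e2pi (u - y)) (e2pi τ)) -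
      e2pi (u - y) * (theta (e2pi (y + v)) (e2pi τ) * theta (e2pi (y - v)) (e2pi τ)) *
        (theta (e2pi (x + u)) (e2pi τ) * theta (e2pi (x - u)) (e2pi τ)) = 0 := by
  have hp := norm_e2pi_lt_one.2 hτ
  set T : ℂ → ℂ := fun w => theta (e2pi w) (e2pi τ) with hT
  have hd : Differentiable ℂ T := differentiable_theta_e2pi hp
  have hneg : ∀ w, T (-w) = -e2pi (-w) * T w := theta_e2pi_neg hτ
  have hadd : ∀ w, T (w + τ) = -e2pi (-w) * T w := theta_e2pi_add_base hτ
  have hone : ∀ w, T (w + 1) = T w := fun w => theta_e2pi_add_one _ _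
  have hT0 : T 0 = 0 := by simp [hT, theta_one hp]
  set G : ℂ → ℂ → ℂ := fun w α => T (w + α) * T (w - α) with hG
  have hG1 : ∀ w α, G (w + 1) α = G w α := by
    intro w α
    simp only [hG]
    rw [show w + 1 + α = w + α + 1 by ring, show w + 1 - α = w - α + 1 by ring, hone, hone]
  have hGτ : ∀ w α, G (w + τ) α = e2pi (-(2 * w)) * G w α := by
    intro w α
    simp only [hG]
    rw [show w + τ + α = w + α + τ by ring, show w + τ - α = w - α + τ by ring, hadd, hadd,
      show -(2 * w) = -(w + α) + -(w - α) by ring, e2pi_add]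
    ring
  have hGneg : ∀ w α, G (-w) α = e2pi (-(2 * w)) * G w α := by
    intro w α
    simp only [hG]
    rw [show -w + α = -(w - α) by ring, show -w - α = -(w + α) by ring, hneg, hneg,
      show -(2 * w) = -(w + α) + -(w - α) by ring, e2pi_add]
    ring
  set F : ℂ → ℂ → ℂ := fun u x => G x y * G u v - G x v * G u y - e2pi (u - y) * G y v * G x u
    with hFdef
  -- For generic u, the function F u vanishes at x = u and x = -u. It is the product of the two
  -- corresponding thetas and an entire doubly periodic, hence constant, cofactor; the zero at x = y
  -- forces this constant to be 0.
  have hgen : ∀ u, T (-(2 * u)) ≠ 0 → T (y - u) ≠ 0 → T (y + u) ≠ 0 → ∀ x, F u x = 0 := by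
    intro u h1 h2 h3 x
    have hF : Differentiable ℂ (F u) := by simp only [hFdef, hG]; fun_prop
    have hFu : F u u = 0 := by
      simp only [hFdef, hG, sub_self, hT0]; ring
    have hFnu : F u (-u) = 0 := by
      have : F u (-u) = e2pi (-(2 * u)) * F u u := by
        simp only [hFdef, hGneg u]; ring
      rw [this, hFu, mul_zero]
    obtain ⟨k, hk, hFk, hk1, hkτ⟩ := exists_eq_theta_mul hτ (μ := fun x => e2pi (-(2 * x))) hF
      (by fun_prop) (fun _ => e2pi_ne_zero _) (fun x => by simp only [hFdef, hG1])
      (fun x => by simp only [hFdef, hGτ]; ring) hFu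
    have hk0 : k (-u) = 0 := by
      have := hFk (-u)
      rw [hFnu, show -u - u = -(2 * u) by ring] at this
      exact (mul_eq_zero.1 this.symm).resolve_left h1
    obtain ⟨l, hl, hkl, hl1, hlτ⟩ := exists_eq_theta_mul hτ
      (μ := fun x => -e2pi (-(2 * x)) * e2pi (x - u)) hk
      (by fun_prop) (fun _ => mul_ne_zero (neg_ne_zero.2 (e2pi_ne_zero _)) (e2pi_ne_zero _))
      hk1 hkτ hk0
    have hlτ' : ∀ x, l (x + τ) = l x := by
      intro x
      have h6 : e2pi (-(2 * x)) * e2pi (x - u) * e2pi (x - -u) = 1 := by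
        rw [← e2pi_add, ← e2pi_add, show -(2 * x) + (x - u) + (x - -u) = 0 by ring, e2pi_zero]
      rw [hlτ]
      linear_combination l x * h6
    have hy : F u y = 0 := by
      have h5 : T (y - u) = -e2pi (y - u) * T (u - y) := by
        rw [show y - u = -(u - y) by ring, hneg]
      have h6 : e2pi (u - y) * e2pi (y - u) = 1 := by rw [← e2pi_add]; simp
      simp only [hFdef, hG, sub_self, hT0, h5, add_comm u y]
      linear_combination T (y + v) * T (y - v) * T (y + u) * T (u - y) * h6
    have hly : l y = 0 := by
      rw [hFk, hkl, sub_neg_eq_add] at hy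
      exact (mul_eq_zero.1 ((mul_eq_zero.1 hy).resolve_left h2)).resolve_left h3
    rw [hFk, hkl, eq_of_doubly_periodic hτ hl hl1 hlτ' x y, hly, mul_zero, mul_zero]
  obtain ⟨w, hw⟩ := exists_theta_ne_zero hτ
  have hFd : Differentiable ℂ fun u => F u x := by simp only [hFdef, hG]; fun_prop
  -- The exceptional u are zeros of three entire functions of u, none of them identically zero; they
  -- are divided out one at a time.
  have key := fun u => eq_zero_of_mul_eq_zero_of_entire (f := fun u => T (-(2 * u)))
    (g := fun u => T (y - u) * (T (y + u) * F u x)) (by fun_prop) (by fun_prop)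
    (fun u => by
      by_cases h1 : T (-(2 * u)) = 0
      · simp [h1]
      by_cases h2 : T (y - u) = 0
      · simp [h2]
      by_cases h3 : T (y + u) = 0
      · simp [h3]
      simp [hgen u h1 h2 h3 x]) (u₀ := -(w / 2)) (by
        simp only [show -(2 * -(w / 2)) = w by ring]; exact hw) u
  have key2 := fun u => eq_zero_of_mul_eq_zero_of_entire (f := fun u => T (y - u))
    (g := fun u => T (y + u) * F u x) (by fun_prop) (by fun_prop) key (u₀ := y - w)
    (by simp only [sub_sub_cancel]; exact hw) u
  have key3 := eq_zero_of_mul_eq_zero_of_entire (f := fun u => T (y + u))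
    (g := fun u => F u x) (by fun_prop) hFd key2 (u₀ := w - y)
    (by simp only [add_sub_cancel]; exact hw) u
  exact key3

lemma exists_base_eq_e2pi {p : ℂ} (hp0 : p ≠ 0) (hp : ‖p‖ < 1) :
    ∃ τ : ℂ, 0 < τ.im ∧ e2pi τ = p := by
  obtain ⟨τ, rfl⟩ := exists_e2pi_eq hp0
  exact ⟨τ, norm_e2pi_lt_one.1 hp, rfl⟩

/-- The addition formula: a linear relation between three values of
`w ↦ θ(w c₁; p) θ(w c₂; p)`. -/
lemma theta_three_term {p : ℂ} (hp0 : p ≠ 0) (hp : ‖p‖ < 1) {w₁ w₂ w₃ c₁ c₂ : ℂ} (h₁ : w₁ ≠ 0)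
    (h₂ : w₂ ≠ 0) (h₃ : w₃ ≠ 0) (hc₁ : c₁ ≠ 0) (hc₂ : c₂ ≠ 0) :
    theta (w₁ * c₁) p * theta (w₁ * c₂) p * theta (c₁ * c₂ * w₂ * w₃) p * theta (w₂ / w₃) p -
      theta (w₂ * c₁) p * theta (w₂ * c₂) p * theta (c₁ * c₂ * w₁ * w₃) p * theta (w₁ / w₃) p +
      w₂ / w₃ * (theta (w₃ * c₁) p * theta (w₃ * c₂) p *
        theta (c₁ * c₂ * w₁ * w₂) p * theta (w₁ / w₂) p) = 0 := by
  obtain ⟨τ, hτ, rfl⟩ := exists_base_eq_e2pi hp0 hp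
  obtain ⟨a, rfl⟩ := exists_e2pi_eq h₁
  obtain ⟨b, rfl⟩ := exists_e2pi_eq h₂
  obtain ⟨c, rfl⟩ := exists_e2pi_eq h₃
  obtain ⟨d, rfl⟩ := exists_e2pi_eq hc₁
  obtain ⟨e, rfl⟩ := exists_e2pi_eq hc₂
  -- Translating by (d + e)/2 and taking (d - e)/2 for the second variable makes the symmetric pairs
  -- x ± y equal to a + d and a + e.
  have h := theta_addition_e2pi hτ (a + (d + e) / 2) ((d - e) / 2) (b + (d + e) / 2)
    (c + (d + e) / 2)
  have hn := theta_e2pi_neg hτ (c + e)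
  rw [show a + (d + e) / 2 + (d - e) / 2 = a + d by ring,
    show a + (d + e) / 2 - (d - e) / 2 = a + e by ring,
    show b + (d + e) / 2 + (c + (d + e) / 2) = d + e + b + c by ring,
    show b + (d + e) / 2 - (c + (d + e) / 2) = b - c by ring,
    show a + (d + e) / 2 + (c + (d + e) / 2) = d + e + a + c by ring,
    show a + (d + e) / 2 - (c + (d + e) / 2) = a - c by ring,
    show b + (d + e) / 2 + (d - e) / 2 = b + d by ring,
    show b + (d + e) / 2 - (d - e) / 2 = b + e by ring,
    show (d - e) / 2 + (c + (d + e) / 2) = c + d by ring,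
    show (d - e) / 2 - (c + (d + e) / 2) = -(c + e) by ring,
    show a + (d + e) / 2 + (b + (d + e) / 2) = d + e + a + b by ring,
    show a + (d + e) / 2 - (b + (d + e) / 2) = a - b by ring, hn] at h
  have h6 : e2pi (b + e) * e2pi (-(c + e)) = e2pi (b - c) := by
    rw [← e2pi_add]; ring_nf
  simp only [← e2pi_add, ← e2pi_sub]
  linear_combination h - theta (e2pi (c + d)) (e2pi τ) * theta (e2pi (c + e)) (e2pi τ) *
    theta (e2pi (d + e + a + b)) (e2pi τ) * theta (e2pi (a - b)) (e2pi τ) * h6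

/-- The partial fraction identity for theta functions with four terms. -/
lemma theta_four_term {p : ℂ} (hp0 : p ≠ 0) (hp : ‖p‖ < 1) {z a c₁ c₂ c₃ c₄ s : ℂ} (hz : z ≠ 0)
    (ha : a ≠ 0) (h₁ : c₁ ≠ 0) (h₂ : c₂ ≠ 0) (h₃ : c₃ ≠ 0) (h₄ : c₄ ≠ 0)
    (hs : s = a * c₁ * c₂ * c₃ * c₄) (hD : theta (c₃ * c₄) p ≠ 0) :
    theta (z ^ 2) p *
      (theta (s / c₁) p * theta (s / c₂) p * theta (s / c₃) p * theta (s / c₄) p *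
          (theta (a * z) p * theta (a / z) p) -
        theta (a * c₁) p * theta (a * c₂) p * theta (a * c₃) p * theta (a * c₄) p *
          (theta (s * z) p * theta (s / z) p)) =
      a * theta (s * a) p *
        (z ^ 3 * (theta (a / z) p * theta (s * z) p *
            (theta (c₁ / z) p * theta (c₂ / z) p * theta (c₃ / z) p * theta (c₄ / z) p)) -
          z⁻¹ * (theta (a * z) p * theta (s / z) p *
            (theta (c₁ * z) p * theta (c₂ * z) p * theta (c₃ * z) p * theta (c₄ * z) p))) := by
  have hs0 : s ≠ 0 := by rw [hs]; simp [*]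
  have hzi := inv_ne_zero hz
  have hsi := inv_ne_zero hs0
  -- `θ(y) = - y θ(x)` for `y = 1 / x`
  have inv : ∀ x y : ℂ, x ≠ 0 → x * y = 1 → theta y p = -y * theta x p := by
    intro x y hx hxy
    rw [eq_inv_of_mul_eq_one_right hxy, theta_inv hx hp]
  -- Two relations eliminate through c₁, c₂ and two through c₃, c₄. Since s = a c₁c₂c₃c₄, their
  -- auxiliary thetas agree in pairs after inversion of the argument (`e4` to `e7`) and cancel in
  -- the final combination.
  have R1 := theta_three_term hp0 hp hz ha hsi h₁ h₂
  have R2 := theta_three_term hp0 hp hzi ha hsi h₁ h₂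
  have R3 := theta_three_term hp0 hp hz hzi ha h₃ h₄
  have R4 := theta_three_term hp0 hp hz hzi hsi h₃ h₄
  -- Each of the four relations has one term carrying θ(c₃c₄), so their combination yields the
  -- identity multiplied by this factor.
  refine mul_left_cancel₀ hD ?_
  have e1 : theta (c₁ * c₂ * a * s⁻¹) p = -(c₁ * c₂ * a * s⁻¹) * theta (c₃ * c₄) p :=
    inv _ _ (by simp [*]) (by rw [hs]; field_simp)
  have e2 : theta (z⁻¹ / a) p = -(z⁻¹ / a) * theta (a * z) p := inv _ _ (by simp [*]) (by field_simp)
  have e3 : theta (z / a) p = -(z / a) * theta (a / z) p := inv _ _ (by simp [*]) (by field_simp)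
  have e4 : theta (c₃ * c₄ * z⁻¹ * a) p =
      -(c₃ * c₄ * z⁻¹ * a) * theta (c₁ * c₂ * z * s⁻¹) p :=
    inv _ _ (by simp [*]) (by rw [hs]; field_simp)
  have e5 : theta (c₃ * c₄ * z * a) p =
      -(c₃ * c₄ * z * a) * theta (c₁ * c₂ * z⁻¹ * s⁻¹) p :=
    inv _ _ (by simp [*]) (by rw [hs]; field_simp)
  have e6 : theta (c₃ * c₄ * z⁻¹ * s⁻¹) p =
      -(c₃ * c₄ * z⁻¹ * s⁻¹) * theta (c₁ * c₂ * z * a) p :=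
    inv _ _ (by simp [*]) (by rw [hs]; field_simp)
  have e7 : theta (c₃ * c₄ * z * s⁻¹) p =
      -(c₃ * c₄ * z * s⁻¹) * theta (c₁ * c₂ * z⁻¹ * a) p :=
    inv _ _ (by simp [*]) (by rw [hs]; field_simp)
  have f : ∀ c, c ≠ 0 → theta (s / c) p = -(s / c) * theta (s⁻¹ * c) p := fun c hc =>
    inv _ _ (by simp [*]) (by field_simp)
  rw [f _ h₁, f _ h₂, f _ h₃, f _ h₄]
  rw [e1, e3, show a / s⁻¹ = s * a by field_simp, show z / s⁻¹ = s * z by field_simp] at R1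
  rw [e1, e2, show a / s⁻¹ = s * a by field_simp, show z⁻¹ / s⁻¹ = s / z by field_simp] at R2
  rw [e2, e3, e4, e5, show z / z⁻¹ = z ^ 2 by field_simp,
    show c₃ * c₄ * z * z⁻¹ = c₃ * c₄ by field_simp] at R3
  rw [e6, e7, show z / z⁻¹ = z ^ 2 by field_simp, show z⁻¹ / s⁻¹ = s / z by field_simp,
    show z / s⁻¹ = s * z by field_simp, show c₃ * c₄ * z * z⁻¹ = c₃ * c₄ by field_simp] at R4
  rw [mul_comm c₁ z, mul_comm c₂ z, mul_comm c₃ z, mul_comm c₄ z]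
  simp only [div_eq_inv_mul _ z] at R1 R2 R3 R4 ⊢
  generalize theta (c₃ * c₄) p = tD at *
  generalize theta (z ^ 2) p = t2 at *
  generalize theta (s * a) p = tsa at *
  generalize theta (s * z) p = tsz at *
  generalize theta (z⁻¹ * s) p = tzs at *
  generalize theta (a * z) p = taz at *
  generalize theta (z⁻¹ * a) p = tza at *
  generalize theta (z * c₁) p = t1 at *
  generalize theta (z * c₂) p = u1 at *
  generalize theta (z * c₃) p = v1 at *
  generalize theta (z * c₄) p = w1 at *
  generalize theta (z⁻¹ * c₁) p = t3 at *
  generalize theta (z⁻¹ * c₂) p = u3 at *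
  generalize theta (z⁻¹ * c₃) p = v3 at *
  generalize theta (z⁻¹ * c₄) p = w3 at *
  generalize theta (s⁻¹ * c₁) p = t4 at *
  generalize theta (s⁻¹ * c₂) p = u4 at *
  generalize theta (s⁻¹ * c₃) p = v4 at *
  generalize theta (s⁻¹ * c₄) p = w4 at *
  generalize theta (a * c₁) p = t5 at *
  generalize theta (a * c₂) p = u5 at *
  generalize theta (a * c₃) p = v5 at *
  generalize theta (a * c₄) p = w5 at *
  generalize theta (c₁ * c₂ * z * s⁻¹) p = x1 at *
  generalize theta (c₁ * c₂ * z⁻¹ * s⁻¹) p = x2 at *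
  generalize theta (c₁ * c₂ * z * a) p = x3 at *
  generalize theta (c₁ * c₂ * z⁻¹ * a) p = x4 at *
  clear e1 e2 e3 e4 e5 e6 e7 f inv
  subst hs
  linear_combination (norm := skip) -(c₃ * c₄ * a * z⁻¹ * taz * tzs * v1 * w1) * R1 +
    (c₃ * c₄ * a * z ^ 3 * tza * tsz * v3 * w3) * R2 - (a * z * t5 * u5 * tsz * tzs) * R3 +
    (z * (a * c₁ * c₂ * c₃ * c₄) ^ 2 * a * t4 * u4 * taz * tza) * R4
  field_simp
  ring

end ThetaIdentities

/-! ### The elliptic gamma function -/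

section Gamma

variable {p q : ℂ}

lemma ellGamma_mul_right (hp : ‖p‖ < 1) (hq : ‖q‖ < 1) (hq0 : q ≠ 0) {z : ℂ}
    (h : ellPoch z p q ≠ 0) : ellGamma (z * q) p q = theta z p * ellGamma z p q := by
  have h1 := ellPoch_mul_right z hp hq
  have h2 := ellPoch_mul_right (p / z) hp hq
  rw [h1] at h
  rw [ellGamma_eq, ellGamma_eq, theta, h1, show p * q / (z * q) = p / z by field_simp, h2,
    show p / z * q = p * q / z by ring]
  have := left_ne_zero_of_mul h
  have := right_ne_zero_of_mul h
  field_simp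

lemma ellGamma_ne_zero (hp : ‖p‖ < 1) (hq : ‖q‖ < 1) {z : ℂ} (hz : ‖z‖ < 1)
    (hz' : ‖p * q‖ < ‖z‖) : ellGamma z p q ≠ 0 := by
  rw [ellGamma_eq]
  refine div_ne_zero (ellPoch_ne_zero_of_norm_lt_one hp hq ?_)
    (ellPoch_ne_zero_of_norm_lt_one hp hq hz)
  rwa [norm_div, div_lt_one ((norm_nonneg _).trans_lt hz')]

lemma _root_.DifferentiableAt.ellGamma {f : ℂ → ℂ} {x : ℂ} (hf : DifferentiableAt ℂ f x)
    (hp : ‖p‖ < 1) (hq : ‖q‖ < 1) (h0 : f x ≠ 0) (h1 : ‖f x‖ < 1) :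
    DifferentiableAt ℂ (fun y => ellGamma (f y) p q) x := by
  simp only [ellGamma_eq]
  refine DifferentiableAt.div ((differentiable_ellPoch hp hq _).comp x
    ((differentiableAt_const _).div hf h0)) ((differentiable_ellPoch hp hq _).comp x hf) ?_
  exact ellPoch_ne_zero_of_norm_lt_one hp hq h1

lemma _root_.ContinuousAt.ellGamma {X : Type*} [TopologicalSpace X] {f : X → ℂ} {x : X}
    (hf : ContinuousAt f x) (hp : ‖p‖ < 1) (hq : ‖q‖ < 1) (h0 : f x ≠ 0) (h1 : ‖f x‖ < 1) :
    ContinuousAt (fun y => ellGamma (f y) p q) x :=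
  (differentiableAt_id.ellGamma hp hq h0 h1 :
    DifferentiableAt ℂ (fun y => EllipticBeta.ellGamma y p q) (f x)).continuousAt.comp hf

lemma _root_.ContinuousAt.theta {X : Type*} [TopologicalSpace X] {f : X → ℂ} {x : X}
    (hf : ContinuousAt f x) (hp : ‖p‖ < 1) (h0 : f x ≠ 0) :
    ContinuousAt (fun y => theta (f y) p) x :=
  (differentiableAt_theta hp h0).continuousAt.comp hf

end Gamma

/-! ### Contour shifts between concentric circles -/

section Contour

lemma circleIntegral_inv_smul (V : ℂ → ℂ) {R : ℝ} (hR : 0 < R) :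
    (∮ z in C(0, R), (z - 0)⁻¹ • V z) =
      2 * Real.pi * I * ∫ x in (0 : ℝ)..1, V (R * e2pi x) := by
  have h1 : (∮ z in C(0, R), (z - 0)⁻¹ • V z) =
      ∫ θ in (0 : ℝ)..2 * Real.pi, I * V (circleMap 0 R θ) := by
    rw [circleIntegral]
    refine intervalIntegral.integral_congr fun θ _ => ?_
    have := circleMap_ne_center (c := 0) (θ := θ) hR.ne'
    simp only [deriv_circleMap, circleMap_sub_center, smul_eq_mul]
    rw [← circleMap_sub_center 0 R θ, sub_zero]
    field_simp
  have h2 := intervalIntegral.integral_comp_mul_left (a := 0) (b := 1)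
    (fun θ => I * V (circleMap 0 R θ)) (c := 2 * Real.pi) (by positivity)
  rw [h1]
  simp only [mul_zero, mul_one] at h2
  rw [eq_inv_smul_iff₀ (by positivity)] at h2
  have h3 : ∀ x : ℝ, circleMap 0 R (2 * Real.pi * x) = R * e2pi x := by
    intro x
    simp only [circleMap, e2pi]
    push_cast
    ring_nf
  rw [← h2, intervalIntegral.integral_const_mul, real_smul]
  simp only [h3]
  push_cast
  ring

/-- Shifting the contour of integration from the unit circle to a concentric one. -/
lemma integral_e2pi_eq_integral_mul {V : ℂ → ℂ} {w : ℂ} (hw : 1 ≤ ‖w‖)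
    (hV : ∀ z, 1 ≤ ‖z‖ → ‖z‖ ≤ ‖w‖ → DifferentiableAt ℂ V z) :
    ∫ x in (0 : ℝ)..1, V (e2pi x) = ∫ x in (0 : ℝ)..1, V (w * e2pi x) := by
  have hw0 : w ≠ 0 := norm_pos_iff.1 (by linarith)
  have h := circleIntegral_sub_center_inv_smul_eq_of_differentiable_on_annulus_off_countable
    (c := 0) (f := V) one_pos hw Set.countable_empty
    (fun z hz => (hV z (by simpa using hz.2) (by simpa using hz.1)).continuousAt.continuousWithinAt)
    (fun z hz => hV z (by have := hz.1.2; simp at this; exact this.le)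
      (by have := hz.1.1; simp at this; exact this.le))
  rw [circleIntegral_inv_smul V (by linarith), circleIntegral_inv_smul V one_pos] at h
  have h2 := mul_left_cancel₀ two_pi_I_ne_zero h
  simp only [ofReal_one, one_mul] at h2
  rw [← h2]
  obtain ⟨y, hy⟩ := exists_e2pi_eq hw0
  -- Only the modulus of w changes the circle; its phase is a rotation, absorbed by periodicity of
  -- the integrand.
  have hwy : w = ‖w‖ * e2pi (y.re : ℂ) := by
    conv_lhs => rw [← hy, ← re_add_im y, e2pi_add]
    rw [← hy, norm_e2pi, mul_comm]
    congr 1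
    rw [e2pi, ofReal_exp]; congr 1
    push_cast
    linear_combination (2 * Real.pi * (y.im : ℂ)) * I_sq
  have hper : Function.Periodic (fun x : ℝ => V (‖w‖ * e2pi x)) 1 := by
    intro x
    simp only [ofReal_add, ofReal_one, e2pi_add_one]
  have h3 := hper.intervalIntegral_add_eq 0 y.re
  have h4 := intervalIntegral.integral_comp_add_right (a := 0) (b := 1)
    (fun x : ℝ => V (‖w‖ * e2pi x)) y.re
  simp only [zero_add] at h3 h4
  rw [h3, add_comm y.re 1, ← h4]
  refine intervalIntegral.integral_congr fun x _ => ?_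
  conv_rhs => rw [hwy]
  push_cast
  rw [e2pi_add, mul_assoc, mul_comm (e2pi x)]

end Contour

/-! ### The elliptic beta integral and its difference equation -/

section Kernel

/-- The integrand of the elliptic beta integral. -/
def betaKernel (p q : ℂ) (t : Fin 6 → ℂ) (z : ℂ) : ℂ :=
  (∏ j, ellGamma (t j * z) p q * ellGamma (t j / z) p q) * (theta (z ^ 2) p * theta (z ^ 2)⁻¹ q)

/-- The elliptic beta integral, over the unit circle. -/
def betaInt (p q : ℂ) (t : Fin 6 → ℂ) : ℂ := ∫ x in (0 : ℝ)..1, betaKernel p q t (e2pi x)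

variable {p q : ℂ} {t : Fin 6 → ℂ}

lemma norm_mul_lt_one {a z : ℂ} (ha : ‖a‖ < 1) (hz : ‖z‖ ≤ 1) : ‖a * z‖ < 1 := by
  rw [norm_mul]
  exact (mul_le_of_le_one_right (norm_nonneg _) hz).trans_lt ha

lemma norm_div_lt_one {a z : ℂ} (ha : ‖a‖ < 1) (hz : 1 ≤ ‖z‖) : ‖a / z‖ < 1 := by
  rw [norm_div]
  exact (div_le_self (norm_nonneg _) hz).trans_lt ha

/-- Multiplying an argument of Γ by q produces a theta factor in base p. Once the common gamma
factors are removed, what remains is `theta_four_term` with a = t₀, c_j = t_j for j = 1, …, 4 and s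
= p / t₅. The unshifted parameters multiply to p, so that each shifted set multiplies to pq. -/
lemma betaKernel_difference (hp0 : p ≠ 0) (hp : ‖p‖ < 1) (hq0 : q ≠ 0) (hq : ‖q‖ < 1)
    (ht : ∀ j, ‖t j‖ < 1) (hprod : ∏ j, t j = p) (hD : theta (t 3 * t 4) p ≠ 0) {z : ℂ}
    (hz : ‖z‖ = 1) :
    theta (t 5 * t 1) p * theta (t 5 * t 2) p * theta (t 5 * t 3) p * theta (t 5 * t 4) p *
        betaKernel p q (Function.update t 0 (t 0 * q)) z -
      theta (t 0 * t 1) p * theta (t 0 * t 2) p * theta (t 0 * t 3) p * theta (t 0 * t 4) p *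
        betaKernel p q (Function.update t 5 (t 5 * q)) z =
      t 0 * theta (t 5 / t 0) p *
        ((q⁻¹ * z)⁻¹ * theta (((q⁻¹ * z) ^ 2)⁻¹) q *
            (∏ j, ellGamma (t j * q * (q⁻¹ * z)) p q * ellGamma (t j / (q⁻¹ * z)) p q) -
          z⁻¹ * theta (z ^ 2)⁻¹ q *
            ∏ j, ellGamma (t j * q * z) p q * ellGamma (t j / z) p q) := by
  have hz0 : z ≠ 0 := norm_pos_iff.1 (by linarith)
  have ht0 : ∀ j, t j ≠ 0 := by
    intro j hj
    exact hp0 (hprod ▸ Finset.prod_eq_zero (Finset.mem_univ j) hj)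
  have hE1 : ∀ j, ellGamma (t j * q * z) p q = theta (t j * z) p * ellGamma (t j * z) p q := by
    intro j
    rw [← ellGamma_mul_right hp hq hq0 (ellPoch_ne_zero_of_norm_lt_one hp hq
      (norm_mul_lt_one (ht j) hz.le))]
    ring_nf
  have hE2 : ∀ j, ellGamma (t j * q / z) p q = theta (t j / z) p * ellGamma (t j / z) p q := by
    intro j
    rw [← ellGamma_mul_right hp hq hq0 (ellPoch_ne_zero_of_norm_lt_one hp hq
      (norm_div_lt_one (ht j) hz.ge))]
    ring_nf
  have hE3 : ∀ j, ellGamma (t j / (q⁻¹ * z)) p q =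
      theta (t j / z) p * ellGamma (t j / z) p q := by
    intro j; rw [← hE2]; congr 1; field_simp
  have hE4 : ∀ j, ellGamma (t j * q * (q⁻¹ * z)) p q = ellGamma (t j * z) p q := by
    intro j; congr 1; field_simp
  have hth : theta (((q⁻¹ * z) ^ 2)⁻¹) q = q⁻¹ * z ^ 4 * theta (z ^ 2)⁻¹ q := by
    rw [show ((q⁻¹ * z) ^ 2)⁻¹ = (z ^ 2)⁻¹ * q * q by field_simp,
      theta_mul_base (by simp [*]) hq0 hq, theta_mul_base (by simp [*]) hq0 hq]
    field_simp
  have h4 := theta_four_term hp0 hp (z := z) (s := p / t 5) hz0 (ht0 0) (ht0 1) (ht0 2) (ht0 3)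
    (ht0 4) (by rw [← hprod, Fin.prod_univ_six]; field_simp [ht0 5]) hD
  have r1 : ∀ x, theta (p / t 5 / x) p = theta (t 5 * x) p := fun x => by
    rw [div_div, theta_div_self hp0]
  have r2 : theta (p / t 5 * z) p = theta (t 5 / z) p := by
    rw [← theta_div_self (z := t 5 / z) hp0]; congr 1; field_simp
  have r3 : theta (p / t 5 * t 0) p = theta (t 5 / t 0) p := by
    rw [← theta_div_self (z := t 5 / t 0) hp0]; congr 1; field_simp
  simp only [r1, r2, r3] at h4
  simp only [betaKernel, Fin.prod_univ_six, Function.update_self, ne_eq, Fin.reduceEq,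
    not_false_eq_true, Function.update_of_ne, hE1, hE2, hE3, hE4, hth]
  generalize theta (t 0 * z) p = a0 at *
  generalize theta (t 0 / z) p = a0' at *
  generalize theta (t 5 * z) p = a5 at *
  generalize theta (t 5 / z) p = a5' at *
  generalize theta (t 5 / t 0) p = K at *
  generalize theta (z ^ 2) p = Z at *
  generalize theta (z ^ 2)⁻¹ q = Y at *
  have hqq : (q⁻¹ * z)⁻¹ * (q⁻¹ * z ^ 4) = z ^ 3 := by field_simp
  linear_combination
    (ellGamma (t 0 * z) p q * ellGamma (t 0 / z) p q * (ellGamma (t 1 * z) p q *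
      ellGamma (t 1 / z) p q) * (ellGamma (t 2 * z) p q * ellGamma (t 2 / z) p q) *
      (ellGamma (t 3 * z) p q * ellGamma (t 3 / z) p q) * (ellGamma (t 4 * z) p q *
      ellGamma (t 4 / z) p q) * (ellGamma (t 5 * z) p q * ellGamma (t 5 / z) p q)) * Y *
    (h4 - t 0 * K * (a0' * a5' * (theta (t 1 / z) p * theta (t 2 / z) p * theta (t 3 / z) p *
      theta (t 4 / z) p)) * hqq)

lemma continuous_betaKernel (hp : ‖p‖ < 1) (hq : ‖q‖ < 1) (ht0 : ∀ j, t j ≠ 0)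
    (ht : ∀ j, ‖t j‖ < 1) : Continuous fun x : ℝ => betaKernel p q t (e2pi x) := by
  have hc : Continuous fun x : ℝ => e2pi x := continuous_e2pi.comp continuous_ofReal
  refine continuous_iff_continuousAt.2 fun x => ?_
  have h1 := norm_e2pi_real x
  have h0 := e2pi_ne_zero x
  unfold betaKernel
  refine ContinuousAt.mul (tendsto_finsetProd _ fun j _ => ?_) ?_
  · exact ContinuousAt.mul
      (((continuousAt_const).mul hc.continuousAt).ellGamma hp hq (mul_ne_zero (ht0 j) h0)
        (norm_mul_lt_one (ht j) h1.le))
      (((continuousAt_const).div hc.continuousAt h0).ellGamma hp hq (div_ne_zero (ht0 j) h0)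
        (norm_div_lt_one (ht j) h1.ge))
  · exact ContinuousAt.mul ((hc.continuousAt.pow 2).theta hp (pow_ne_zero _ h0))
      (((hc.continuousAt.pow 2).inv₀ (pow_ne_zero _ h0)).theta hq (inv_ne_zero (pow_ne_zero _ h0)))

/-- The right side of `betaKernel_difference` is a multiple of V(z/q) - V(z). On 1 ≤ |z| ≤ 1/|q|
both t_j q z and t_j / z stay in the unit disc, so V has no pole there and the two integrals agree.
-/
lemma betaInt_difference (hp0 : p ≠ 0) (hp : ‖p‖ < 1) (hq0 : q ≠ 0) (hq : ‖q‖ < 1)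
    (ht : ∀ j, ‖t j‖ < 1) (hprod : ∏ j, t j = p) (hD : theta (t 3 * t 4) p ≠ 0) :
    theta (t 5 * t 1) p * theta (t 5 * t 2) p * theta (t 5 * t 3) p * theta (t 5 * t 4) p *
        betaInt p q (Function.update t 0 (t 0 * q)) =
      theta (t 0 * t 1) p * theta (t 0 * t 2) p * theta (t 0 * t 3) p * theta (t 0 * t 4) p *
        betaInt p q (Function.update t 5 (t 5 * q)) := by
  have ht0 : ∀ j, t j ≠ 0 := by
    intro j hj
    exact hp0 (hprod ▸ Finset.prod_eq_zero (Finset.mem_univ j) hj)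
  have hqn := norm_pos_iff.2 hq0
  set V : ℂ → ℂ := fun z => z⁻¹ * theta (z ^ 2)⁻¹ q *
            ∏ j, ellGamma (t j * q * z) p q * ellGamma (t j / z) p q with hV
  have hVd : ∀ z, 1 ≤ ‖z‖ → ‖z‖ ≤ ‖q⁻¹‖ → DifferentiableAt ℂ V z := by
    intro z h1 h2
    have hz0 : z ≠ 0 := norm_pos_iff.1 (by linarith)
    refine DifferentiableAt.mul (DifferentiableAt.mul (differentiableAt_inv hz0) ?_) ?_
    · exact DifferentiableAt.theta (by fun_prop (disch := simpa)) hq (by simpa)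
    · refine DifferentiableAt.fun_finsetProd fun j _ => DifferentiableAt.mul ?_ ?_
      · refine DifferentiableAt.ellGamma (by fun_prop) hp hq (by simp [*]) ?_
        rw [mul_assoc]
        refine norm_mul_lt_one (ht j) ?_
        rw [norm_inv] at h2
        rw [norm_mul, mul_comm]
        exact (le_div_iff₀ hqn).1 (by rwa [one_div])
      · exact DifferentiableAt.ellGamma (by fun_prop (disch := simpa)) hp hq (by simp [*])
          (norm_div_lt_one (ht j) h1)
  have hshift := integral_e2pi_eq_integral_mul (V := V) (w := q⁻¹)
    (by rw [norm_inv]; exact (one_le_inv₀ hqn).2 hq.le) hVd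
  have hcV1 : Continuous fun x : ℝ => V (e2pi x) := by
    refine continuous_iff_continuousAt.2 fun x => ?_
    exact ContinuousAt.comp (f := fun x : ℝ => e2pi x)
      (hVd _ (norm_e2pi_real x).ge (by
        rw [norm_e2pi_real, norm_inv]; exact (one_le_inv₀ hqn).2 hq.le)).continuousAt
      (continuous_e2pi.comp continuous_ofReal).continuousAt
  have hcV2 : Continuous fun x : ℝ => V (q⁻¹ * e2pi x) := by
    refine continuous_iff_continuousAt.2 fun x => ?_
    have hn : ‖q⁻¹ * e2pi x‖ = ‖q⁻¹‖ := by rw [norm_mul, norm_e2pi_real, mul_one]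
    exact ContinuousAt.comp (f := fun x : ℝ => q⁻¹ * e2pi x)
      (hVd _ (by rw [hn, norm_inv]; exact (one_le_inv₀ hqn).2 hq.le) hn.le).continuousAt
      (continuous_const.mul (continuous_e2pi.comp continuous_ofReal)).continuousAt
  have hu : ∀ i, Continuous fun x : ℝ =>
      betaKernel p q (Function.update t i (t i * q)) (e2pi x) := by
    intro i
    refine continuous_betaKernel hp hq (fun j => ?_) fun j => ?_
    · rcases eq_or_ne j i with rfl | h
      · simp [*]
      · simp [*]
    · rcases eq_or_ne j i with rfl | h
      · simpa using norm_mul_lt_one (ht j) hq.le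
      · simpa [h] using ht j
  rw [← sub_eq_zero, betaInt, betaInt, ← intervalIntegral.integral_const_mul,
    ← intervalIntegral.integral_const_mul, ← intervalIntegral.integral_sub]
  · calc _ = ∫ x in (0 : ℝ)..1, t 0 * theta (t 5 / t 0) p * (V (q⁻¹ * e2pi x) - V (e2pi x)) := by
          refine intervalIntegral.integral_congr fun x _ => ?_
          exact betaKernel_difference hp0 hp hq0 hq ht hprod hD (norm_e2pi_real x)
      _ = 0 := by
          rw [intervalIntegral.integral_const_mul, intervalIntegral.integral_sub
            (hcV2.intervalIntegrable _ _) (hcV1.intervalIntegrable _ _), hshift, sub_self, mul_zero]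
  · exact ((hu 0).const_mul _).intervalIntegrable _ _
  · exact ((hu 5).const_mul _).intervalIntegrable _ _

end Kernel

/-! ### The normalised integral: symmetry and shift invariance -/

section Ratio

/-- The product `∏_{j < m} Γ(t_j t_m; p, q)`. -/
def pairProd (p q : ℂ) (t : Fin 6 → ℂ) : ℂ :=
  ∏ j : Fin 6, ∏ m ∈ Finset.Ioi j, ellGamma (t j * t m) p q

/-- The quotient of the elliptic beta integral by the product of elliptic gamma functions. -/
def betaRatio (p q : ℂ) (t : Fin 6 → ℂ) : ℂ := betaInt p q t / pairProd p q t

variable {p q : ℂ} {t t' : Fin 6 → ℂ}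

lemma prod_Ioi_fin_six (f : Fin 6 → Fin 6 → ℂ) :
    ∏ j : Fin 6, ∏ m ∈ Finset.Ioi j, f j m =
      f 0 1 * f 0 2 * f 0 3 * f 0 4 * f 0 5 * (f 1 2 * f 1 3 * f 1 4 * f 1 5) *
        (f 2 3 * f 2 4 * f 2 5) * (f 3 4 * f 3 5) * f 4 5 := by
  have h0 : Finset.Ioi (0 : Fin 6) = {1, 2, 3, 4, 5} := by decide
  have h1 : Finset.Ioi (1 : Fin 6) = {2, 3, 4, 5} := by decide
  have h2 : Finset.Ioi (2 : Fin 6) = {3, 4, 5} := by decide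
  have h3 : Finset.Ioi (3 : Fin 6) = {4, 5} := by decide
  have h4 : Finset.Ioi (4 : Fin 6) = {5} := by decide
  have h5 : Finset.Ioi (5 : Fin 6) = ∅ := by decide
  rw [Fin.prod_univ_six, h0, h1, h2, h3, h4, h5]
  simp [mul_assoc]

lemma betaInt_comp_perm (σ : Equiv.Perm (Fin 6)) : betaInt p q (t ∘ σ) = betaInt p q t := by
  unfold betaInt betaKernel
  refine intervalIntegral.integral_congr fun x _ => ?_
  simp only [Function.comp_apply]
  rw [Equiv.prod_comp σ fun j => ellGamma (t j * e2pi x) p q * ellGamma (t j / e2pi x) p q]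

/-- These transpositions bring the parameter to be varied to position 0 and leave position 5, which
the product condition determines, in place. -/
lemma pairProd_comp_swap (m : Fin 6) (hm : m ≠ 5) :
    pairProd p q (t ∘ Equiv.swap 0 m) = pairProd p q t := by
  unfold pairProd
  rw [prod_Ioi_fin_six fun j m => ellGamma (t j * t m) p q,
    prod_Ioi_fin_six fun j m' => ellGamma ((t ∘ Equiv.swap 0 m) j * (t ∘ Equiv.swap 0 m) m') p q]
  fin_cases m
  · simp
  · simp [Equiv.swap_apply_def, mul_comm (t 1) (t 0)]
    ring_nf; simp
  · simp [Equiv.swap_apply_def, mul_comm (t 2) (t 0), mul_comm (t 2) (t 1), mul_comm (t 1) (t 0)]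
    ring_nf; simp
  · simp [Equiv.swap_apply_def, mul_comm (t 3) (t 0), mul_comm (t 3) (t 1), mul_comm (t 3) (t 2),
      mul_comm (t 1) (t 0), mul_comm (t 2) (t 0)]
    ring_nf; simp
  · simp [Equiv.swap_apply_def, mul_comm (t 4) (t 0), mul_comm (t 4) (t 1), mul_comm (t 4) (t 2),
      mul_comm (t 4) (t 3), mul_comm (t 1) (t 0), mul_comm (t 2) (t 0), mul_comm (t 3) (t 0)]
    ring
  · exact absurd rfl hm

lemma betaRatio_comp_swap (m : Fin 6) (hm : m ≠ 5) :
    betaRatio p q (t ∘ Equiv.swap 0 m) = betaRatio p q t := by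
  rw [betaRatio, betaInt_comp_perm, pairProd_comp_swap m hm, betaRatio]

lemma ne_zero_of_prod_eq {a : ℂ} (ha : a ≠ 0) (hprod : ∏ j, t j = a) (j : Fin 6) : t j ≠ 0 :=
  fun hj => ha (hprod ▸ Finset.prod_eq_zero (Finset.mem_univ j) hj)

/-- The four remaining parameters have modulus below 1. For a = pq this puts t_j t_k in the annulus
|pq| < |z| < 1, where Γ has neither zeros nor poles. -/
lemma norm_prod_lt_norm_pair {a : ℂ} (ha : a ≠ 0) (ht : ∀ j, ‖t j‖ < 1) (hprod : ∏ j, t j = a)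
    {j k : Fin 6} (hjk : j ≠ k) : ‖a‖ < ‖t j * t k‖ := by
  have h0 := ne_zero_of_prod_eq ha hprod
  have hk : k ∈ Finset.univ.erase j := by simp [hjk.symm]
  rw [← hprod, ← Finset.mul_prod_erase _ _ (Finset.mem_univ j), ← Finset.mul_prod_erase _ _ hk,
    ← mul_assoc, norm_mul]
  refine mul_lt_of_lt_one_right (norm_pos_iff.2 (mul_ne_zero (h0 _) (h0 _))) ?_
  rw [norm_prod]
  calc _ < ∏ i ∈ (Finset.univ.erase j).erase k, (1 : ℝ) := by
        refine Finset.prod_lt_prod_of_nonempty (fun i _ => norm_pos_iff.2 (h0 i))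
          (fun i _ => ht i) ?_
        rw [← Finset.card_pos, Finset.card_erase_of_mem hk,
          Finset.card_erase_of_mem (Finset.mem_univ j)]
        simp
    _ = 1 := by simp

lemma pair_ellGamma_ne_zero (hp0 : p ≠ 0) (hp : ‖p‖ < 1) (hq0 : q ≠ 0) (hq : ‖q‖ < 1)
    (ht : ∀ j, ‖t j‖ < 1) (hprod : ∏ j, t j = p * q) {j k : Fin 6} (hjk : j ≠ k) :
    ellGamma (t j * t k) p q ≠ 0 :=
  ellGamma_ne_zero hp hq (norm_mul_lt_one (ht j) (ht k).le)
    (norm_prod_lt_norm_pair (mul_ne_zero hp0 hq0) ht hprod hjk)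

lemma pairProd_ne_zero (hp0 : p ≠ 0) (hp : ‖p‖ < 1) (hq0 : q ≠ 0) (hq : ‖q‖ < 1)
    (ht : ∀ j, ‖t j‖ < 1) (hprod : ∏ j, t j = p * q) : pairProd p q t ≠ 0 := by
  refine Finset.prod_ne_zero_iff.2 fun j _ => Finset.prod_ne_zero_iff.2 fun m hm => ?_
  exact pair_ellGamma_ne_zero hp0 hp hq0 hq ht hprod (Finset.mem_Ioi.1 hm).ne

/-- Invariance of the normalised integral under `t₀ ↦ q t₀`, `t₅ ↦ t₅ / q`. -/
lemma betaRatio_shift (hp0 : p ≠ 0) (hp : ‖p‖ < 1) (hq0 : q ≠ 0) (hq : ‖q‖ < 1)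
    (ht : ∀ j, ‖t j‖ < 1) (hprod : ∏ j, t j = p) (hD : theta (t 3 * t 4) p ≠ 0) :
    betaRatio p q (Function.update t 0 (t 0 * q)) =
      betaRatio p q (Function.update t 5 (t 5 * q)) := by
  have hd := betaInt_difference hp0 hp hq0 hq ht hprod hD
  have hadm : ∀ i, (∀ j, ‖Function.update t i (t i * q) j‖ < 1) ∧
      ∏ j, Function.update t i (t i * q) j = p * q := by
    intro i
    constructor
    · intro j
      rcases eq_or_ne j i with rfl | h
      · simpa using norm_mul_lt_one (ht j) hq.le
      · simpa [h] using ht j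
    · rw [Finset.prod_update_of_mem (Finset.mem_univ i), ← hprod, Finset.sdiff_singleton_eq_erase,
        ← Finset.mul_prod_erase _ t (Finset.mem_univ i)]
      ring
  have hR0 := pairProd_ne_zero hp0 hp hq0 hq (hadm 0).1 (hadm 0).2
  have hR5 := pairProd_ne_zero hp0 hp hq0 hq (hadm 5).1 (hadm 5).2
  have hsh : ∀ i j, ellGamma (t i * q * t j) p q =
      theta (t i * t j) p * ellGamma (t i * t j) p q := by
    intro i j
    rw [← ellGamma_mul_right hp hq hq0 (ellPoch_ne_zero_of_norm_lt_one hp hq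
      (norm_mul_lt_one (ht i) (ht j).le))]
    ring_nf
  have hsh' : ∀ i j, ellGamma (t i * (t j * q)) p q =
      theta (t j * t i) p * ellGamma (t i * t j) p q := by
    intro i j
    rw [mul_comm (t j) (t i), ← ellGamma_mul_right hp hq hq0 (ellPoch_ne_zero_of_norm_lt_one hp hq
      (norm_mul_lt_one (ht i) (ht j).le))]
    ring_nf
  have e05 : theta (t 0 * t 5) p = theta (t 5 * t 0) p := by rw [mul_comm]
  -- The product of gamma functions satisfies the same difference equation as the integral, with the
  -- same theta coefficients.
  have hR : theta (t 5 * t 1) p * theta (t 5 * t 2) p * theta (t 5 * t 3) p *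
        theta (t 5 * t 4) p * pairProd p q (Function.update t 0 (t 0 * q)) =
      theta (t 0 * t 1) p * theta (t 0 * t 2) p * theta (t 0 * t 3) p * theta (t 0 * t 4) p *
        pairProd p q (Function.update t 5 (t 5 * q)) := by
    unfold pairProd
    rw [prod_Ioi_fin_six fun j m => ellGamma (Function.update t 0 (t 0 * q) j *
        Function.update t 0 (t 0 * q) m) p q, prod_Ioi_fin_six fun j m =>
        ellGamma (Function.update t 5 (t 5 * q) j * Function.update t 5 (t 5 * q) m) p q]
    simp only [Function.update_self, ne_eq, Fin.reduceEq, not_false_eq_true,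
      Function.update_of_ne, hsh, hsh', e05]
    ring
  -- The theta is a factor of Γ(q t₀ t_m), which is nonzero because the shifted parameters are
  -- admissible.
  have hth : ∀ m, m ≠ 0 → theta (t 0 * t m) p ≠ 0 := by
    intro m hm
    have h := pair_ellGamma_ne_zero hp0 hp hq0 hq (hadm 0).1 (hadm 0).2 hm.symm
    rw [Function.update_self, Function.update_of_ne hm, hsh] at h
    exact left_ne_zero_of_mul h
  have hA : theta (t 0 * t 1) p * theta (t 0 * t 2) p * theta (t 0 * t 3) p *
      theta (t 0 * t 4) p ≠ 0 :=
    mul_ne_zero (mul_ne_zero (mul_ne_zero (hth 1 (by decide)) (hth 2 (by decide)))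
      (hth 3 (by decide))) (hth 4 (by decide))
  have hB := left_ne_zero_of_mul (hR ▸ mul_ne_zero hA hR5)
  rw [betaRatio, betaRatio, ← mul_div_mul_left _ _ hB, hd, hR, mul_div_mul_left _ _ hA]

end Ratio

/-! ### Holomorphic dependence on the parameters -/

section Holomorphy

/-- Holomorphic dependence of an integral on a parameter. -/
lemma differentiableOn_integral_param {F : ℂ → ℝ → ℂ} {S : Set ℂ} (hS : IsOpen S)
    (hc : ∀ s ∈ S, ∀ x, ContinuousAt (Function.uncurry F) (s, x))
    (hd : ∀ x, DifferentiableOn ℂ (fun s => F s x) S) :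
    DifferentiableOn ℂ (fun s => ∫ x in (0 : ℝ)..1, F s x) S := by
  intro s₀ hs₀
  obtain ⟨R, hR, hRS⟩ := Metric.nhds_basis_closedBall.mem_iff.1 (hS.mem_nhds hs₀)
  have hr : 0 < R / 2 := by positivity
  have hK : IsCompact (Metric.closedBall s₀ R ×ˢ Set.Icc (0 : ℝ) 1) :=
    (isCompact_closedBall _ _).prod isCompact_Icc
  obtain ⟨M, hM⟩ := hK.exists_bound_of_continuousOn (f := Function.uncurry F)
    (fun y hy => (hc y.1 (hRS hy.1) y.2).continuousWithinAt)
  have hcx : ∀ s ∈ S, Continuous (F s) := fun s hs => continuous_iff_continuousAt.2 fun x =>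
    (hc s hs x).comp (f := fun x => (s, x)) (by fun_prop)
  have hballS : ∀ s ∈ Metric.ball s₀ (R / 2), Metric.closedBall s (R / 2) ⊆ Metric.closedBall s₀ R :=
    fun s hs => Metric.closedBall_subset_closedBall' (by
      rw [Metric.mem_ball] at hs; linarith)
  have hdAt : ∀ s ∈ S, ∀ x, DifferentiableAt ℂ (fun s => F s x) s := fun s hs x =>
    (hd x).differentiableAt (hS.mem_nhds hs)
  -- The derivative in the parameter is a limit of difference quotients along the steps R/(n+2),
  -- each continuous in x.
  have hmeas : MeasureTheory.AEStronglyMeasurable (fun x => deriv (fun s => F s x) s₀)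
      (MeasureTheory.volume.restrict (Set.uIoc (0 : ℝ) 1)) := by
    set h : ℕ → ℂ := fun n => ((R / (n + 2) : ℝ) : ℂ) with hh
    have hpos : ∀ n : ℕ, 0 < R / (n + 2) := fun n => by positivity
    have hlim : Tendsto h atTop (𝓝[≠] 0) := by
      refine tendsto_nhdsWithin_iff.2 ⟨?_, .of_forall fun n => ?_⟩
      · have h1 : Tendsto (fun n : ℕ => R / ((n : ℝ) + 2)) atTop (𝓝 0) :=
          (tendsto_natCast_atTop_atTop.atTop_add tendsto_const_nhds).const_div_atTop R
        have h2 := (continuous_ofReal.tendsto 0).comp h1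
        rwa [ofReal_zero] at h2
      · exact ofReal_ne_zero.2 (hpos n).ne'
    refine aestronglyMeasurable_of_tendsto_ae atTop
      (f := fun n x => (h n)⁻¹ • (F (s₀ + h n) x - F s₀ x)) (fun n => ?_) (.of_forall fun x => ?_)
    · refine Continuous.aestronglyMeasurable ?_
      have hm : s₀ + h n ∈ S := hRS ?_
      · have := hcx _ hm
        have := hcx _ hs₀
        fun_prop
      rw [Metric.mem_closedBall, dist_eq_norm, add_sub_cancel_left, hh, norm_real, Real.norm_eq_abs,
        abs_of_pos (hpos n)]
      exact div_le_self hR.le (by linarith [(Nat.cast_nonneg n : (0 : ℝ) ≤ n)])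
    · exact ((hdAt s₀ hs₀ x).hasDerivAt.tendsto_slope_zero).comp hlim
  -- The dominating constant is Cauchy's estimate: a bound M on the disc of radius R gives M / (R/2)
  -- for the derivative on the disc of half the radius.
  refine (intervalIntegral.hasDerivAt_integral_of_dominated_loc_of_deriv_le
    (F' := fun s x => deriv (fun s => F s x) s) (bound := fun _ => M / (R / 2))
    (Metric.ball_mem_nhds s₀ hr) ?_ ((hcx s₀ hs₀).intervalIntegrable _ _) hmeas
    (.of_forall fun x hx s hs => ?_) intervalIntegrable_const
    (.of_forall fun x hx s hs => ?_)).2.differentiableAt.differentiableWithinAt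
  · filter_upwards [hS.mem_nhds hs₀] with s hs using (hcx s hs).aestronglyMeasurable
  · rw [Set.uIoc_of_le zero_le_one] at hx
    refine Complex.norm_deriv_le_of_forall_mem_sphere_norm_le hr ?_ fun w hw => ?_
    · refine DifferentiableOn.diffContOnCl ?_
      rw [closure_ball _ hr.ne']
      exact (hd x).mono ((hballS s hs).trans hRS)
    · exact hM (w, x) ⟨hballS s hs (Metric.sphere_subset_closedBall hw), hx.1.le, hx.2⟩
  · exact (hdAt s (hRS (hballS s hs (Metric.mem_closedBall_self hr.le))) x).hasDerivAt

variable {p q : ℂ}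

lemma differentiableOn_betaRatio (hp0 : p ≠ 0) (hp : ‖p‖ < 1) (hq0 : q ≠ 0) (hq : ‖q‖ < 1)
    {t : ℂ → Fin 6 → ℂ} {S : Set ℂ} (hS : IsOpen S)
    (hd : ∀ j, DifferentiableOn ℂ (fun s => t s j) S) (ht : ∀ s ∈ S, ∀ j, ‖t s j‖ < 1)
    (hprod : ∀ s ∈ S, ∏ j, t s j = p * q) :
    DifferentiableOn ℂ (fun s => betaRatio p q (t s)) S := by
  have ht0 : ∀ s ∈ S, ∀ j, t s j ≠ 0 := fun s hs =>
    ne_zero_of_prod_eq (mul_ne_zero hp0 hq0) (hprod s hs)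
  have hdA : ∀ s ∈ S, ∀ j, DifferentiableAt ℂ (fun s => t s j) s := fun s hs j =>
    (hd j).differentiableAt (hS.mem_nhds hs)
  refine DifferentiableOn.div ?_ ?_ fun s hs =>
    pairProd_ne_zero hp0 hp hq0 hq (ht s hs) (hprod s hs)
  · refine differentiableOn_integral_param hS (fun s hs x => ?_) fun x s hs => ?_
    · have h1 := norm_e2pi_real x
      have h0 := e2pi_ne_zero x
      have hc : ContinuousAt (fun y : ℂ × ℝ => e2pi y.2) (s, x) := by fun_prop
      have hct : ∀ j, ContinuousAt (fun y : ℂ × ℝ => t y.1 j) (s, x) := fun j =>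
        ContinuousAt.comp (g := fun s => t s j) (f := fun y : ℂ × ℝ => y.1)
          (hdA s hs j).continuousAt continuousAt_fst
      unfold Function.uncurry betaKernel
      refine ContinuousAt.mul (tendsto_finsetProd _ fun j _ => ?_) ?_
      · exact ContinuousAt.mul
          (((hct j).mul hc).ellGamma hp hq (mul_ne_zero (ht0 s hs j) h0)
            (norm_mul_lt_one (ht s hs j) h1.le))
          (((hct j).div hc h0).ellGamma hp hq (div_ne_zero (ht0 s hs j) h0)
            (norm_div_lt_one (ht s hs j) h1.ge))
      · exact ContinuousAt.mul ((hc.pow 2).theta hp (pow_ne_zero _ h0))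
          (((hc.pow 2).inv₀ (pow_ne_zero _ h0)).theta hq (inv_ne_zero (pow_ne_zero _ h0)))
    · have h1 := norm_e2pi_real x
      have h0 := e2pi_ne_zero x
      unfold betaKernel
      refine DifferentiableAt.differentiableWithinAt (DifferentiableAt.mul
        (DifferentiableAt.fun_finsetProd fun j _ => ?_) (differentiableAt_const _))
      exact DifferentiableAt.mul
          (((hdA s hs j).mul_const _).ellGamma hp hq (mul_ne_zero (ht0 s hs j) h0)
            (norm_mul_lt_one (ht s hs j) h1.le))
          (((hdA s hs j).div_const _).ellGamma hp hq (div_ne_zero (ht0 s hs j) h0)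
            (norm_div_lt_one (ht s hs j) h1.ge))
  · unfold pairProd
    refine fun s hs => DifferentiableAt.differentiableWithinAt
      (DifferentiableAt.fun_finsetProd fun j _ => DifferentiableAt.fun_finsetProd fun m _ => ?_)
    exact ((hdA s hs j).mul (hdA s hs m)).ellGamma hp hq
      (mul_ne_zero (ht0 s hs j) (ht0 s hs m)) (norm_mul_lt_one (ht s hs j) (ht s hs m).le)

end Holomorphy

/-! ### Independence of the parameters -/

section Constancy

variable {p q : ℂ} {t t' : Fin 6 → ℂ}

lemma norm_e2pi_le_iff {x y : ℂ} : ‖e2pi x‖ < ‖e2pi y‖ ↔ y.im < x.im := by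
  have := norm_e2pi_lt_one (x := x - y)
  rwa [e2pi_sub, norm_div, div_lt_one (norm_pos_iff.2 (e2pi_ne_zero y)), sub_im, sub_pos] at this

/-- With t₁, …, t₄ fixed, write t₀ = `e2pi x` and t₅ = `e2pi (β - x)`; the admissible x form the
strip 0 < Im x < Im β. The bound r⁴ > |p| gives |t₁t₂t₃t₄| > |p|, which says exactly that the strip
is higher than Im σ, where q = `e2pi σ`. Hence the ratio, with periods 1 and σ, is constant on it.
-/
lemma betaRatio_eq_of_eq_off_zero (hp0 : p ≠ 0) (hp : ‖p‖ < 1) (hq0 : q ≠ 0) (hq : ‖q‖ < 1)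
    {r : ℝ} (hr0 : 0 < r) (hr : ‖p‖ < r ^ 4) (ht : ∀ j, ‖t j‖ < 1)
    (hprod : ∏ j, t j = p * q) (htr : ∀ j, j ≠ 5 → r < ‖t j‖) (ht' : ∀ j, ‖t' j‖ < 1)
    (hprod' : ∏ j, t' j = p * q) (heq : ∀ j, j ≠ 0 → j ≠ 5 → t j = t' j) :
    betaRatio p q t = betaRatio p q t' := by
  have hpq0 := mul_ne_zero hp0 hq0
  have ht0 := ne_zero_of_prod_eq hpq0 hprod
  have ht0' := ne_zero_of_prod_eq hpq0 hprod'
  set C := t 1 * t 2 * t 3 * t 4 with hC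
  have hC0 : C ≠ 0 := by simp [hC, ht0]
  have hr1 : r < 1 := (htr 0 (by decide)).trans (ht 0)
  have hCn : ‖p‖ < ‖C‖ := by
    refine hr.trans_le ?_
    rw [hC, norm_mul, norm_mul, norm_mul]
    calc r ^ 4 = r * r * r * r := by ring
      _ ≤ _ := by
        have h1 := (htr 1 (by decide)).le
        have h2 := (htr 2 (by decide)).le
        have h3 := (htr 3 (by decide)).le
        have h4 := (htr 4 (by decide)).le
        gcongr
  have hD : theta (t 3 * t 4) p ≠ 0 := by
    refine theta_ne_zero_of_norm hp (norm_mul_lt_one (ht 3) (ht 4).le) (hCn.trans_le ?_)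
    rw [hC, mul_assoc, norm_mul]
    refine mul_le_of_le_one_left (norm_nonneg _) (norm_mul_lt_one (ht 1) (ht 2).le).le
  obtain ⟨σ, hσ, hσq⟩ := exists_base_eq_e2pi hq0 hq
  obtain ⟨β, hβ⟩ := exists_e2pi_eq (div_ne_zero hpq0 hC0)
  set T : ℂ → Fin 6 → ℂ := fun x => ![e2pi x, t 1, t 2, t 3, t 4, e2pi (β - x)] with hT
  have hTprod : ∀ x, ∏ j, T x j = p * q := by
    intro x
    rw [Fin.prod_univ_six]
    have : e2pi x * e2pi (β - x) = p * q / C := by rw [← e2pi_add, ← hβ]; ring_nf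
    calc _ = e2pi x * e2pi (β - x) * C := by simp [hT, hC]; ring
      _ = p * q := by rw [this]; field_simp
  have hTn : ∀ x : ℂ, 0 < x.im → x.im < β.im → ∀ j, ‖T x j‖ < 1 := by
    intro x h1 h2 j
    fin_cases j
    · exact norm_e2pi_lt_one.2 h1
    · exact ht 1
    · exact ht 2
    · exact ht 3
    · exact ht 4
    · exact norm_e2pi_lt_one.2 (by simpa using h2)
  have hlift : ∀ u : Fin 6 → ℂ, (∀ j, ‖u j‖ < 1) → ∏ j, u j = p * q → (∀ j, u j ≠ 0) →
      (∀ j, j ≠ 0 → j ≠ 5 → u j = t j) →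
      ∃ x : ℂ, (0 < x.im ∧ x.im < β.im) ∧ T x = u := by
    intro u hu hup hu0 hut
    obtain ⟨x, hx⟩ := exists_e2pi_eq (hu0 0)
    have h5 : e2pi (β - x) = u 5 := by
      rw [e2pi_sub, hβ, hx, ← hup, Fin.prod_univ_six, hC, hut 1 (by decide) (by decide),
        hut 2 (by decide) (by decide), hut 3 (by decide) (by decide), hut 4 (by decide) (by decide)]
      have := hu0 0; have := ht0 1; have := ht0 2; have := ht0 3; have := ht0 4
      field_simp
    refine ⟨x, ⟨norm_e2pi_lt_one.1 (hx ▸ hu 0), ?_⟩, ?_⟩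
    · have := norm_e2pi_lt_one.1 (h5 ▸ hu 5)
      simpa using this
    · ext j
      fin_cases j
      · exact hx
      · exact (hut 1 (by decide) (by decide)).symm
      · exact (hut 2 (by decide) (by decide)).symm
      · exact (hut 3 (by decide) (by decide)).symm
      · exact (hut 4 (by decide) (by decide)).symm
      · exact h5
  obtain ⟨x, hx, hxt⟩ := hlift t ht hprod ht0 fun _ _ _ => rfl
  obtain ⟨y, hy, hyt⟩ := hlift t' ht' hprod' ht0' fun j h1 h2 => (heq j h1 h2).symm
  rw [← hxt, ← hyt]
  have hσβ : σ.im < β.im - 0 := by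
    rw [sub_zero, ← norm_e2pi_le_iff, hβ, hσq, norm_div, norm_mul,
      div_lt_iff₀ (norm_pos_iff.2 hC0), mul_comm]
    exact mul_lt_mul_of_pos_left hCn (norm_pos_iff.2 hq0)
  refine eq_of_doubly_periodic_on_strip (H := fun x => betaRatio p q (T x)) hσ hσβ ?_ ?_ ?_ hx hy
  · refine differentiableOn_betaRatio hp0 hp hq0 hq
      ((isOpen_lt continuous_const continuous_im).inter (isOpen_lt continuous_im continuous_const))
      (fun j => ?_) (fun s hs => hTn s hs.1 hs.2) (fun s _ => hTprod s)
    refine Differentiable.differentiableOn ?_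
    fin_cases j <;> simp only [hT] <;> simp <;> fun_prop
  · intro x _ _
    have : T (x + 1) = T x := by
      simp only [hT, e2pi_add_one]
      rw [show β - (x + 1) = β - x + -1 by ring, e2pi_add, e2pi_neg, e2pi_one, inv_one, mul_one]
    simp only [this]
  · intro x h1 h2
    -- The parameters at x and at x + σ are the two q-shifts of one vector whose product is p.
    set u : Fin 6 → ℂ := ![e2pi x, t 1, t 2, t 3, t 4, e2pi (β - x - σ)] with hu
    have hE : e2pi (β - x) = e2pi (β - x - σ) * q := by
      rw [← hσq, ← e2pi_add]; ring_nf
    have hu1 : Function.update u 0 (u 0 * q) = T (x + σ) := by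
      ext j
      fin_cases j <;> simp [hu, hT, e2pi_add, hσq, sub_sub, Function.update]
    have hu2 : Function.update u 5 (u 5 * q) = T x := by
      ext j
      fin_cases j <;> simp [hu, hT, hE, Function.update]
    rw [← hu1, ← hu2]
    refine betaRatio_shift hp0 hp hq0 hq (fun j => ?_) ?_ hD
    · fin_cases j
      · exact norm_e2pi_lt_one.2 h1
      · exact ht 1
      · exact ht 2
      · exact ht 3
      · exact ht 4
      · exact norm_e2pi_lt_one.2 (by simp only [sub_im]; linarith)
    · refine mul_right_cancel₀ hq0 ?_
      rw [← hTprod x, Fin.prod_univ_six, Fin.prod_univ_six]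
      simp [hu, hT, hE]; ring

lemma betaRatio_eq_of_eq_off (hp0 : p ≠ 0) (hp : ‖p‖ < 1) (hq0 : q ≠ 0) (hq : ‖q‖ < 1)
    {r : ℝ} (hr0 : 0 < r) (hr : ‖p‖ < r ^ 4) (ht : ∀ j, ‖t j‖ < 1)
    (hprod : ∏ j, t j = p * q) (htr : ∀ j, j ≠ 5 → r < ‖t j‖) (ht' : ∀ j, ‖t' j‖ < 1)
    (hprod' : ∏ j, t' j = p * q) (m : Fin 6) (hm : m ≠ 5)
    (heq : ∀ j, j ≠ m → j ≠ 5 → t j = t' j) :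
    betaRatio p q t = betaRatio p q t' := by
  rw [← betaRatio_comp_swap m hm, ← betaRatio_comp_swap (t := t') m hm]
  have h5 : ∀ j, j ≠ 5 → Equiv.swap 0 m j ≠ 5 := by
    intro j hj h
    rw [← Equiv.swap_apply_of_ne_of_ne (a := (0 : Fin 6)) (b := m) (x := 5) (by decide) hm.symm] at h
    exact hj ((Equiv.swap 0 m).injective h)
  refine betaRatio_eq_of_eq_off_zero hp0 hp hq0 hq hr0 hr (fun j => ht _) ?_
    (fun j hj => htr _ (h5 j hj)) (fun j => ht' _) ?_ fun j h0 hj => heq _ (fun h => ?_) (h5 j hj)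
  · rw [← hprod]; exact Equiv.prod_comp _ t
  · rw [← hprod']; exact Equiv.prod_comp _ t'
  · exact h0 ((Equiv.swap 0 m).injective (h.trans (Equiv.swap_apply_left 0 m).symm))

/-- The parameters are exchanged one at a time and the last one is recomputed from the product
condition after each exchange. The bound r⁵ > |p| keeps that last parameter inside the disc at every
stage. -/
lemma betaRatio_eq_of_norm_gt (hp0 : p ≠ 0) (hp : ‖p‖ < 1) (hq0 : q ≠ 0) (hq : ‖q‖ < 1)
    {r : ℝ} (hr0 : 0 < r) (hr : ‖p‖ < r ^ 5) (ht : ∀ j, ‖t j‖ < 1)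
    (hprod : ∏ j, t j = p * q) (htr : ∀ j, j ≠ 5 → r < ‖t j‖) (ht' : ∀ j, ‖t' j‖ < 1)
    (hprod' : ∏ j, t' j = p * q) (htr' : ∀ j, j ≠ 5 → r < ‖t' j‖) :
    betaRatio p q t = betaRatio p q t' := by
  classical
  have hpq0 := mul_ne_zero hp0 hq0
  have hr1 : r < 1 := (htr 0 (by decide)).trans (ht 0)
  set c : Finset (Fin 6) → Fin 6 → ℂ := fun A i => if i ∈ A then t' i else t i with hc
  have hcn : ∀ A j, ‖c A j‖ < 1 := by
    intro A j; simp only [hc]; split_ifs <;> simp [*]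
  have hcr : ∀ A j, j ≠ 5 → r < ‖c A j‖ := by
    intro A j hj; simp only [hc]; split_ifs
    exacts [htr' j hj, htr j hj]
  set f : (Fin 6 → ℂ) → Fin 6 → ℂ := fun c =>
    Function.update c 5 (p * q / ∏ k ∈ Finset.univ.erase 5, c k) with hf
  have hprodr : ∀ A, r ^ 5 ≤ ‖∏ k ∈ Finset.univ.erase 5, c A k‖ := by
    intro A
    rw [norm_prod]
    calc r ^ 5 = ∏ k ∈ (Finset.univ : Finset (Fin 6)).erase 5, r := by simp
      _ ≤ _ := Finset.prod_le_prod (fun _ _ => hr0.le) fun k hk =>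
        (hcr A k (Finset.ne_of_mem_erase hk)).le
  have hfn : ∀ A j, ‖f (c A) j‖ < 1 := by
    intro A j
    rcases eq_or_ne j 5 with rfl | hj
    · simp only [hf, Function.update_self]
      have := hprodr A
      rw [norm_div, div_lt_one ((pow_pos hr0 5).trans_le this), norm_mul]
      exact ((mul_le_of_le_one_right (norm_nonneg _) hq.le).trans_lt hr).trans_le this
    · simpa [hf, hj] using hcn A j
  have hfr : ∀ A j, j ≠ 5 → r < ‖f (c A) j‖ := fun A j hj => by simpa [hf, hj] using hcr A j hj
  have hfp : ∀ A, ∏ j, f (c A) j = p * q := by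
    intro A
    have h0 : ∏ k ∈ Finset.univ.erase 5, c A k ≠ 0 :=
      norm_pos_iff.1 ((pow_pos hr0 5).trans_le (hprodr A))
    simp only [hf]
    rw [Finset.prod_update_of_mem (Finset.mem_univ _), Finset.sdiff_singleton_eq_erase,
      div_mul_cancel₀ _ h0]
  have hself : ∀ u : Fin 6 → ℂ, ∏ j, u j = p * q → f u = u := by
    intro u hu
    simp only [hf]
    rw [← hu, ← Finset.mul_prod_erase _ _ (Finset.mem_univ 5), mul_div_cancel_right₀,
      Function.update_eq_self]
    exact Finset.prod_ne_zero_iff.2 fun k _ => ne_zero_of_prod_eq hpq0 hu k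
  have key : ∀ A : Finset (Fin 6), betaRatio p q (f (c A)) = betaRatio p q t := by
    intro A
    induction A using Finset.induction_on with
    | empty => simp only [hc, Finset.notMem_empty, if_false]; rw [hself t hprod]
    | insert m A hm ih =>
      rw [← ih]
      rcases eq_or_ne m 5 with rfl | hm5
      · congr 1
        have hE : ∀ k, k ≠ 5 → c (insert 5 A) k = c A k := by
          intro k hk; simp [hc, hk]
        ext j
        rcases eq_or_ne j 5 with rfl | hj
        · simp only [hf, Function.update_self]
          rw [Finset.prod_congr rfl fun k hk => hE k (Finset.ne_of_mem_erase hk)]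
        · simp [hf, hj, hE]
      · refine (betaRatio_eq_of_eq_off hp0 hp hq0 hq hr0
          (hr.trans_le (pow_le_pow_of_le_one hr0.le hr1.le (by norm_num))) (hfn A) (hfp A) (hfr A)
          (hfn _) (hfp _) m hm5 fun j hjm hj5 => ?_).symm
        simp [hf, hc, hj5, hjm]
  rw [← key Finset.univ, show c Finset.univ = t' by ext i; simp [hc], hself t' hprod']

lemma exists_log_of_norm_lt_one {z : ℂ} (h0 : z ≠ 0) (hz : ‖z‖ < 1) :
    ∃ x : ℂ, x.re < 0 ∧ exp x = z :=
  ⟨log z, by rw [log_re]; exact Real.log_neg (norm_pos_iff.2 h0) hz, exp_log h0⟩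

/-- Multiplying the logarithms of t₀, …, t₄ by 1 - s moves these parameters to 1 as s → 1, while the
last one tends to pq. The real parts of the logarithms are real-affine in s, so the admissible s
form a convex open set. Near an admissible point close to s = 1 the ratio is constant by
`betaRatio_eq_of_norm_gt`, and the identity theorem carries this back to s = 0. The point s = 1
itself is not admissible. -/
lemma exists_betaRatio_eq_norm_gt (hp0 : p ≠ 0) (hp : ‖p‖ < 1) (hq0 : q ≠ 0) (hq : ‖q‖ < 1)
    {r : ℝ} (hr0 : 0 < r) (hr1 : r < 1) (hr : ‖p‖ < r ^ 5) (ht : ∀ j, ‖t j‖ < 1)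
    (hprod : ∏ j, t j = p * q) :
    ∃ t' : Fin 6 → ℂ, (∀ j, ‖t' j‖ < 1) ∧ ∏ j, t' j = p * q ∧ (∀ j, j ≠ 5 → r < ‖t' j‖) ∧
      betaRatio p q t = betaRatio p q t' := by
  have hpq0 := mul_ne_zero hp0 hq0
  have ht0 := ne_zero_of_prod_eq hpq0 hprod
  choose x hx0 hx using fun j => exists_log_of_norm_lt_one (ht0 j) (ht j)
  obtain ⟨y, hy0, hy⟩ := exists_log_of_norm_lt_one hpq0 (norm_mul_lt_one hp hq.le)
  set X := ∑ j ∈ Finset.univ.erase (5 : Fin 6), x j with hX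
  -- the logarithms along the path
  set L : ℂ → Fin 6 → ℂ := fun s => Function.update (fun j => (1 - s) * x j) 5 (y - (1 - s) * X)
    with hL
  have hL5 : ∀ s, L s 5 = y - (1 - s) * X := fun s => by simp [hL]
  have hLj : ∀ s j, j ≠ 5 → L s j = (1 - s) * x j := fun s j hj => by simp [hL, hj]
  have hLd : ∀ j, Differentiable ℂ fun s => L s j := by
    intro j
    rcases eq_or_ne j 5 with rfl | hj
    · simp only [hL5]; fun_prop
    · simp only [hLj _ j hj]; fun_prop
  have hLsum : ∀ s, ∑ j, L s j = y := by
    intro s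
    rw [← Finset.add_sum_erase _ _ (Finset.mem_univ 5), hL5,
      Finset.sum_congr rfl fun j hj => hLj s j (Finset.ne_of_mem_erase hj), ← Finset.mul_sum]
    ring
  have hTprod : ∀ s, ∏ j, exp (L s j) = p * q := by
    intro s; rw [← Complex.exp_sum, hLsum, hy]
  have hcomb : ∀ s₁ s₂ : ℂ, ∀ a b : ℝ, a + b = 1 → ∀ j,
      (L (a • s₁ + b • s₂) j).re = a * (L s₁ j).re + b * (L s₂ j).re := by
    intro s₁ s₂ a b hab j
    have hb : b = 1 - a := by linarith
    subst hb
    have : L (a • s₁ + (1 - a) • s₂) j = a * L s₁ j + (1 - a) * L s₂ j := by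
      rcases eq_or_ne j 5 with rfl | hj
      · simp only [hL5, real_smul]; push_cast; ring
      · simp only [hLj _ j hj, real_smul]; push_cast; ring
    rw [this]
    simp
  set S : Set ℂ := {s | ∀ j, (L s j).re < 0} with hS
  have hSo : IsOpen S := by
    simp only [hS, Set.ofPred_forall]
    exact isOpen_iInter_of_finite fun j =>
      isOpen_lt (continuous_re.comp (hLd j).continuous) continuous_const
  have hSc : Convex ℝ S := by
    intro s₁ h1 s₂ h2 a b ha hb hab j
    rw [hcomb s₁ s₂ a b hab]
    rcases ha.eq_or_lt with rfl | ha'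
    · have : b = 1 := by linarith
      subst this; simpa using h2 j
    · nlinarith [mul_neg_of_pos_of_neg ha' (h1 j), mul_nonpos_of_nonneg_of_nonpos hb (h2 j).le]
  have hT0 : (fun j => exp (L 0 j)) = t := by
    ext j
    rcases eq_or_ne j 5 with rfl | hj
    · have : exp X = ∏ j ∈ Finset.univ.erase (5 : Fin 6), t j := by
        rw [hX, Complex.exp_sum]; exact Finset.prod_congr rfl fun j _ => hx j
      rw [hL5, sub_zero, one_mul, exp_sub, hy, this, ← hprod,
        ← Finset.mul_prod_erase _ t (Finset.mem_univ 5), mul_div_cancel_right₀]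
      exact Finset.prod_ne_zero_iff.2 fun k _ => ht0 k
    · rw [hLj 0 j hj, sub_zero, one_mul, hx]
  have h0S : (0 : ℂ) ∈ S := by
    intro j
    have := ht j
    rw [← hT0] at this
    simpa [norm_exp] using this
  have hfd : DifferentiableOn ℂ (fun s => betaRatio p q fun j => exp (L s j)) S :=
    differentiableOn_betaRatio hp0 hp hq0 hq hSo (fun j => (hLd j).cexp.differentiableOn)
      (fun s hs j => by rw [norm_exp, Real.exp_lt_one_iff]; exact hs j) fun s _ => hTprod s
  -- near `s = 1` all parameters but the last are close to the unit circle
  have hev : ∀ᶠ s : ℂ in 𝓝 1, (L s 5).re < 0 ∧ ∀ j, j ≠ 5 → r < ‖exp (L s j)‖ := by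
    refine Filter.Eventually.and ?_ (eventually_all.2 fun j => ?_)
    · have : ContinuousAt (fun s => (L s 5).re) 1 :=
        (continuous_re.comp (hLd 5).continuous).continuousAt
      exact this.eventually_lt_const (by simp [hL5, hy0])
    · by_cases hj : j = 5
      · simp [hj]
      have : ContinuousAt (fun s => ‖exp (L s j)‖) 1 :=
        (hLd j).cexp.continuous.norm.continuousAt
      filter_upwards [this.eventually_const_lt (u := r) (by simpa [hLj _ j hj] using hr1)]
        with s hs _ using hs
  obtain ⟨ε, hε, hball⟩ := Metric.eventually_nhds_iff_ball.1 hev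
  set δ : ℝ := min (ε / 2) 1 with hδ
  have hδ0 : 0 < δ := by positivity
  have hmem : ((1 - δ : ℝ) : ℂ) ∈ Metric.ball (1 : ℂ) ε := by
    rw [Metric.mem_ball, dist_eq_norm]
    have : ((1 - δ : ℝ) : ℂ) - 1 = ((-δ : ℝ) : ℂ) := by push_cast; ring
    rw [this, norm_real, Real.norm_eq_abs, abs_neg, abs_of_pos hδ0]
    exact (min_le_left _ _).trans_lt (by linarith)
  have hsS : ((1 - δ : ℝ) : ℂ) ∈ S := by
    intro j
    rcases eq_or_ne j 5 with rfl | hj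
    · exact (hball _ hmem).1
    · rw [hLj _ j hj, show (1 : ℂ) - ((1 - δ : ℝ) : ℂ) = (δ : ℂ) by push_cast; ring, re_ofReal_mul]
      exact mul_neg_of_pos_of_neg hδ0 (hx0 j)
  refine ⟨fun j => exp (L ((1 - δ : ℝ) : ℂ) j), fun j => ?_, hTprod _, (hball _ hmem).2, ?_⟩
  · rw [norm_exp, Real.exp_lt_one_iff]; exact hsS j
  · have hconst := (hfd.analyticOnNhd hSo).eqOn_of_preconnected_of_eventuallyEq
      (analyticOnNhd_const (v := betaRatio p q fun j => exp (L ((1 - δ : ℝ) : ℂ) j)))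
      hSc.isPreconnected hsS (by
        filter_upwards [Metric.isOpen_ball.mem_nhds hmem, hSo.mem_nhds hsS] with s h1 h2
        exact betaRatio_eq_of_norm_gt hp0 hp hq0 hq hr0 hr
          (fun j => by rw [norm_exp, Real.exp_lt_one_iff]; exact h2 j) (hTprod _) (hball s h1).2
          (fun j => by rw [norm_exp, Real.exp_lt_one_iff]; exact hsS j) (hTprod _)
          (hball _ hmem).2)
    have := hconst h0S
    simp only [hT0] at this
    exact this

/-- The normalised elliptic beta integral does not depend on the parameters. -/
theorem betaRatio_eq (hp0 : p ≠ 0) (hp : ‖p‖ < 1) (hq0 : q ≠ 0) (hq : ‖q‖ < 1)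
    (ht : ∀ j, ‖t j‖ < 1) (hprod : ∏ j, t j = p * q) (ht' : ∀ j, ‖t' j‖ < 1)
    (hprod' : ∏ j, t' j = p * q) : betaRatio p q t = betaRatio p q t' := by
  obtain ⟨r, hr0, hr1, hr⟩ : ∃ r : ℝ, 0 < r ∧ r < 1 ∧ ‖p‖ < r ^ 5 := by
    have hc : ContinuousAt (fun r : ℝ => r ^ 5) 1 := by fun_prop
    have h1 : ∀ᶠ r : ℝ in 𝓝[<] 1, ‖p‖ < r ^ 5 :=
      (hc.eventually_const_lt (by simpa)).filter_mono nhdsWithin_le_nhds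
    have h2 : ∀ᶠ r : ℝ in 𝓝[<] 1, 0 < r :=
      (lt_mem_nhds one_pos).filter_mono nhdsWithin_le_nhds
    obtain ⟨r, h1, h2, h3⟩ := (h1.and (h2.and self_mem_nhdsWithin)).exists
    exact ⟨r, h2, h3, h1⟩
  obtain ⟨u, hu, hup, hur, e⟩ := exists_betaRatio_eq_norm_gt hp0 hp hq0 hq hr0 hr1 hr ht hprod
  obtain ⟨u', hu', hup', hur', e'⟩ := exists_betaRatio_eq_norm_gt hp0 hp hq0 hq hr0 hr1 hr ht' hprod'
  rw [e, e', betaRatio_eq_of_norm_gt hp0 hp hq0 hq hr0 hr hu hup hur hu' hup' hur']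

end Constancy

/-! ### The Poisson kernel as an approximate identity -/

section Poisson

lemma integral_e2pi_eq_center {f : ℂ → ℂ} (hf : DiffContOnCl ℂ f (Metric.ball 0 1)) :
    ∫ x in (0 : ℝ)..1, f (e2pi x) = f 0 := by
  have h1 := circleIntegral_inv_smul f one_pos
  rw [hf.circleIntegral_sub_inv_smul (Metric.mem_ball_self one_pos), smul_eq_mul] at h1
  simpa using (mul_left_cancel₀ two_pi_I_ne_zero h1).symm

/-- The Poisson kernel of the unit disc with parameter `-y`, at the point `e2pi (2 u)`. -/
def poissonKer (y u : ℝ) : ℝ := (1 - y ^ 2) / normSq (1 + y * e2pi u ^ 2)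

variable {y : ℝ}

lemma one_add_mul_ne_zero (hy : 0 ≤ y) (hy1 : y < 1) {w : ℂ} (hw : ‖w‖ ≤ 1) : 1 + y * w ≠ 0 := by
  intro h
  have h1 : ‖(y : ℂ) * w‖ = 1 := by
    rw [← norm_neg, ← eq_neg_of_add_eq_zero_left h, norm_one]
  rw [norm_mul, norm_real, Real.norm_of_nonneg hy] at h1
  nlinarith [norm_nonneg w]

lemma conj_e2pi_real (u : ℝ) : (starRingEnd ℂ) (e2pi u) = (e2pi u)⁻¹ := by
  have h := mul_conj (e2pi u)
  rw [normSq_eq_norm_sq, norm_e2pi_real] at h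
  exact eq_inv_of_mul_eq_one_right (by simpa using h)

lemma ofReal_poissonKer (y u : ℝ) :
    (poissonKer y u : ℂ) = (1 - y ^ 2) / ((1 + y * e2pi u ^ 2) * (1 + y * ((e2pi u)⁻¹) ^ 2)) := by
  rw [poissonKer]
  push_cast
  rw [← mul_conj]
  simp [conj_e2pi_real]

lemma poissonKer_nonneg (hy : 0 ≤ y) (hy1 : y < 1) (u : ℝ) : 0 ≤ poissonKer y u :=
  div_nonneg (by nlinarith) (normSq_nonneg _)

lemma continuous_poissonKer (hy : 0 ≤ y) (hy1 : y < 1) : Continuous (poissonKer y) := by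
  refine continuous_const.div ?_ fun u => ?_
  · exact continuous_normSq.comp (by fun_prop)
  · refine normSq_eq_zero.not.2 ?_
    exact one_add_mul_ne_zero hy hy1 (by simp [norm_e2pi_real])

/-- With z = `e2pi u` the kernel is 1/(1 + yz²) + 1/(1 + yz⁻²) - 1, and by the mean value property
each fraction has mean 1. -/
lemma integral_poissonKer (hy : 0 ≤ y) (hy1 : y < 1) : ∫ u in (0 : ℝ)..1, poissonKer y u = 1 := by
  have hf : DiffContOnCl ℂ (fun z : ℂ => (1 + y * z ^ 2)⁻¹) (Metric.ball 0 1) := by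
    refine DifferentiableOn.diffContOnCl fun z hz => ?_
    rw [closure_ball _ one_ne_zero, mem_closedBall_zero_iff] at hz
    refine DifferentiableAt.differentiableWithinAt (DifferentiableAt.inv (by fun_prop) ?_)
    exact one_add_mul_ne_zero hy hy1 (by rw [norm_pow]; exact pow_le_one₀ (norm_nonneg _) hz)
  have h1 := integral_e2pi_eq_center hf
  have h2 : ∫ x in (0 : ℝ)..1, (1 + y * ((e2pi x)⁻¹) ^ 2)⁻¹ = (1 : ℂ) := by
    have h3 := intervalIntegral.integral_comp_sub_left (a := 0) (b := 1)
      (fun x : ℝ => (1 + y * (e2pi x) ^ 2)⁻¹) 1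
    simp only [sub_self, sub_zero] at h3
    rw [h1] at h3
    simp only [ne_eq, OfNat.ofNat_ne_zero, not_false_eq_true, zero_pow, mul_zero, add_zero,
      inv_one] at h3
    refine Eq.trans ?_ h3
    refine intervalIntegral.integral_congr fun x _ => ?_
    simp only [ofReal_sub, ofReal_one, e2pi_sub, e2pi_one, one_div]
  have hne1 : ∀ x : ℝ, 1 + (y : ℂ) * e2pi x ^ 2 ≠ 0 := fun x =>
    one_add_mul_ne_zero hy hy1 (by simp [norm_e2pi_real])
  have hne2 : ∀ x : ℝ, 1 + (y : ℂ) * (e2pi x)⁻¹ ^ 2 ≠ 0 := fun x =>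
    one_add_mul_ne_zero hy hy1 (by simp [norm_e2pi_real])
  have hc1 : Continuous fun x : ℝ => (1 + (y : ℂ) * e2pi x ^ 2)⁻¹ :=
    Continuous.inv₀ (by fun_prop) hne1
  have hc2 : Continuous fun x : ℝ => (1 + (y : ℂ) * (e2pi x)⁻¹ ^ 2)⁻¹ := by
    refine Continuous.inv₀ ?_ hne2
    have : Continuous fun x : ℝ => (e2pi x)⁻¹ :=
      Continuous.inv₀ (by fun_prop) fun x => e2pi_ne_zero _
    fun_prop
  have key : ((∫ u in (0 : ℝ)..1, poissonKer y u : ℝ) : ℂ) = 1 := by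
    rw [← intervalIntegral.integral_ofReal]
    calc _ = ∫ x in (0 : ℝ)..1, ((1 + (y : ℂ) * e2pi x ^ 2)⁻¹ +
              (1 + (y : ℂ) * (e2pi x)⁻¹ ^ 2)⁻¹ - 1) := by
          refine intervalIntegral.integral_congr fun x _ => ?_
          have h1 := hne1 x
          have h2 := hne2 x
          have h0 := e2pi_ne_zero x
          have h3 : e2pi x * (e2pi x)⁻¹ = 1 := mul_inv_cancel₀ h0
          simp only [ofReal_poissonKer]
          rw [div_eq_iff (mul_ne_zero h1 h2)]
          generalize (e2pi x)⁻¹ = w at *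
          generalize e2pi x = z at *
          field_simp
          linear_combination ((y : ℂ) ^ 2 * (z * w + 1)) * h3
      _ = 1 := by
          rw [intervalIntegral.integral_sub ((hc1.fun_add hc2).intervalIntegrable _ _)
            intervalIntegrable_const, intervalIntegral.integral_add (hc1.intervalIntegrable _ _)
            (hc2.intervalIntegrable _ _), h1, h2]
          simp
  exact_mod_cast key

/-- On the circle |1 + yw|² - y|1 + w|² = (1 - y)² ≥ 0. Away from the points where z² = -1 the
kernel therefore tends to 0 as y → 1. -/
lemma poissonKer_mul_le (hy : 0 < y) (hy1 : y < 1) (u : ℝ) :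
    poissonKer y u * normSq (1 + e2pi u ^ 2) ≤ (1 - y ^ 2) / y := by
  have h0 : 0 < normSq (1 + y * e2pi u ^ 2) :=
    normSq_pos.2 (one_add_mul_ne_zero hy.le hy1 (by simp [norm_e2pi_real]))
  rw [poissonKer, div_mul_eq_mul_div, div_le_div_iff₀ h0 hy, mul_assoc]
  refine mul_le_mul_of_nonneg_left ?_ (by nlinarith)
  have hn : normSq (e2pi u ^ 2) = 1 := by simp [normSq_eq_norm_sq, norm_e2pi_real]
  generalize e2pi u ^ 2 = w at *
  rw [normSq_apply] at *
  simp only [add_re, one_re, add_im, one_im, re_ofReal_mul, im_ofReal_mul, normSq_apply]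
  nlinarith [sq_nonneg (1 - y)]

/-- The Poisson kernel is an approximate identity, for a test function depending continuously on
the parameter. -/
lemma tendsto_integral_poissonKer {G : ℝ → ℝ → ℂ} {a : ℂ}
    (hG : ∀ u, ContinuousAt (Function.uncurry G) (1, u))
    (hGx : ∀ᶠ x in 𝓝[<] (1 : ℝ), Continuous (G x))
    (ha : ∀ u : ℝ, 1 + e2pi u ^ 2 = 0 → G 1 u = a) :
    Tendsto (fun x : ℝ => ∫ u in (0 : ℝ)..1, poissonKer (x ^ 2) u * G x u) (𝓝[<] 1) (𝓝 a) := by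
  have hlt : ∀ᶠ x : ℝ in 𝓝[<] 1, 0 < x ∧ x < 1 := by
    filter_upwards [self_mem_nhdsWithin, mem_nhdsWithin_of_mem_nhds (lt_mem_nhds one_pos)]
      with x h1 h2 using ⟨h2, h1⟩
  have hcn : Continuous fun u : ℝ => normSq (1 + e2pi u ^ 2) :=
    continuous_normSq.comp (by fun_prop)
  -- Near a point with z² = -1 the deviation from a is at most ε; near any other point it is
  -- bounded, hence dominated by a multiple of |1 + z²|². Compactness combines the local bounds, and
  -- `poissonKer_mul_le` controls the second term.
  have hloc : ∀ ε > 0, ∃ M : ℝ, 0 ≤ M ∧ ∀ᶠ x in 𝓝 (1 : ℝ), ∀ u ∈ Set.Icc (0 : ℝ) 1,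
      ‖G x u - a‖ ≤ ε + M * normSq (1 + e2pi u ^ 2) := by
    intro ε hε
    refine isCompact_Icc.induction_on (p := fun s => ∃ M : ℝ, 0 ≤ M ∧ ∀ᶠ x in 𝓝 (1 : ℝ), ∀ u ∈ s,
      ‖G x u - a‖ ≤ ε + M * normSq (1 + e2pi u ^ 2)) ⟨0, le_rfl, by simp⟩ ?_ ?_ ?_
    · rintro s t hst ⟨M, hM, h⟩
      exact ⟨M, hM, h.mono fun x hx u hu => hx u (hst hu)⟩
    · rintro s t ⟨M, hM, h⟩ ⟨M', hM', h'⟩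
      refine ⟨M + M', add_nonneg hM hM', ?_⟩
      filter_upwards [h, h'] with x hx hx' u hu
      have hn := normSq_nonneg (1 + e2pi u ^ 2)
      rcases hu with hu | hu
      · exact (hx u hu).trans (by nlinarith [mul_nonneg hM' hn])
      · exact (hx' u hu).trans (by nlinarith [mul_nonneg hM hn])
    · intro u _
      have hD : ContinuousAt (fun w : ℝ × ℝ => ‖G w.1 w.2 - a‖) (1, u) :=
        ((hG u).sub continuousAt_const).norm
      suffices h : ∃ M : ℝ, 0 ≤ M ∧ ∀ᶠ w : ℝ × ℝ in 𝓝 (1, u),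
          ‖G w.1 w.2 - a‖ ≤ ε + M * normSq (1 + e2pi w.2 ^ 2) by
        obtain ⟨M, hM, h⟩ := h
        rw [nhds_prod_eq, eventually_prod_iff] at h
        obtain ⟨P, hP, Q, hQ, h⟩ := h
        exact ⟨{v | Q v}, mem_nhdsWithin_of_mem_nhds hQ, M, hM, hP.mono fun x hx v hv => h hx hv⟩
      by_cases hu : 1 + e2pi u ^ 2 = 0
      · refine ⟨0, le_rfl, ?_⟩
        filter_upwards [hD.eventually_lt_const (u := ε) (by simpa [ha u hu])] with w hw
        simpa using hw.le
      · have hpos := normSq_pos.2 hu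
        set c := normSq (1 + e2pi u ^ 2) with hc
        set B := ‖G 1 u - a‖ + 1 with hB
        have hB0 : 0 ≤ B := by positivity
        refine ⟨B / (c / 2), by positivity, ?_⟩
        have hcn' : ContinuousAt (fun w : ℝ × ℝ => normSq (1 + e2pi w.2 ^ 2)) (1, u) :=
          (hcn.comp continuous_snd).continuousAt
        filter_upwards [hD.eventually_lt_const (u := B) (by simp [hB]),
          hcn'.eventually_const_lt (u := c / 2) (by simpa using by linarith)] with w h1 h2
        have : B ≤ B / (c / 2) * normSq (1 + e2pi w.2 ^ 2) := by
          rw [div_mul_eq_mul_div, le_div_iff₀ (by positivity)]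
          exact mul_le_mul_of_nonneg_left h2.le hB0
        linarith
  rw [Metric.tendsto_nhds]
  intro ε hε
  obtain ⟨M, hM, hMx⟩ := hloc (ε / 2) (by positivity)
  have hsmall : ∀ᶠ x : ℝ in 𝓝[<] 1, M * ((1 - (x ^ 2) ^ 2) / x ^ 2) < ε / 2 := by
    have hc : ContinuousAt (fun x : ℝ => M * ((1 - (x ^ 2) ^ 2) / x ^ 2)) 1 :=
      continuousAt_const.mul (ContinuousAt.div (by fun_prop) (by fun_prop) (by norm_num))
    exact (hc.eventually_lt_const (by simpa using half_pos hε)).filter_mono nhdsWithin_le_nhds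
  filter_upwards [hlt, hsmall, hGx, hMx.filter_mono nhdsWithin_le_nhds] with x hx hxs hcx hxM
  have hy : 0 < x ^ 2 := by positivity [hx.1]
  have hy1 : x ^ 2 < 1 := by nlinarith [hx.1, hx.2]
  have hck := continuous_poissonKer hy.le hy1
  have hint := integral_poissonKer hy.le hy1
  rw [dist_eq_norm]
  have e : (∫ u in (0 : ℝ)..1, (poissonKer (x ^ 2) u : ℂ) * G x u) - a =
      ∫ u in (0 : ℝ)..1, (poissonKer (x ^ 2) u : ℂ) * (G x u - a) := by
    simp only [mul_sub]
    rw [intervalIntegral.integral_sub, intervalIntegral.integral_mul_const,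
      intervalIntegral.integral_ofReal, hint]
    · simp
    · exact ((continuous_ofReal.comp hck).mul hcx).intervalIntegrable _ _
    · exact ((continuous_ofReal.comp hck).mul continuous_const).intervalIntegrable _ _
  rw [e]
  calc _ ≤ ∫ u in (0 : ℝ)..1, (poissonKer (x ^ 2) u * (ε / 2) +
          M * ((1 - (x ^ 2) ^ 2) / x ^ 2)) := by
        refine intervalIntegral.norm_integral_le_of_norm_le zero_le_one
          (.of_forall fun u hu => ?_) ?_
        · rw [norm_mul, norm_real, Real.norm_of_nonneg (poissonKer_nonneg hy.le hy1 u)]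
          have h1 := hxM u ⟨hu.1.le, hu.2⟩
          have h2 := poissonKer_mul_le hy hy1 u
          have h3 := poissonKer_nonneg hy.le hy1 u
          calc _ ≤ poissonKer (x ^ 2) u * (ε / 2 + M * normSq (1 + e2pi u ^ 2)) := by gcongr
            _ = poissonKer (x ^ 2) u * (ε / 2) +
                M * (poissonKer (x ^ 2) u * normSq (1 + e2pi u ^ 2)) := by ring
            _ ≤ _ := by gcongr
        · exact ((hck.mul continuous_const).add continuous_const).intervalIntegrable _ _
    _ = ε / 2 + M * ((1 - (x ^ 2) ^ 2) / x ^ 2) := by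
        rw [intervalIntegral.integral_add ((hck.fun_mul continuous_const).intervalIntegrable _ _)
          intervalIntegrable_const, intervalIntegral.integral_mul_const, hint]
        simp
    _ < ε := by linarith

end Poisson

/-! ### Evaluation of the constant by pinching the contour -/

section Constant

variable {p q : ℂ}

/-- The function `(1 - z) Γ(z; p, q)`, regular at `z = 1`. -/
def ellGammaReg (z p q : ℂ) : ℂ :=
  ellPoch (p * q / z) p q / (qPochInf (z * q) q * ellPoch (z * p) p q)

lemma ellGamma_eq_ellGammaReg_div (hp : ‖p‖ < 1) (hq : ‖q‖ < 1) (z : ℂ) :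
    ellGamma z p q = ellGammaReg z p q / (1 - z) := by
  rw [ellGamma_eq, ellGammaReg, ellPoch_mul_left z hp hq, qPochInf_eq z hq, div_div]
  congr 1; ring

lemma _root_.ContinuousAt.ellGammaReg {X : Type*} [TopologicalSpace X] {f : X → ℂ} {x : X}
    (hf : ContinuousAt f x) (hp : ‖p‖ < 1) (hq : ‖q‖ < 1) (h0 : f x ≠ 0) (h1 : ‖f x‖ ≤ 1) :
    ContinuousAt (fun y => ellGammaReg (f y) p q) x := by
  have hE := (differentiable_ellPoch hp hq).continuous
  have hQ := (differentiable_qPochInf hq).continuous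
  refine ContinuousAt.div (hE.continuousAt.comp (continuousAt_const.div hf h0))
    ((hQ.continuousAt.comp (hf.mul continuousAt_const)).mul
      (hE.continuousAt.comp (hf.mul continuousAt_const))) (mul_ne_zero ?_ ?_)
  · exact qPochInf_ne_zero_of_norm_lt_one hq (by rw [mul_comm]; exact norm_mul_lt_one hq h1)
  · exact ellPoch_ne_zero_of_norm_lt_one hp hq (by rw [mul_comm]; exact norm_mul_lt_one hp h1)

/-- As z⁻¹ = z, the numerator cancels the double product that remains in the denominator after one
more factor is split off. -/
lemma ellGammaReg_of_norm_eq_one (hp : ‖p‖ < 1) (hq : ‖q‖ < 1) {z : ℂ} (hz : z * z = 1) :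
    ellGammaReg z p q = (qPochInf (z * q) q * qPochInf (z * p) p)⁻¹ := by
  have hn : ‖z‖ = 1 := by
    have : ‖z‖ * ‖z‖ = 1 := by rw [← norm_mul, hz, norm_one]
    nlinarith [norm_nonneg z]
  have h1 : ellPoch (z * p * q) p q ≠ 0 := ellPoch_ne_zero_of_norm_lt_one hp hq
    (norm_mul_lt_one (by rw [mul_comm]; exact norm_mul_lt_one hp hn.le) hq.le)
  rw [ellGammaReg, ellPoch_mul_right (z * p) hp hq, div_eq_mul_inv (p * q),
    inv_eq_of_mul_eq_one_right hz, show p * q * z = z * p * q by ring, ← mul_assoc, div_eq_mul_inv,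
    mul_inv_rev, ← mul_assoc, mul_inv_cancel₀ h1, one_mul]

lemma ellGamma_reflection (hp0 : p ≠ 0) (hq0 : q ≠ 0) {z w : ℂ} (hzw : z * w = p * q)
    (h1 : ellPoch z p q ≠ 0) (h2 : ellPoch w p q ≠ 0) :
    ellGamma z p q * ellGamma w p q = 1 := by
  have hz : z ≠ 0 := left_ne_zero_of_mul (hzw ▸ mul_ne_zero hp0 hq0)
  have hw : w ≠ 0 := right_ne_zero_of_mul (hzw ▸ mul_ne_zero hp0 hq0)
  rw [ellGamma_eq, ellGamma_eq, ← hzw, mul_div_cancel_left₀ _ hz, mul_div_cancel_right₀ _ hw]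
  field_simp

/-- The parameters `t₀ = i x`, `t₁ = - i x`, whose product tends to `1` as `x → 1`. -/
def pinchParams (c pq : ℂ) (x : ℝ) : Fin 6 → ℂ :=
  ![I * x, -I * x, c, c, c, pq / (x ^ 2 * c ^ 3)]

/-- The regular part of the kernel at `pinchParams`. -/
def pinchReg (p q c : ℂ) (x u : ℝ) : ℂ :=
  ellGammaReg (I * x * e2pi u) p q * ellGammaReg (I * x / e2pi u) p q *
    (ellGammaReg (-I * x * e2pi u) p q * ellGammaReg (-I * x / e2pi u) p q) *
    ((ellGamma (c * e2pi u) p q * ellGamma (c / e2pi u) p q) ^ 3 *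
      (ellGamma (p * q / (x ^ 2 * c ^ 3) * e2pi u) p q *
        ellGamma (p * q / (x ^ 2 * c ^ 3) / e2pi u) p q)) *
    (theta (e2pi u ^ 2) p * theta (e2pi u ^ 2)⁻¹ q)

/-- Since (1 - ixz)(1 + ixz) = 1 + x²z², and likewise for z⁻¹, the four factors that become singular
as x → 1 form the denominator of the Poisson kernel with y = x². -/
lemma betaKernel_pinchParams (hp : ‖p‖ < 1) (hq : ‖q‖ < 1) (c : ℂ) (x u : ℝ) :
    (1 - (x ^ 2) ^ 2 : ℂ) * betaKernel p q (pinchParams c (p * q) x) (e2pi u) =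
      poissonKer (x ^ 2) u * pinchReg p q c x u := by
  have h0 := e2pi_ne_zero u
  rw [ofReal_poissonKer, betaKernel, Fin.prod_univ_six]
  simp only [pinchParams, Matrix.cons_val]
  rw [ellGamma_eq_ellGammaReg_div hp hq (I * x * e2pi u),
    ellGamma_eq_ellGammaReg_div hp hq (I * x / e2pi u),
    ellGamma_eq_ellGammaReg_div hp hq (-I * x * e2pi u),
    ellGamma_eq_ellGammaReg_div hp hq (-I * x / e2pi u), pinchReg]
  have e1 : (1 + ((x ^ 2 : ℝ) : ℂ) * e2pi u ^ 2) * (1 + ((x ^ 2 : ℝ) : ℂ) * ((e2pi u)⁻¹) ^ 2) =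
      (1 - I * x * e2pi u) * (1 - I * x / e2pi u) *
        ((1 - -I * x * e2pi u) * (1 - -I * x / e2pi u)) := by
    have e2 : 1 + ((x ^ 2 : ℝ) : ℂ) * e2pi u ^ 2 =
        (1 - I * x * e2pi u) * (1 - -I * x * e2pi u) := by
      push_cast; linear_combination (x * e2pi u : ℂ) ^ 2 * I_sq
    have e3 : 1 + ((x ^ 2 : ℝ) : ℂ) * ((e2pi u)⁻¹) ^ 2 =
        (1 - I * x / e2pi u) * (1 - -I * x / e2pi u) := by
      push_cast; simp only [div_eq_mul_inv]; linear_combination (x * (e2pi u)⁻¹ : ℂ) ^ 2 * I_sq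
    rw [e2, e3]; ring
  rw [e1]
  generalize 1 - I * x * e2pi u = A
  generalize 1 - I * x / e2pi u = B
  generalize 1 - -I * x * e2pi u = C
  generalize 1 - -I * x / e2pi u = D
  push_cast
  ring

lemma theta_neg_one (hp : ‖p‖ < 1) : theta (-1) p = 2 * qPochInf (-p) p ^ 2 := by
  rw [theta_eq_one_sub_mul (-1) hp]; simp [div_neg]; ring

lemma continuousAt_pinchReg (hp0 : p ≠ 0) (hp : ‖p‖ < 1) (hq0 : q ≠ 0) (hq : ‖q‖ < 1) {c : ℂ}
    (hc0 : c ≠ 0) (hc1 : ‖c‖ < 1) {x u : ℝ} (hx0 : x ≠ 0) (hx1 : ‖x‖ ≤ 1)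
    (hd : ‖p * q / (x ^ 2 * c ^ 3)‖ < 1) :
    ContinuousAt (Function.uncurry (pinchReg p q c)) (x, u) := by
  have h1 := norm_e2pi_real u
  have h0 := e2pi_ne_zero u
  have hx0' : (x : ℂ) ≠ 0 := ofReal_ne_zero.2 hx0
  have hd0 : p * q / ((x : ℂ) ^ 2 * c ^ 3) ≠ 0 := by simp [*]
  have hz : ContinuousAt (fun y : ℝ × ℝ => e2pi y.2) (x, u) := by fun_prop
  have hI : ContinuousAt (fun y : ℝ × ℝ => I * (y.1 : ℂ)) (x, u) := by fun_prop
  have hI' : ContinuousAt (fun y : ℝ × ℝ => -I * (y.1 : ℂ)) (x, u) := by fun_prop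
  have hdc : ContinuousAt (fun y : ℝ × ℝ => p * q / ((y.1 : ℂ) ^ 2 * c ^ 3)) (x, u) :=
    ContinuousAt.div (by fun_prop) (by fun_prop) (by simp [*])
  have hn : ‖I * (x : ℂ)‖ ≤ 1 := by simpa using hx1
  have hn' : ‖-I * (x : ℂ)‖ ≤ 1 := by simpa using hx1
  have hI0 : I * (x : ℂ) ≠ 0 := by simp [hx0]
  have hI0' : -I * (x : ℂ) ≠ 0 := by simp [hx0]
  have hmul : ∀ w : ℂ, ‖w‖ ≤ 1 → ‖w * e2pi u‖ ≤ 1 := fun w hw => by simpa [h1] using hw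
  have hdiv : ∀ w : ℂ, ‖w‖ ≤ 1 → ‖w / e2pi u‖ ≤ 1 := fun w hw => by simpa [h1] using hw
  unfold Function.uncurry pinchReg
  refine ContinuousAt.mul (ContinuousAt.mul (ContinuousAt.mul (ContinuousAt.mul ?_ ?_)
    (ContinuousAt.mul ?_ ?_)) (ContinuousAt.mul (ContinuousAt.pow (ContinuousAt.mul ?_ ?_) 3)
    (ContinuousAt.mul ?_ ?_))) (ContinuousAt.mul ?_ ?_)
  · exact (hI.mul hz).ellGammaReg hp hq (mul_ne_zero hI0 h0) (hmul _ hn)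
  · exact (hI.div hz h0).ellGammaReg hp hq (div_ne_zero hI0 h0) (hdiv _ hn)
  · exact (hI'.mul hz).ellGammaReg hp hq (mul_ne_zero hI0' h0) (hmul _ hn')
  · exact (hI'.div hz h0).ellGammaReg hp hq (div_ne_zero hI0' h0) (hdiv _ hn')
  · exact (continuousAt_const.mul hz).ellGamma hp hq (mul_ne_zero hc0 h0)
      (norm_mul_lt_one hc1 h1.le)
  · exact (continuousAt_const.div hz h0).ellGamma hp hq (div_ne_zero hc0 h0)
      (norm_div_lt_one hc1 h1.ge)
  · exact (hdc.mul hz).ellGamma hp hq (mul_ne_zero hd0 h0) (norm_mul_lt_one hd h1.le)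
  · exact (hdc.div hz h0).ellGamma hp hq (div_ne_zero hd0 h0) (norm_div_lt_one hd h1.ge)
  · exact (hz.pow 2).theta hp (pow_ne_zero _ h0)
  · exact ((hz.pow 2).inv₀ (pow_ne_zero _ h0)).theta hq (inv_ne_zero (pow_ne_zero _ h0))

/-- The elliptic beta integral. -/
theorem betaInt_eq (hp0 : p ≠ 0) (hp : ‖p‖ < 1) (hq0 : q ≠ 0) (hq : ‖q‖ < 1) {t : Fin 6 → ℂ}
    (ht : ∀ j, ‖t j‖ < 1) (hprod : ∏ j, t j = p * q) :
    betaInt p q t = 2 / (qPochInf p p * qPochInf q q) * pairProd p q t := by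
  have hpq1 : ‖p * q‖ < 1 := norm_mul_lt_one hp hq.le
  have hpq0 : p * q ≠ 0 := mul_ne_zero hp0 hq0
  -- The condition c³ > |pq| keeps the sixth parameter pq/(x²c³) in the open disc for x near 1.
  obtain ⟨c, hc0, hc1, hc⟩ : ∃ r : ℝ, 0 < r ∧ r < 1 ∧ ‖p * q‖ < r ^ 3 := by
    have hc : ContinuousAt (fun r : ℝ => r ^ 3) 1 := by fun_prop
    have h1 : ∀ᶠ r : ℝ in 𝓝[<] 1, ‖p * q‖ < r ^ 3 :=
      (hc.eventually_const_lt (by simpa using hpq1)).filter_mono nhdsWithin_le_nhds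
    have h2 : ∀ᶠ r : ℝ in 𝓝[<] 1, 0 < r :=
      (lt_mem_nhds one_pos).filter_mono nhdsWithin_le_nhds
    obtain ⟨r, h1, h2, h3⟩ := (h1.and (h2.and self_mem_nhdsWithin)).exists
    exact ⟨r, h2, h3, h1⟩
  have hcC : (c : ℂ) ≠ 0 := ofReal_ne_zero.2 hc0.ne'
  have hcn : ‖(c : ℂ)‖ < 1 := by rwa [norm_real, Real.norm_of_nonneg hc0.le]
  set d : ℂ := p * q / c ^ 3 with hd
  have hd0 : d ≠ 0 := div_ne_zero hpq0 (pow_ne_zero _ hcC)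
  have hdn : ‖d‖ < 1 := by
    rw [hd, norm_div, norm_pow, norm_real, Real.norm_of_nonneg hc0.le, div_lt_one (by positivity)]
    exact hc
  set T : ℝ → Fin 6 → ℂ := pinchParams c (p * q) with hT
  set C := betaRatio p q t with hC
  have hdx : ContinuousAt (fun x : ℝ => p * q / ((x : ℂ) ^ 2 * c ^ 3)) 1 :=
    ContinuousAt.div (by fun_prop) (by fun_prop) (by simp [hcC])
  have hev : ∀ᶠ x : ℝ in 𝓝[<] 1, 0 < x ∧ x < 1 ∧ ‖p * q / ((x : ℂ) ^ 2 * c ^ 3)‖ < 1 := by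
    filter_upwards [self_mem_nhdsWithin, mem_nhdsWithin_of_mem_nhds (lt_mem_nhds one_pos),
      (hdx.norm.eventually_lt_const (u := 1)
        (by simpa [hd] using hdn)).filter_mono nhdsWithin_le_nhds] with x h1 h2 h3
      using ⟨h2, h1, h3⟩
  have hadm : ∀ᶠ x : ℝ in 𝓝[<] 1, betaInt p q (T x) = C * pairProd p q (T x) := by
    filter_upwards [hev] with x ⟨h1, h2, h3⟩
    have hx0 : (x : ℂ) ≠ 0 := ofReal_ne_zero.2 h1.ne'
    have hx1 : ‖x‖ < 1 := by rwa [Real.norm_of_nonneg h1.le]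
    have hTn : ∀ j, ‖T x j‖ < 1 := by
      intro j
      fin_cases j
      · simpa [hT, pinchParams] using hx1
      · simpa [hT, pinchParams] using hx1
      · exact hcn
      · exact hcn
      · exact hcn
      · exact h3
    have hTp : ∏ j, T x j = p * q := by
      rw [Fin.prod_univ_six]
      simp only [hT, pinchParams, Matrix.cons_val]
      field_simp
      linear_combination (-1 : ℂ) * I_sq
    rw [hC, betaRatio_eq hp0 hp hq0 hq ht hprod hTn hTp, betaRatio,
      div_mul_cancel₀ _ (pairProd_ne_zero hp0 hp hq0 hq hTn hTp)]
  set R : ℂ := (ellGamma (c * I) p q * ellGamma (-(c * I)) p q) ^ 3 *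
    (ellGamma (d * I) p q * ellGamma (-(d * I)) p q) with hR
  set Γ₁ : ℂ := ellGammaReg 1 p q with hΓ₁
  set Γ₂ : ℂ := ellGammaReg (-1) p q with hΓ₂
  -- the limit of the integral
  have hL := tendsto_integral_poissonKer (G := pinchReg p q c)
    (a := Γ₁ ^ 2 * Γ₂ ^ 2 * R * (theta (-1) p * theta (-1) q))
    (fun u => continuousAt_pinchReg hp0 hp hq0 hq hcC hcn one_ne_zero (by simp)
      (by simpa [hd] using hdn))
    (by
      filter_upwards [hev] with x ⟨h1, h2, h3⟩
      refine continuous_iff_continuousAt.2 fun u => ?_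
      exact (continuousAt_pinchReg hp0 hp hq0 hq hcC hcn h1.ne'
        (by rw [Real.norm_of_nonneg h1.le]; exact h2.le) h3).comp (f := fun u => (x, u))
        (by fun_prop))
    (by
      intro u hu
      have hz2 : e2pi u ^ 2 = -1 := by linear_combination hu
      have hz : e2pi u = I ∨ e2pi u = -I := by
        have : (e2pi u - I) * (e2pi u + I) = 0 := by linear_combination hz2 - I_sq
        rcases mul_eq_zero.1 this with h | h
        · exact Or.inl (sub_eq_zero.1 h)
        · exact Or.inr (eq_neg_of_add_eq_zero_left h)
      simp only [pinchReg, hz2]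
      rcases hz with h | h
      · rw [h]
        simp only [ofReal_one, mul_one, I_mul_I, neg_mul, div_self I_ne_zero, neg_neg, neg_div,
          one_pow, one_mul, div_I, inv_neg, inv_one, hR, hΓ₁, hΓ₂, hd]
        ring
      · rw [h]
        simp only [ofReal_one, mul_one, I_mul_I, neg_mul, mul_neg, div_self I_ne_zero, neg_neg,
          neg_div, div_neg, one_pow, one_mul, div_I, inv_neg, inv_one, hR, hΓ₁, hΓ₂, hd]
        ring)
  -- the limit of the product
  have hcd : ellGamma (c * c) p q * ellGamma (c * d) p q = 1 := by
    refine ellGamma_reflection hp0 hq0 (by rw [hd]; field_simp)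
      (ellPoch_ne_zero_of_norm_lt_one hp hq (norm_mul_lt_one hcn hcn.le))
      (ellPoch_ne_zero_of_norm_lt_one hp hq (norm_mul_lt_one hcn hdn.le))
  have hRt : Tendsto (fun x : ℝ => (1 - ((x : ℂ) ^ 2) ^ 2) * pairProd p q (T x)) (𝓝[<] 1)
      (𝓝 (2 * Γ₁ * R)) := by
    set D : ℝ → ℂ := fun x => p * q / ((x : ℂ) ^ 2 * c ^ 3) with hDdef
    have hD1 : D 1 = d := by simp [hDdef, hd]
    have hDc : ContinuousAt D 1 := hdx
    set F : ℝ → ℂ := fun x => (1 + (x : ℂ) ^ 2) * ellGammaReg ((x : ℂ) ^ 2) p q *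
      ((ellGamma (I * x * c) p q * ellGamma (-I * x * c) p q) ^ 3 *
        (ellGamma (I * x * D x) p q * ellGamma (-I * x * D x) p q)) *
      (ellGamma (c * c) p q * ellGamma (c * D x) p q) ^ 3 with hF
    have hcI : ContinuousAt (fun x : ℝ => I * (x : ℂ)) 1 := by fun_prop
    have hcI' : ContinuousAt (fun x : ℝ => -I * (x : ℂ)) 1 := by fun_prop
    have hFc : ContinuousAt F 1 := by
      refine ContinuousAt.mul (ContinuousAt.mul (ContinuousAt.mul (by fun_prop) ?_)
        (ContinuousAt.mul (ContinuousAt.pow (ContinuousAt.mul ?_ ?_) 3)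
          (ContinuousAt.mul ?_ ?_))) (ContinuousAt.pow (ContinuousAt.mul continuousAt_const ?_) 3)
      · exact ContinuousAt.ellGammaReg (by fun_prop) hp hq (by simp) (by simp)
      · exact (hcI.mul continuousAt_const).ellGamma hp hq (by simp [hcC]) (by simpa using hcn)
      · exact (hcI'.mul continuousAt_const).ellGamma hp hq (by simp [hcC]) (by simpa using hcn)
      · exact (hcI.mul hDc).ellGamma hp hq (by simp [hD1, hd0]) (by simpa [hD1] using hdn)
      · exact (hcI'.mul hDc).ellGamma hp hq (by simp [hD1, hd0]) (by simpa [hD1] using hdn)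
      · exact (continuousAt_const.mul hDc).ellGamma hp hq (by simp [hD1, hd0, hcC])
          (by simp only [Pi.mul_apply, hD1]; exact norm_mul_lt_one hcn hdn.le)
    have hF1 : F 1 = 2 * Γ₁ * R := by
      simp only [hF, hD1, hcd, ofReal_one, hR, hΓ₁]
      rw [show I * 1 * (c : ℂ) = c * I by ring, show -I * 1 * (c : ℂ) = -(c * I) by ring,
        show I * 1 * d = d * I by ring, show -I * 1 * d = -(d * I) by ring]
      norm_num
    rw [← hF1]
    refine (hFc.tendsto.mono_left nhdsWithin_le_nhds).congr' ?_
    filter_upwards [hev] with x ⟨h1, h2, h3⟩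
    have hne : (1 : ℂ) - (x : ℂ) ^ 2 ≠ 0 := by
      have : (1 : ℝ) - x ^ 2 ≠ 0 := by nlinarith
      exact_mod_cast this
    unfold pairProd
    rw [prod_Ioi_fin_six fun j m => ellGamma (T x j * T x m) p q]
    simp only [hT, pinchParams, Matrix.cons_val]
    rw [show I * (x : ℂ) * (-I * x) = (x : ℂ) ^ 2 by linear_combination (-(x : ℂ) ^ 2) * I_sq,
      ellGamma_eq_ellGammaReg_div hp hq ((x : ℂ) ^ 2)]
    simp only [hF, hDdef]
    field_simp
    ring
  -- comparison
  have hlim : Tendsto (fun x : ℝ => ∫ u in (0 : ℝ)..1, (poissonKer (x ^ 2) u : ℂ) *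
      pinchReg p q c x u) (𝓝[<] 1) (𝓝 (C * (2 * Γ₁ * R))) := by
    refine (hRt.const_mul C).congr' ?_
    filter_upwards [hadm] with x hx
    rw [mul_left_comm, ← hx, betaInt, ← intervalIntegral.integral_const_mul]
    exact intervalIntegral.integral_congr fun u _ => betaKernel_pinchParams hp hq c x u
  have hfin := tendsto_nhds_unique hL hlim
  have hΓ₁v : Γ₁ = (qPochInf q q * qPochInf p p)⁻¹ := by
    rw [hΓ₁, ellGammaReg_of_norm_eq_one hp hq (by ring)]; simp
  have hΓ₂v : Γ₂ = (qPochInf (-q) q * qPochInf (-p) p)⁻¹ := by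
    rw [hΓ₂, ellGammaReg_of_norm_eq_one hp hq (by ring)]; simp
  have hqq := qPochInf_ne_zero_of_norm_lt_one hq hq
  have hpp := qPochInf_ne_zero_of_norm_lt_one hp hp
  have hqn := qPochInf_ne_zero_of_norm_lt_one (z := -q) hq (by simpa using hq)
  have hpn := qPochInf_ne_zero_of_norm_lt_one (z := -p) hp (by simpa using hp)
  have hΓ₁0 : Γ₁ ≠ 0 := by rw [hΓ₁v]; exact inv_ne_zero (mul_ne_zero hqq hpp)
  have hR0 : R ≠ 0 := by
    have hpqc : ∀ w : ℂ, ‖w‖ < 1 → ‖p * q‖ < ‖w‖ →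
        ellGamma (w * I) p q ≠ 0 ∧ ellGamma (-(w * I)) p q ≠ 0 := by
      intro w h1 h2
      exact ⟨ellGamma_ne_zero hp hq (by simpa using h1) (by simpa using h2),
        ellGamma_ne_zero hp hq (by simpa using h1) (by simpa using h2)⟩
    have hc' : ‖p * q‖ < ‖(c : ℂ)‖ := by
      rw [norm_real, Real.norm_of_nonneg hc0.le]
      exact hc.trans_le (pow_le_of_le_one hc0.le hc1.le (by norm_num))
    have hd' : ‖p * q‖ < ‖d‖ := by
      rw [hd, norm_div, norm_pow, norm_real, Real.norm_of_nonneg hc0.le, lt_div_iff₀ (by positivity)]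
      exact mul_lt_of_lt_one_right (norm_pos_iff.2 hpq0) (pow_lt_one₀ hc0.le hc1 (by norm_num))
    exact mul_ne_zero (pow_ne_zero _ (mul_ne_zero (hpqc c hcn hc').1 (hpqc c hcn hc').2))
      (mul_ne_zero (hpqc d hdn hd').1 (hpqc d hdn hd').2)
  -- As θ(-1; p) = 2(-p; p)², the theta factors cancel Γ₂² up to 4. The comparison of limits reads
  -- 4Γ₁²R = 2CΓ₁R, that is C = 2Γ₁.
  have hCv : C = 2 / (qPochInf p p * qPochInf q q) := by
    have h2 : 2 * Γ₁ * R ≠ 0 := mul_ne_zero (mul_ne_zero two_ne_zero hΓ₁0) hR0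
    refine mul_right_cancel₀ h2 ?_
    rw [← hfin, theta_neg_one hp, theta_neg_one hq, hΓ₂v]
    rw [hΓ₁v]
    field_simp
  rw [← hCv, hC, betaRatio, div_mul_cancel₀ _ (pairProd_ne_zero hp0 hp hq0 hq ht hprod)]

end Constant

/-! ### Modular transformations of (q;q)_∞ and theta -/

section ModularTheta

variable {τ : ℂ}

lemma neg_inv_im_pos (hτ : 0 < τ.im) : 0 < (-(1 / τ)).im := by
  rw [one_div, neg_im, inv_im, neg_div, neg_neg]
  have h0 : τ ≠ 0 := by rintro rfl; simp at hτ
  exact div_pos hτ (normSq_pos.2 h0)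

/-- The eta function in terms of the infinite product. -/
lemma eta_eq (z : ℂ) : ModularForm.eta z = e2pi (z / 24) * qPochInf (e2pi z) (e2pi z) := by
  rw [ModularForm.eta, qPochInf, e2pi, Function.Periodic.qParam]
  congr 1
  · push_cast; congr 1; ring
  · refine tprod_congr fun n => ?_
    rw [ModularForm.eta_q_eq_pow, e2pi, pow_succ']

/-- The modular transformation of `(q; q)_∞`. -/
lemma pochRatioUpper_eq (hτ : 0 < τ.im) :
    pochRatioUpper τ = exp (Real.pi * I / 4 - log τ / 2 - Real.pi * I * (τ + 1 / τ) / 12) := by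
  have h0 : τ ≠ 0 := by rintro rfl; simp at hτ
  have h := ModularForm.eta_comp_eq_csqrt_I_inv hτ
  simp only [Function.comp_apply, Pi.smul_apply, Pi.mul_apply, smul_eq_mul] at h
  rw [eta_eq, eta_eq, Complex.sqrt, Complex.sqrt, cpow_def_of_ne_zero I_ne_zero,
    cpow_def_of_ne_zero h0, log_I, ← exp_neg, show (-1 / τ) = -(1 / τ) by ring] at h
  have hq := qPochInf_ne_zero_of_norm_lt_one (norm_e2pi_lt_one.2 (neg_inv_im_pos hτ))
    (norm_e2pi_lt_one.2 (neg_inv_im_pos hτ))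
  rw [pochRatioUpper, div_eq_iff hq]
  have h1 := e2pi_ne_zero (-(1 / τ) / 24)
  refine mul_left_cancel₀ h1 ?_
  have e1 : e2pi (-(1 / τ) / 24) =
      exp (Real.pi * I / 4 - log τ / 2 - Real.pi * I * (τ + 1 / τ) / 12) *
        (exp (-(Real.pi / 2 * I * 2⁻¹)) * (exp (log τ * 2⁻¹) * e2pi (τ / 24))) := by
    rw [e2pi, e2pi, ← exp_add, ← exp_add, ← exp_add]; congr 1; ring
  rw [mul_left_comm, h, e1]
  ring

/-- The quadratic polynomial in the modular transformation of the theta function. -/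
def thetaExponent (v τ : ℂ) : ℂ := v ^ 2 / τ - v * (1 + 1 / τ) + (τ + 1 / τ) / 6 + 1 / 2

lemma exp_pi_mul_eq_e2pi (x : ℂ) : exp (Real.pi * I * x) = e2pi (x / 2) := by
  rw [e2pi]; congr 1; ring

lemma e2pi_half : e2pi (1 / 2) = -1 := by
  rw [← exp_pi_mul_eq_e2pi, mul_one, exp_pi_mul_I]

/-- The modular transformation of the theta function. -/
lemma theta_modular (hτ : 0 < τ.im) (v : ℂ) :
    theta (e2pi (-(v / τ))) (e2pi (-(1 / τ))) =
      exp (Real.pi * I * thetaExponent v τ) * theta (e2pi v) (e2pi τ) := by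
  have h0 : τ ≠ 0 := by rintro rfl; simp at hτ
  have hσ := neg_inv_im_pos hτ
  have hq := norm_e2pi_lt_one.2 hτ
  have hq' := norm_e2pi_lt_one.2 hσ
  -- The Gaussian factor gives F the quasi-periods of θ(e^{2πiv}; e^{2πiτ}). As F also vanishes at
  -- 0, division by this theta leaves an entire doubly periodic function, that is, a constant.
  set F : ℂ → ℂ := fun v => e2pi (-(thetaExponent v τ / 2)) *
    theta (e2pi (-(v / τ))) (e2pi (-(1 / τ))) with hF
  have hd1 : Differentiable ℂ fun v => theta (e2pi (-(v / τ))) (e2pi (-(1 / τ))) :=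
    (differentiable_theta_e2pi hq').comp (by fun_prop : Differentiable ℂ fun x => -(x / τ))
  have hd2 : Differentiable ℂ fun v => e2pi (-(thetaExponent v τ / 2)) := by
    unfold thetaExponent; fun_prop
  have hFd : Differentiable ℂ F := hd2.mul hd1
  have hF1 : ∀ x, F (x + 1) = F x := by
    intro x
    simp only [hF]
    rw [show -((x + 1) / τ) = -(x / τ) + -(1 / τ) by ring, theta_e2pi_add_base hσ,
      show -(thetaExponent (x + 1) τ / 2) = -(thetaExponent x τ / 2) + -(x / τ) + 1 / 2 by
        simp only [thetaExponent]; field_simp; ring, e2pi_add, e2pi_add, e2pi_half, e2pi_neg (-(x / τ))]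
    have := e2pi_ne_zero (-(x / τ))
    field_simp
  have hFτ : ∀ x, F (x + τ) = -e2pi (-x) * F x := by
    intro x
    simp only [hF]
    rw [← theta_e2pi_add_one (-((x + τ) / τ)), show -((x + τ) / τ) + 1 = -(x / τ) by field_simp; ring,
      show -(thetaExponent (x + τ) τ / 2) = -(thetaExponent x τ / 2) + -x + 1 / 2 by
        simp only [thetaExponent]; field_simp; ring, e2pi_add, e2pi_add, e2pi_half]
    ring
  obtain ⟨k, hk, hFk, hk1, hkτ⟩ := exists_eq_theta_mul hτ hFd
    (by fun_prop : Differentiable ℂ fun x => -e2pi (-x))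
    (fun _ => neg_ne_zero.2 (e2pi_ne_zero _)) hF1 hFτ (β := 0) (by simp only [hF, zero_div, neg_zero, e2pi_zero, theta_one hq', mul_zero])
  have hkc : ∀ x, k x = k 0 := fun x => eq_of_doubly_periodic hτ hk hk1 (fun x => by
    rw [hkτ, sub_zero, neg_neg, e2pi_neg, inv_mul_cancel₀ (e2pi_ne_zero _), one_mul]) x 0
  have hFk' : ∀ x, F x = theta (e2pi x) (e2pi τ) * k 0 := fun x => by rw [hFk, sub_zero, hkc]
  have hD1 : HasDerivAt F (-(2 * Real.pi * I) * qPochInf (e2pi τ) (e2pi τ) ^ 2 * k 0) 0 := by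
    rw [funext hFk']; exact (hasDerivAt_theta_zero hq).mul_const _
  have hD2 : HasDerivAt F (e2pi (-(thetaExponent 0 τ / 2)) *
      (-(2 * Real.pi * I) * qPochInf (e2pi (-(1 / τ))) (e2pi (-(1 / τ))) ^ 2 * -(1 / τ))) 0 := by
    have h1 : HasDerivAt (fun v : ℂ => -(v / τ)) (-(1 / τ)) 0 :=
      ((hasDerivAt_id (0 : ℂ)).div_const τ).neg
    have h2 : HasDerivAt (fun v => theta (e2pi (-(v / τ))) (e2pi (-(1 / τ)))) _ 0 :=
      HasDerivAt.comp (h₂ := fun u => theta (e2pi u) (e2pi (-(1 / τ)))) 0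
        (by simpa only [zero_div, neg_zero] using hasDerivAt_theta_zero hq') h1
    have h3 := (hd2 0).hasDerivAt.mul h2
    simp only [zero_div, neg_zero, e2pi_zero, theta_one hq', mul_zero, zero_add] at h3
    exact h3
  have hp := pochRatioUpper_eq hτ
  have hne := qPochInf_ne_zero_of_norm_lt_one hq' hq'
  rw [pochRatioUpper, div_eq_iff hne] at hp
  -- Comparing derivatives at 0 expresses the constant through the square of (q;q)_∞ / (q̃;q̃)_∞,
  -- which the eta transformation evaluates.
  have hk0 : k 0 = 1 := by
    have := hD1.unique hD2
    rw [hp, mul_pow, ← exp_nat_mul] at this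
    have e1 : e2pi (-(thetaExponent 0 τ / 2)) * -(1 / τ) =
        exp ((2 : ℕ) * (Real.pi * I / 4 - log τ / 2 - Real.pi * I * (τ + 1 / τ) / 12)) := by
      rw [eq_comm, e2pi, show (2 : ℕ) * (Real.pi * I / 4 - log τ / 2 - Real.pi * I * (τ + 1 / τ) / 12) =
        2 * Real.pi * I * -(thetaExponent 0 τ / 2) + Real.pi * I - log τ by
          simp only [thetaExponent]; push_cast; ring, exp_sub, exp_log h0, exp_add, exp_pi_mul_I]
      ring
    have h5 : -(2 * Real.pi * I) * qPochInf (e2pi (-(1 / τ))) (e2pi (-(1 / τ))) ^ 2 *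
      exp ((2 : ℕ) * (Real.pi * I / 4 - log τ / 2 - Real.pi * I * (τ + 1 / τ) / 12)) ≠ 0 :=
      mul_ne_zero (mul_ne_zero (neg_ne_zero.2 two_pi_I_ne_zero) (pow_ne_zero _ hne)) (exp_ne_zero _)
    refine mul_left_cancel₀ h5 ?_
    linear_combination this + -(2 * Real.pi * I) *
      qPochInf (e2pi (-(1 / τ))) (e2pi (-(1 / τ))) ^ 2 * e1
  have hv := hFk' v
  rw [hk0, mul_one] at hv
  rw [exp_pi_mul_eq_e2pi, ← hv]
  simp only [hF]
  rw [← mul_assoc, ← e2pi_add, add_neg_cancel, e2pi_zero, one_mul]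

end ModularTheta

/-! ### The modular identity for the elliptic gamma function -/

section ModularGamma

lemma neg_div_im_pos {a b : ℂ} (h : 0 < (a / b).im) : 0 < (-(b / a)).im := by
  simpa using neg_inv_im_pos h

lemma ne_zero_of_div_im_pos {a b : ℂ} (h : 0 < (a / b).im) : a ≠ 0 ∧ b ≠ 0 := by
  constructor <;> rintro rfl <;> simp at h

lemma ellPoch_e2pi_left {σ τ a b : ℂ} (hσ : 0 < σ.im) (hτ : 0 < τ.im) (h : b = a + σ) :
    ellPoch (e2pi a) (e2pi σ) (e2pi τ) =
      qPochInf (e2pi a) (e2pi τ) * ellPoch (e2pi b) (e2pi σ) (e2pi τ) := by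
  rw [h, e2pi_add, ← ellPoch_mul_left _ (norm_e2pi_lt_one.2 hσ) (norm_e2pi_lt_one.2 hτ)]

lemma ellPoch_e2pi_right {σ τ a b : ℂ} (hσ : 0 < σ.im) (hτ : 0 < τ.im) (h : b = a + τ) :
    ellPoch (e2pi a) (e2pi σ) (e2pi τ) =
      qPochInf (e2pi a) (e2pi σ) * ellPoch (e2pi b) (e2pi σ) (e2pi τ) := by
  rw [h, e2pi_add, ← ellPoch_mul_right _ (norm_e2pi_lt_one.2 hσ) (norm_e2pi_lt_one.2 hτ)]

lemma theta_e2pi_eq {σ a b : ℂ} (h : b = σ - a) :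
    theta (e2pi a) (e2pi σ) = qPochInf (e2pi a) (e2pi σ) * qPochInf (e2pi b) (e2pi σ) := by
  rw [theta, h, e2pi_sub]

lemma e2pi_congr {a b : ℂ} (h : b = a + 1) : e2pi b = e2pi a := by rw [h, e2pi_add_one]

/-- The numerator of `Γ(e^{2πi u/ω₂}; p, q) Γ(r e^{-2πi u/ω₁}; r, q̃)`. -/
def modNum (ω₁ ω₂ ω₃ u : ℂ) : ℂ :=
  ellPoch (e2pi ((ω₃ + ω₁ - u) / ω₂)) (e2pi (ω₃ / ω₂)) (e2pi (ω₁ / ω₂)) *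
    ellPoch (e2pi ((u - ω₂) / ω₁)) (e2pi (ω₃ / ω₁)) (e2pi (-(ω₂ / ω₁)))

/-- The denominator of `Γ(e^{2πi u/ω₂}; p, q) Γ(r e^{-2πi u/ω₁}; r, q̃)`. -/
def modDen (ω₁ ω₂ ω₃ u : ℂ) : ℂ :=
  ellPoch (e2pi (u / ω₂)) (e2pi (ω₃ / ω₂)) (e2pi (ω₁ / ω₂)) *
    ellPoch (e2pi ((ω₃ - u) / ω₁)) (e2pi (ω₃ / ω₁)) (e2pi (-(ω₂ / ω₁)))

/-- The numerator of `Γ(e^{-2πi u/ω₃}; r̃, p̃)`. -/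
def dualNum (ω₁ ω₂ ω₃ u : ℂ) : ℂ :=
  ellPoch (e2pi ((u - ω₁ - ω₂) / ω₃)) (e2pi (-(ω₁ / ω₃))) (e2pi (-(ω₂ / ω₃)))

/-- The denominator of `Γ(e^{-2πi u/ω₃}; r̃, p̃)`. -/
def dualDen (ω₁ ω₂ ω₃ u : ℂ) : ℂ :=
  ellPoch (e2pi (-(u / ω₃))) (e2pi (-(ω₁ / ω₃))) (e2pi (-(ω₂ / ω₃)))

variable {ω₁ ω₂ ω₃ : ℂ}

/-- The increments of P along the three periods are the quadratic exponents in the modular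
transformation of theta; this is why P occurs in G. -/
lemma cubicP_add_fst (h₁ : ω₁ ≠ 0) (h₂ : ω₂ ≠ 0) (h₃ : ω₃ ≠ 0) (u : ℂ) :
    cubicP ω₁ ω₂ ω₃ (u + ω₁) = cubicP ω₁ ω₂ ω₃ u + thetaExponent (u / ω₂) (ω₃ / ω₂) := by
  simp only [cubicP, thetaExponent]; field_simp; ring

lemma cubicP_add_snd (h₁ : ω₁ ≠ 0) (h₂ : ω₂ ≠ 0) (h₃ : ω₃ ≠ 0) (u : ℂ) :
    cubicP ω₁ ω₂ ω₃ (u + ω₂) = cubicP ω₁ ω₂ ω₃ u + thetaExponent (u / ω₁) (ω₃ / ω₁) := by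
  simp only [cubicP, thetaExponent]; field_simp; ring

lemma cubicP_add_thd (h₁ : ω₁ ≠ 0) (h₂ : ω₂ ≠ 0) (h₃ : ω₃ ≠ 0) (u : ℂ) :
    cubicP ω₁ ω₂ ω₃ (u + ω₃) = cubicP ω₁ ω₂ ω₃ u + thetaExponent (u / ω₂) (ω₁ / ω₂) := by
  simp only [cubicP, thetaExponent]; field_simp; ring

/-- The modular transformation of theta functions for a quotient of periods. -/
lemma theta_modular_div {a b : ℂ} (h : 0 < (a / b).im) (u : ℂ) :
    theta (e2pi (-(u / a))) (e2pi (-(b / a))) =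
      exp (Real.pi * I * thetaExponent (u / b) (a / b)) * theta (e2pi (u / b)) (e2pi (a / b)) := by
  obtain ⟨ha, hb⟩ := ne_zero_of_div_im_pos h
  rw [← theta_modular h, show u / b / (a / b) = u / a by field_simp, one_div_div]

/-- One side of the identity between the two representations of the modified gamma function. -/
def modSide (ω₁ ω₂ ω₃ u : ℂ) : ℂ :=
  modNum ω₁ ω₂ ω₃ u * dualDen ω₁ ω₂ ω₃ u * exp (Real.pi * I * cubicP ω₁ ω₂ ω₃ u)

/-- The other side of the identity between the two representations of the modified gamma
function. -/
def dualSide (ω₁ ω₂ ω₃ u : ℂ) : ℂ := dualNum ω₁ ω₂ ω₃ u * modDen ω₁ ω₂ ω₃ u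

/-- Written without division because both sides may vanish. The products with denominator ω₁ do not
change; those over ω₂ and ω₃ gain single products that assemble into two thetas, related by the
modular transformation with modulus ω₃/ω₂, whose exponent is the increment of P. The other two
periods work in the same way with moduli ω₃/ω₁ and ω₁/ω₂. -/
lemma modSide_add_fst (h₁₂ : 0 < (ω₁ / ω₂).im) (h₃₁ : 0 < (ω₃ / ω₁).im)
    (h₃₂ : 0 < (ω₃ / ω₂).im) (u : ℂ) :
    modSide ω₁ ω₂ ω₃ (u + ω₁) * dualSide ω₁ ω₂ ω₃ u =
      modSide ω₁ ω₂ ω₃ u * dualSide ω₁ ω₂ ω₃ (u + ω₁) := by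
  obtain ⟨h₃, h₁⟩ := ne_zero_of_div_im_pos h₃₁
  obtain ⟨-, h₂⟩ := ne_zero_of_div_im_pos h₃₂
  have h13 := neg_div_im_pos h₃₁
  have h23 := neg_div_im_pos h₃₂
  have e7 := theta_modular_div h₃₂ u
  rw [theta_e2pi_eq (b := (u + ω₁ - ω₁ - ω₂) / ω₃) (by ring),
    theta_e2pi_eq (b := (ω₃ + ω₁ - (u + ω₁)) / ω₂) (by ring)] at e7
  simp only [modSide, dualSide, modNum, modDen, dualNum, dualDen,
    cubicP_add_fst h₁ h₂ h₃, mul_add (Real.pi * I : ℂ), exp_add]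
  rw [ellPoch_e2pi_right h₃₂ h₁₂ (a := (ω₃ + ω₁ - (u + ω₁)) / ω₂) (b := (ω₃ + ω₁ - u) / ω₂)
      (by ring),
    ellPoch_e2pi_right h₃₂ h₁₂ (a := u / ω₂) (b := (u + ω₁) / ω₂) (by ring),
    ellPoch_e2pi_left h13 h23 (a := (u + ω₁ - ω₁ - ω₂) / ω₃) (b := (u - ω₁ - ω₂) / ω₃) (by ring),
    ellPoch_e2pi_left h13 h23 (a := -(u / ω₃)) (b := -((u + ω₁) / ω₃)) (by ring),
    e2pi_congr (a := (u - ω₂) / ω₁) (b := (u + ω₁ - ω₂) / ω₁) (by field_simp; ring),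
    e2pi_congr (a := (ω₃ - (u + ω₁)) / ω₁) (b := (ω₃ - u) / ω₁) (by field_simp; ring)]
  have aux : ∀ a b c d x P N₁ M₁ D₂ N₂ D₁ M₂ : ℂ, d * c = x * (b * a) →
      a * N₁ * M₁ * D₂ * (P * x) * (N₂ * (b * D₁ * M₂)) =
        N₁ * M₁ * (d * D₂) * P * (c * N₂ * (D₁ * M₂)) := by
    intro a b c d x P N₁ M₁ D₂ N₂ D₁ M₂ h
    linear_combination (-(N₁ * M₁ * D₂ * P * N₂ * D₁ * M₂)) * h
  exact aux _ _ _ _ _ _ _ _ _ _ _ _ e7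

lemma modSide_add_snd (h₁₂ : 0 < (ω₁ / ω₂).im) (h₃₁ : 0 < (ω₃ / ω₁).im)
    (h₃₂ : 0 < (ω₃ / ω₂).im) (u : ℂ) :
    modSide ω₁ ω₂ ω₃ (u + ω₂) * dualSide ω₁ ω₂ ω₃ u =
      modSide ω₁ ω₂ ω₃ u * dualSide ω₁ ω₂ ω₃ (u + ω₂) := by
  obtain ⟨h₃, h₁⟩ := ne_zero_of_div_im_pos h₃₁
  obtain ⟨-, h₂⟩ := ne_zero_of_div_im_pos h₃₂
  have h13 := neg_div_im_pos h₃₁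
  have h23 := neg_div_im_pos h₃₂
  have h21 := neg_div_im_pos h₁₂
  have e7 := theta_modular_div h₃₁ u
  rw [theta_e2pi_eq (b := (u + ω₂ - ω₁ - ω₂) / ω₃) (by ring),
    theta_e2pi_eq (b := (ω₃ - u) / ω₁) (by ring)] at e7
  simp only [modSide, dualSide, modNum, modDen, dualNum, dualDen,
    cubicP_add_snd h₁ h₂ h₃, mul_add (Real.pi * I : ℂ), exp_add]
  rw [add_sub_cancel_right u ω₂, ellPoch_e2pi_right h₃₁ h21 (a := u / ω₁) (b := (u - ω₂) / ω₁) (by ring),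
    ellPoch_e2pi_right h₃₁ h21 (a := (ω₃ - u) / ω₁) (b := (ω₃ - (u + ω₂)) / ω₁) (by ring),
    ellPoch_e2pi_right h13 h23 (a := (u + ω₂ - ω₁ - ω₂) / ω₃) (b := (u - ω₁ - ω₂) / ω₃) (by ring),
    ellPoch_e2pi_right h13 h23 (a := -(u / ω₃)) (b := -((u + ω₂) / ω₃)) (by ring),
    e2pi_congr (a := (ω₃ + ω₁ - (u + ω₂)) / ω₂) (b := (ω₃ + ω₁ - u) / ω₂) (by field_simp; ring),
    e2pi_congr (a := u / ω₂) (b := (u + ω₂) / ω₂) (by field_simp)]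
  have aux : ∀ a b c d x P N₁ M₁ D₂ N₂ D₁ M₂ : ℂ, d * c = x * (a * b) →
      N₁ * (a * M₁) * D₂ * (P * x) * (N₂ * (D₁ * (b * M₂))) =
        N₁ * M₁ * (d * D₂) * P * (c * N₂ * (D₁ * M₂)) := by
    intro a b c d x P N₁ M₁ D₂ N₂ D₁ M₂ h
    linear_combination (-(N₁ * M₁ * D₂ * P * N₂ * D₁ * M₂)) * h
  exact aux _ _ _ _ _ _ _ _ _ _ _ _ e7

lemma modSide_add_thd (h₁₂ : 0 < (ω₁ / ω₂).im) (h₃₁ : 0 < (ω₃ / ω₁).im)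
    (h₃₂ : 0 < (ω₃ / ω₂).im) (u : ℂ) :
    modSide ω₁ ω₂ ω₃ (u + ω₃) * dualSide ω₁ ω₂ ω₃ u =
      modSide ω₁ ω₂ ω₃ u * dualSide ω₁ ω₂ ω₃ (u + ω₃) := by
  obtain ⟨h₃, h₁⟩ := ne_zero_of_div_im_pos h₃₁
  obtain ⟨-, h₂⟩ := ne_zero_of_div_im_pos h₃₂
  have h21 := neg_div_im_pos h₁₂
  have e7 := theta_modular_div h₁₂ u
  rw [theta_e2pi_eq (b := (u - ω₂) / ω₁) (by ring),
    theta_e2pi_eq (b := (ω₃ + ω₁ - (u + ω₃)) / ω₂) (by ring)] at e7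
  simp only [modSide, dualSide, modNum, modDen, dualNum, dualDen,
    cubicP_add_thd h₁ h₂ h₃, mul_add (Real.pi * I : ℂ), exp_add]
  rw [ellPoch_e2pi_left h₃₂ h₁₂ (a := (ω₃ + ω₁ - (u + ω₃)) / ω₂) (b := (ω₃ + ω₁ - u) / ω₂)
      (by ring),
    ellPoch_e2pi_left h₃₂ h₁₂ (a := u / ω₂) (b := (u + ω₃) / ω₂) (by ring),
    ellPoch_e2pi_left h₃₁ h21 (a := (u - ω₂) / ω₁) (b := (u + ω₃ - ω₂) / ω₁) (by ring),
    show (ω₃ - (u + ω₃)) / ω₁ = -(u / ω₁) by ring,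
    ellPoch_e2pi_left h₃₁ h21 (a := -(u / ω₁)) (b := (ω₃ - u) / ω₁) (by ring),
    e2pi_congr (a := -((u + ω₃) / ω₃)) (b := -(u / ω₃)) (by field_simp; ring),
    e2pi_congr (a := (u - ω₁ - ω₂) / ω₃) (b := (u + ω₃ - ω₁ - ω₂) / ω₃) (by field_simp; ring)]
  have aux : ∀ a b c d x P N₁ M₁ D₂ N₂ D₁ M₂ : ℂ, d * c = x * (b * a) →
      a * N₁ * M₁ * D₂ * (P * x) * (N₂ * (b * D₁ * M₂)) =
        N₁ * (c * M₁) * D₂ * P * (N₂ * (D₁ * (d * M₂))) := by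
    intro a b c d x P N₁ M₁ D₂ N₂ D₁ M₂ h
    linear_combination (-(N₁ * M₁ * D₂ * P * N₂ * D₁ * M₂)) * h
  exact aux _ _ _ _ _ _ _ _ _ _ _ _ e7

lemma differentiable_modSide (h₁₂ : 0 < (ω₁ / ω₂).im) (h₃₁ : 0 < (ω₃ / ω₁).im)
    (h₃₂ : 0 < (ω₃ / ω₂).im) : Differentiable ℂ (modSide ω₁ ω₂ ω₃) := by
  have n1 := norm_e2pi_lt_one.2 h₁₂
  have n2 := norm_e2pi_lt_one.2 h₃₁
  have n3 := norm_e2pi_lt_one.2 h₃₂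
  have n4 := norm_e2pi_lt_one.2 (neg_div_im_pos h₁₂)
  have n5 := norm_e2pi_lt_one.2 (neg_div_im_pos h₃₁)
  have n6 := norm_e2pi_lt_one.2 (neg_div_im_pos h₃₂)
  have c1 : Differentiable ℂ fun u => cexp (Real.pi * I * cubicP ω₁ ω₂ ω₃ u) := by
    simp only [cubicP]; fun_prop
  exact ((((differentiable_ellPoch n3 n1).comp
    (by fun_prop : Differentiable ℂ fun u => e2pi ((ω₃ + ω₁ - u) / ω₂))).mul
    ((differentiable_ellPoch n2 n4).comp
      (by fun_prop : Differentiable ℂ fun u => e2pi ((u - ω₂) / ω₁)))).mul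
    ((differentiable_ellPoch n5 n6).comp
      (by fun_prop : Differentiable ℂ fun u => e2pi (-(u / ω₃))))).mul c1

lemma differentiable_dualSide (h₁₂ : 0 < (ω₁ / ω₂).im) (h₃₁ : 0 < (ω₃ / ω₁).im)
    (h₃₂ : 0 < (ω₃ / ω₂).im) : Differentiable ℂ (dualSide ω₁ ω₂ ω₃) := by
  have n1 := norm_e2pi_lt_one.2 h₁₂
  have n2 := norm_e2pi_lt_one.2 h₃₁
  have n3 := norm_e2pi_lt_one.2 h₃₂
  have n4 := norm_e2pi_lt_one.2 (neg_div_im_pos h₁₂)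
  have n5 := norm_e2pi_lt_one.2 (neg_div_im_pos h₃₁)
  have n6 := norm_e2pi_lt_one.2 (neg_div_im_pos h₃₂)
  exact ((differentiable_ellPoch n5 n6).comp
      (by fun_prop : Differentiable ℂ fun u => e2pi ((u - ω₁ - ω₂) / ω₃))).mul
    (((differentiable_ellPoch n3 n1).comp
    (by fun_prop : Differentiable ℂ fun u => e2pi (u / ω₂))).mul
    ((differentiable_ellPoch n2 n4).comp
      (by fun_prop : Differentiable ℂ fun u => e2pi ((ω₃ - u) / ω₁))))

/-- The two sides agree, and do not vanish, at the centre `(ω₁ + ω₂ + ω₃) / 2`. -/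
lemma modSide_center (h₁₂ : 0 < (ω₁ / ω₂).im) (h₃₁ : 0 < (ω₃ / ω₁).im)
    (h₃₂ : 0 < (ω₃ / ω₂).im) : modSide ω₁ ω₂ ω₃ ((ω₁ + ω₂ + ω₃) / 2) =
      dualSide ω₁ ω₂ ω₃ ((ω₁ + ω₂ + ω₃) / 2) ∧
    dualSide ω₁ ω₂ ω₃ ((ω₁ + ω₂ + ω₃) / 2) ≠ 0 := by
  obtain ⟨h₃, h₁⟩ := ne_zero_of_div_im_pos h₃₁
  obtain ⟨-, h₂⟩ := ne_zero_of_div_im_pos h₃₂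
  have h21 := neg_div_im_pos h₁₂
  have h13 := neg_div_im_pos h₃₁
  have h23 := neg_div_im_pos h₃₂
  have n1 := norm_e2pi_lt_one.2 h₁₂
  have n2 := norm_e2pi_lt_one.2 h₃₁
  have n3 := norm_e2pi_lt_one.2 h₃₂
  have n4 := norm_e2pi_lt_one.2 h21
  have n5 := norm_e2pi_lt_one.2 h13
  have n6 := norm_e2pi_lt_one.2 h23
  set u := (ω₁ + ω₂ + ω₃) / 2 with hu
  have hP : cubicP ω₁ ω₂ ω₃ u = 0 := by simp [cubicP, hu]
  -- The centre is fixed by u ↦ ω₁ + ω₂ + ω₃ - u, so each numerator argument differs from its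
  -- denominator argument by an integer.
  have e1 := e2pi_congr (a := (ω₃ + ω₁ - u) / ω₂) (b := u / ω₂) (by rw [hu]; field_simp; ring)
  have e2 := e2pi_congr (a := (ω₃ - u) / ω₁) (b := (u - ω₂) / ω₁) (by rw [hu]; field_simp; ring)
  have e3 := e2pi_congr (a := -(u / ω₃)) (b := (u - ω₁ - ω₂) / ω₃) (by rw [hu]; field_simp; ring)
  constructor
  · rw [modSide, dualSide, modNum, modDen, dualNum, dualDen, hP, e1, e2, e3]
    simp; ring
  · rw [dualSide, modDen, dualNum]
    refine mul_ne_zero (ellPoch_ne_zero_of_norm_lt_one n5 n6 ?_) (mul_ne_zero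
      (ellPoch_ne_zero_of_norm_lt_one n3 n1 ?_) (ellPoch_ne_zero_of_norm_lt_one n2 n4 ?_))
    · rw [e3, norm_e2pi_lt_one, show -(u / ω₃) = (-(ω₁ / ω₃) + -(ω₂ / ω₃) - 1) / 2 by
        rw [hu]; field_simp; ring]
      simp at h13 h23 ⊢; linarith
    · rw [norm_e2pi_lt_one, show u / ω₂ = (ω₁ / ω₂ + ω₃ / ω₂ + 1) / 2 by
        rw [hu]; field_simp; ring]
      simp at h₁₂ h₃₂ ⊢; linarith
    · rw [norm_e2pi_lt_one, show (ω₃ - u) / ω₁ = (ω₃ / ω₁ + -(ω₂ / ω₁) - 1) / 2 by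
        rw [hu]; field_simp; ring]
      simp at h₃₁ h21 ⊢; linarith

/-- The translations preserving the ratio of two entire functions. -/
def ratioPeriods {f k : ℂ → ℂ} (hf : Differentiable ℂ f) (hk : Differentiable ℂ k) {u₀ : ℂ}
    (h₀ : k u₀ ≠ 0) : AddSubgroup ℂ where
  carrier := {l | ∀ u, f (u + l) * k u = f u * k (u + l)}
  zero_mem' := by simp
  add_mem' := by
    intro l m hl hm u
    refine sub_eq_zero.1 (eq_zero_of_mul_eq_zero_of_entire (f := fun u => k (u + l))
      (g := fun u => f (u + (l + m)) * k u - f u * k (u + (l + m))) (by fun_prop) (by fun_prop)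
      (fun u => ?_) (u₀ := u₀ - l) (by simpa) u)
    have h1 := hm (u + l)
    have h2 := hl u
    rw [add_assoc] at h1
    linear_combination k u * h1 + k (u + (l + m)) * h2
  neg_mem' := by
    intro l hl u
    have := hl (u + -l)
    rw [neg_add_cancel_right] at this
    linear_combination -this

lemma isClosed_ratioPeriods {f k : ℂ → ℂ} (hf : Differentiable ℂ f) (hk : Differentiable ℂ k)
    {u₀ : ℂ} (h₀ : k u₀ ≠ 0) : IsClosed (ratioPeriods hf hk h₀ : Set ℂ) := by
  have : (ratioPeriods hf hk h₀ : Set ℂ) = ⋂ u, {l | f (u + l) * k u = f u * k (u + l)} := by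
    ext l; simp [ratioPeriods]
  rw [this]
  have hf' := hf.continuous
  have hk' := hk.continuous
  exact isClosed_iInter fun u => isClosed_eq (by fun_prop) (by fun_prop)

/-- Entire functions agreeing at a point, whose ratio is invariant under two translations with
irrational quotient, are equal. -/
lemma eq_of_irrational_ratioPeriods {f k : ℂ → ℂ} (hf : Differentiable ℂ f)
    (hk : Differentiable ℂ k) {u₀ : ℂ} (h₀ : k u₀ ≠ 0) (he : f u₀ = k u₀) {l : ℂ} (hl : l ≠ 0)
    {s : ℝ} (hs : Irrational s) (h1 : l ∈ ratioPeriods hf hk h₀)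
    (h2 : s * l ∈ ratioPeriods hf hk h₀) : f = k := by
  -- The real x for which x l is a period form a closed subgroup containing 1 and the irrational s,
  -- hence all of ℝ. The functions then agree on a real line, and so everywhere.
  set S : AddSubgroup ℝ := (ratioPeriods hf hk h₀).comap
    ((AddMonoidHom.mulRight l).comp ofRealHom.toAddMonoidHom) with hS
  have hSc : IsClosed (S : Set ℝ) :=
    (isClosed_ratioPeriods hf hk h₀).preimage (by fun_prop : Continuous fun x : ℝ => (x : ℂ) * l)
  have hle : AddSubgroup.closure {s, 1} ≤ S := by
    rw [AddSubgroup.closure_le]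
    rintro x (rfl | rfl)
    · exact h2
    · change ((1 : ℝ) : ℂ) * l ∈ ratioPeriods hf hk h₀
      simpa
  have hd : Dense (S : Set ℝ) :=
    (dense_addSubgroupClosure_pair_iff.2 (by simpa using hs)).mono hle
  have hall : ∀ x : ℝ, f (u₀ + x * l) = k (u₀ + x * l) := by
    intro x
    have hx : x ∈ (S : Set ℝ) := by rw [← hSc.closure_eq, hd.closure_eq]; trivial
    have := (hx : (x : ℂ) * l ∈ ratioPeriods hf hk h₀) u₀
    rw [he, mul_comm] at this
    exact mul_left_cancel₀ h₀ this
  have hz : (fun z => f (u₀ + z * l)) = fun z => k (u₀ + z * l) := by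
    refine AnalyticOnNhd.eq_of_frequently_eq (z₀ := 0) (fun z _ => ?_) (fun z _ => ?_) ?_
    · exact Differentiable.analyticAt (by fun_prop) z
    · exact Differentiable.analyticAt (by fun_prop) z
    · have ht : Tendsto (fun x : ℝ => (x : ℂ)) (𝓝[≠] 0) (𝓝[≠] 0) := by
        refine tendsto_nhdsWithin_iff.2 ⟨?_, ?_⟩
        · exact (continuous_ofReal.tendsto' 0 0 (by simp)).mono_left nhdsWithin_le_nhds
        · filter_upwards [self_mem_nhdsWithin] with x hx
          simpa using hx
      exact ht.frequently (Eventually.frequently (.of_forall hall))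
  funext u
  have := congrFun hz ((u - u₀) / l)
  simpa [div_mul_cancel₀ _ hl] using this

/-- If n is the denominator of b, then nω₃ - (nb)ω₂ = naω₁ is a period and an irrational multiple of
the period ω₁. -/
lemma modSide_eq_dualSide_of_irrational (h₁₂ : 0 < (ω₁ / ω₂).im) (h₃₁ : 0 < (ω₃ / ω₁).im)
    (h₃₂ : 0 < (ω₃ / ω₂).im) {a : ℝ} (ha : Irrational a) (b : ℚ)
    (h : ω₃ = a * ω₁ + b * ω₂) : modSide ω₁ ω₂ ω₃ = dualSide ω₁ ω₂ ω₃ := by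
  have hf := differentiable_modSide h₁₂ h₃₁ h₃₂
  have hk := differentiable_dualSide h₁₂ h₃₁ h₃₂
  obtain ⟨he, h₀⟩ := modSide_center h₁₂ h₃₁ h₃₂
  have m1 : ω₁ ∈ ratioPeriods hf hk h₀ := modSide_add_fst h₁₂ h₃₁ h₃₂
  have m2 : ω₂ ∈ ratioPeriods hf hk h₀ := modSide_add_snd h₁₂ h₃₁ h₃₂
  have m3 : ω₃ ∈ ratioPeriods hf hk h₀ := modSide_add_thd h₁₂ h₃₁ h₃₂
  refine eq_of_irrational_ratioPeriods hf hk h₀ he (ne_zero_of_div_im_pos h₁₂).1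
    (s := b.den * a) (ha.natCast_mul b.den_nz) m1 ?_
  have e : ((b.den * a : ℝ) : ℂ) * ω₁ = b.den • ω₃ - b.num • ω₂ := by
    have hb : (b : ℂ) * b.den = b.num := by exact_mod_cast Rat.mul_den_eq_num b
    rw [h, nsmul_eq_mul, zsmul_eq_mul]
    push_cast
    linear_combination (-ω₂) * hb
  rw [e]
  exact sub_mem (nsmul_mem m3 _) (zsmul_mem m2 _)

lemma exists_real_coords (h : 0 < (ω₁ / ω₂).im) (z : ℂ) : ∃ a b : ℝ, z = a * ω₁ + b * ω₂ := by
  have h2 := (ne_zero_of_div_im_pos h).2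
  refine ⟨(z / ω₂).im / (ω₁ / ω₂).im,
    (z / ω₂).re - (z / ω₂).im / (ω₁ / ω₂).im * (ω₁ / ω₂).re, ?_⟩
  have e : z / ω₂ = ((z / ω₂).im / (ω₁ / ω₂).im : ℝ) * (ω₁ / ω₂) +
      ((z / ω₂).re - (z / ω₂).im / (ω₁ / ω₂).im * (ω₁ / ω₂).re : ℝ) := by
    apply Complex.ext
    · simp only [add_re, re_ofReal_mul, ofReal_re]; ring
    · simp only [add_im, im_ofReal_mul, ofReal_im]; field_simp; ring
  calc z = z / ω₂ * ω₂ := by field_simp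
    _ = _ := by nth_rewrite 1 [e]; rw [add_mul, mul_assoc, div_mul_cancel₀ _ h2]

lemma continuousAt_modSide (h₁₂ : 0 < (ω₁ / ω₂).im) (h₃₁ : 0 < (ω₃ / ω₁).im)
    (h₃₂ : 0 < (ω₃ / ω₂).im) (u : ℂ) : ContinuousAt (fun w => modSide ω₁ ω₂ w u) ω₃ := by
  have n1 := norm_e2pi_lt_one.2 h₁₂
  have n2 := norm_e2pi_lt_one.2 h₃₁
  have n3 := norm_e2pi_lt_one.2 h₃₂
  have n4 := norm_e2pi_lt_one.2 (neg_div_im_pos h₁₂)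
  have n5 := norm_e2pi_lt_one.2 (neg_div_im_pos h₃₁)
  have n6 := norm_e2pi_lt_one.2 (neg_div_im_pos h₃₂)
  obtain ⟨h₃, h₁⟩ := ne_zero_of_div_im_pos h₃₁
  obtain ⟨-, h₂⟩ := ne_zero_of_div_im_pos h₃₂
  have c0 : ∀ c : ℂ, ContinuousAt (fun w => e2pi (-(c / w))) ω₃ := fun c =>
    continuous_e2pi.continuousAt.comp (continuousAt_const.div continuousAt_id h₃).neg
  have c1 : ContinuousAt (fun w => ellPoch (e2pi ((w + ω₁ - u) / ω₂)) (e2pi (w / ω₂))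
      (e2pi (ω₁ / ω₂))) ω₃ :=
    ContinuousAt.ellPoch (f := fun w => e2pi ((w + ω₁ - u) / ω₂)) (g := fun w => e2pi (w / ω₂))
      (h := fun _ => e2pi (ω₁ / ω₂)) (by fun_prop) (by fun_prop) (by fun_prop) n3 n1
  have c2 : ContinuousAt (fun w => ellPoch (e2pi ((u - ω₂) / ω₁)) (e2pi (w / ω₁))
      (e2pi (-(ω₂ / ω₁)))) ω₃ :=
    ContinuousAt.ellPoch (f := fun _ => e2pi ((u - ω₂) / ω₁)) (g := fun w => e2pi (w / ω₁))
      (h := fun _ => e2pi (-(ω₂ / ω₁))) (by fun_prop) (by fun_prop) (by fun_prop) n2 n4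
  have c3 := (c0 u).ellPoch (c0 ω₁) (c0 ω₂) n5 n6
  have c4 : ContinuousAt (fun w => exp (Real.pi * I * cubicP ω₁ ω₂ w u)) ω₃ := by
    simp only [cubicP]
    have : 3 * ω₁ * ω₂ * ω₃ ≠ 0 := by simp [h₁, h₂, h₃]
    fun_prop (disch := assumption)
  exact ((c1.mul c2).mul c3).mul c4

lemma continuousAt_dualSide (h₁₂ : 0 < (ω₁ / ω₂).im) (h₃₁ : 0 < (ω₃ / ω₁).im)
    (h₃₂ : 0 < (ω₃ / ω₂).im) (u : ℂ) : ContinuousAt (fun w => dualSide ω₁ ω₂ w u) ω₃ := by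
  have n1 := norm_e2pi_lt_one.2 h₁₂
  have n2 := norm_e2pi_lt_one.2 h₃₁
  have n3 := norm_e2pi_lt_one.2 h₃₂
  have n4 := norm_e2pi_lt_one.2 (neg_div_im_pos h₁₂)
  have n5 := norm_e2pi_lt_one.2 (neg_div_im_pos h₃₁)
  have n6 := norm_e2pi_lt_one.2 (neg_div_im_pos h₃₂)
  have h₃ := (ne_zero_of_div_im_pos h₃₁).1
  have c0 : ∀ c : ℂ, ContinuousAt (fun w => e2pi (-(c / w))) ω₃ := fun c =>
    continuous_e2pi.continuousAt.comp (continuousAt_const.div continuousAt_id h₃).neg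
  have c1 : ContinuousAt (fun w => e2pi ((u - ω₁ - ω₂) / w)) ω₃ :=
    continuous_e2pi.continuousAt.comp (continuousAt_const.div continuousAt_id h₃)
  have c2 : ContinuousAt (fun w => ellPoch (e2pi (u / ω₂)) (e2pi (w / ω₂)) (e2pi (ω₁ / ω₂))) ω₃ :=
    ContinuousAt.ellPoch (f := fun _ => e2pi (u / ω₂)) (g := fun w => e2pi (w / ω₂))
      (h := fun _ => e2pi (ω₁ / ω₂)) (by fun_prop) (by fun_prop) (by fun_prop) n3 n1
  have c3 : ContinuousAt (fun w => ellPoch (e2pi ((w - u) / ω₁)) (e2pi (w / ω₁))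
      (e2pi (-(ω₂ / ω₁)))) ω₃ :=
    ContinuousAt.ellPoch (f := fun w => e2pi ((w - u) / ω₁)) (g := fun w => e2pi (w / ω₁))
      (h := fun _ => e2pi (-(ω₂ / ω₁))) (by fun_prop) (by fun_prop) (by fun_prop) n2 n4
  exact (c1.ellPoch (c0 ω₁) (c0 ω₂) n5 n6).mul (c2.mul c3)

/-- The modular identity for the elliptic gamma function, in product form. -/
lemma modSide_eq_dualSide (h₁₂ : 0 < (ω₁ / ω₂).im) (h₃₁ : 0 < (ω₃ / ω₁).im)
    (h₃₂ : 0 < (ω₃ / ω₂).im) (u : ℂ) : modSide ω₁ ω₂ ω₃ u = dualSide ω₁ ω₂ ω₃ u := by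
  obtain ⟨a, b, hab⟩ := exists_real_coords h₁₂ ω₃
  set φ : ℝ × ℝ → ℂ := fun x => x.1 * ω₁ + x.2 * ω₂ with hφ
  have hφc : Continuous φ := by fun_prop
  have hφ0 : φ (a, b) = ω₃ := hab.symm
  have hT : Tendsto (fun x => modSide ω₁ ω₂ (φ x) u - dualSide ω₁ ω₂ (φ x) u) (𝓝 (a, b))
      (𝓝 (modSide ω₁ ω₂ ω₃ u - dualSide ω₁ ω₂ ω₃ u)) :=
    ((continuousAt_modSide h₁₂ h₃₁ h₃₂ u).sub (continuousAt_dualSide h₁₂ h₃₁ h₃₂ u)).tendsto.comp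
      (hφc.tendsto' _ _ hφ0)
  -- Pairs with irrational first and rational second coordinate are dense, so the case already
  -- settled occurs arbitrarily near ω₃.
  have hfr : ∃ᶠ x in 𝓝 (a, b), x ∈ {x : ℝ | Irrational x} ×ˢ Set.range ((↑) : ℚ → ℝ) :=
    mem_closure_iff_frequently.1 ((dense_irrational.prod Rat.denseRange_cast) (a, b))
  have e1 : ∀ᶠ x in 𝓝 (a, b), 0 < (φ x / ω₁).im :=
    ContinuousAt.eventually_lt continuousAt_const (by fun_prop) (by rwa [hφ0])
  have e2 : ∀ᶠ x in 𝓝 (a, b), 0 < (φ x / ω₂).im :=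
    ContinuousAt.eventually_lt continuousAt_const (by fun_prop) (by rwa [hφ0])
  have hfr' : ∃ᶠ x in 𝓝 (a, b), modSide ω₁ ω₂ (φ x) u - dualSide ω₁ ω₂ (φ x) u ∈ ({0} : Set ℂ) := by
    refine (hfr.and_eventually (e1.and e2)).mono ?_
    rintro ⟨x, y⟩ ⟨⟨hx, c, rfl⟩, h1, h2⟩
    rw [Set.mem_singleton_iff, sub_eq_zero]
    exact congrFun (modSide_eq_dualSide_of_irrational h₁₂ h1 h2 hx c (by simp [hφ])) u
  have := mem_closure_of_frequently_of_tendsto hfr' hT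
  rw [closure_singleton, Set.mem_singleton_iff, sub_eq_zero] at this
  exact this

end ModularGamma

/-! ### One representation of the modified gamma function for all |q| ≤ 1 -/

section ModifiedGamma

variable {ω₁ ω₂ ω₃ : ℂ}

lemma ellGamma_dual (u : ℂ) :
    ellGamma (e2pi (-(u / ω₃))) (e2pi (-(ω₁ / ω₃))) (e2pi (-(ω₂ / ω₃))) =
      dualNum ω₁ ω₂ ω₃ u / dualDen ω₁ ω₂ ω₃ u := by
  rw [ellGamma_eq, dualNum, dualDen, ← e2pi_add, ← e2pi_sub,
    show -(ω₁ / ω₃) + -(ω₂ / ω₃) - -(u / ω₃) = (u - ω₁ - ω₂) / ω₃ by ring]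

lemma ellGamma_mul_ellGamma_mod (v : ℂ) :
    ellGamma (e2pi (v / ω₂)) (e2pi (ω₃ / ω₂)) (e2pi (ω₁ / ω₂)) *
        ellGamma (e2pi (ω₃ / ω₁) * e2pi (-(v / ω₁))) (e2pi (ω₃ / ω₁)) (e2pi (-(ω₂ / ω₁))) =
      modNum ω₁ ω₂ ω₃ v / modDen ω₁ ω₂ ω₃ v := by
  rw [ellGamma_eq, ellGamma_eq, modNum, modDen, div_mul_div_comm, ← e2pi_add, ← e2pi_add,
    ← e2pi_add, ← e2pi_sub, ← e2pi_sub, show ω₃ / ω₂ + ω₁ / ω₂ - v / ω₂ = (ω₃ + ω₁ - v) / ω₂ by ring,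
    show ω₃ / ω₁ + -(ω₂ / ω₁) - (ω₃ / ω₁ + -(v / ω₁)) = (v - ω₂) / ω₁ by ring,
    show ω₃ / ω₁ + -(v / ω₁) = (ω₃ - v) / ω₁ by ring]

/-- The representation of the modified elliptic gamma function in terms of the bases `r̃`, `p̃`. -/
lemma modEllGamma_eq (h₃₁ : 0 < (ω₃ / ω₁).im) (h₃₂ : 0 < (ω₃ / ω₂).im) {u : ℂ}
    (hu : dualDen ω₁ ω₂ ω₃ u ≠ 0) :
    modEllGamma ω₁ ω₂ ω₃ u = exp (-(Real.pi * I * cubicP ω₁ ω₂ ω₃ u)) *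
      ellGamma (e2pi (-(u / ω₃))) (e2pi (-(ω₁ / ω₃))) (e2pi (-(ω₂ / ω₃))) := by
  rw [modEllGamma]
  split_ifs with h₁₂
  swap
  · rfl
  have n1 := norm_e2pi_lt_one.2 h₁₂
  have n2 := norm_e2pi_lt_one.2 h₃₁
  have n3 := norm_e2pi_lt_one.2 h₃₂
  have n4 := norm_e2pi_lt_one.2 (neg_div_im_pos h₁₂)
  have n5 := norm_e2pi_lt_one.2 (neg_div_im_pos h₃₁)
  have n6 := norm_e2pi_lt_one.2 (neg_div_im_pos h₃₂)
  have dN : Differentiable ℂ (modNum ω₁ ω₂ ω₃) :=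
    ((differentiable_ellPoch n3 n1).comp
      (by fun_prop : Differentiable ℂ fun u => e2pi ((ω₃ + ω₁ - u) / ω₂))).mul
    ((differentiable_ellPoch n2 n4).comp
      (by fun_prop : Differentiable ℂ fun u => e2pi ((u - ω₂) / ω₁)))
  have dD : Differentiable ℂ (modDen ω₁ ω₂ ω₃) :=
    ((differentiable_ellPoch n3 n1).comp
      (by fun_prop : Differentiable ℂ fun u => e2pi (u / ω₂))).mul
    ((differentiable_ellPoch n2 n4).comp
      (by fun_prop : Differentiable ℂ fun u => e2pi ((ω₃ - u) / ω₁)))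
  have dN' : Differentiable ℂ (dualNum ω₁ ω₂ ω₃) := (differentiable_ellPoch n5 n6).comp
    (by fun_prop : Differentiable ℂ fun u => e2pi ((u - ω₁ - ω₂) / ω₃))
  have dD' : Differentiable ℂ (dualDen ω₁ ω₂ ω₃) := (differentiable_ellPoch n5 n6).comp
    (by fun_prop : Differentiable ℂ fun u => e2pi (-(u / ω₃)))
  have dE : Differentiable ℂ fun u => cexp (-(Real.pi * I * cubicP ω₁ ω₂ ω₃ u)) := by
    simp only [cubicP]; fun_prop
  simp only [ellGamma_mul_ellGamma_mod, ellGamma_dual]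
  have hmer : MeromorphicOn (fun v => modNum ω₁ ω₂ ω₃ v / modDen ω₁ ω₂ ω₃ v) Set.univ :=
    fun v _ => (dN.analyticAt v).meromorphicAt.div (dD.analyticAt v).meromorphicAt
  set g : ℂ → ℂ := fun v => cexp (-(Real.pi * I * cubicP ω₁ ω₂ ω₃ v)) *
    (dualNum ω₁ ω₂ ω₃ v / dualDen ω₁ ω₂ ω₃ v) with hg
  -- The product defining G agrees near u, except perhaps at u, with a function analytic at u, and
  -- the normal form takes the value of the latter. So the value is right even where a pole of one
  -- factor meets a zero of the other.
  have hga : AnalyticAt ℂ g u :=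
    (dE.analyticAt u).mul ((dN'.analyticAt u).div (dD'.analyticAt u) hu)
  -- The zeros are isolated because the denominator is entire and nonzero at the centre.
  have hD0 : ∀ᶠ v in 𝓝[≠] u, modDen ω₁ ω₂ ω₃ v ≠ 0 := by
    refine ((dD.analyticAt u).eventually_eq_zero_or_eventually_ne_zero).resolve_left fun h => ?_
    have h0 := AnalyticOnNhd.eqOn_zero_of_preconnected_of_eventuallyEq_zero
      (fun z (_ : z ∈ Set.univ) => dD.analyticAt z) isPreconnected_univ (Set.mem_univ u) h
    have := (modSide_center h₁₂ h₃₁ h₃₂).2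
    rw [dualSide] at this
    exact (right_ne_zero_of_mul this) (h0 (Set.mem_univ _))
  have hD0' : ∀ᶠ v in 𝓝[≠] u, dualDen ω₁ ω₂ ω₃ v ≠ 0 :=
    (dD'.continuous.continuousAt.eventually_ne hu).filter_mono nhdsWithin_le_nhds
  have hfg : (fun v => modNum ω₁ ω₂ ω₃ v / modDen ω₁ ω₂ ω₃ v) =ᶠ[𝓝[≠] u] g := by
    filter_upwards [hD0, hD0'] with v h1 h2
    have h3 := modSide_eq_dualSide h₁₂ h₃₁ h₃₂ v
    rw [modSide, dualSide] at h3
    simp only [hg, exp_neg]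
    have h4 := exp_ne_zero (Real.pi * I * cubicP ω₁ ω₂ ω₃ v)
    field_simp
    linear_combination h3
  rw [toMeromorphicNFOn_eq_toMeromorphicNFAt hmer (Set.mem_univ u),
    (toMeromorphicNFAt_eventuallyEq_nhds_congr hfg).eq_of_nhds,
    toMeromorphicNFAt_eq_self.2 hga.meromorphicNFAt]

lemma modEllGamma_eq_of_im_neg (h₃₁ : 0 < (ω₃ / ω₁).im) (h₃₂ : 0 < (ω₃ / ω₂).im) {u : ℂ}
    (hu : (u / ω₃).im < 0) :
    modEllGamma ω₁ ω₂ ω₃ u = exp (-(Real.pi * I * cubicP ω₁ ω₂ ω₃ u)) *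
      ellGamma (e2pi (-(u / ω₃))) (e2pi (-(ω₁ / ω₃))) (e2pi (-(ω₂ / ω₃))) :=
  modEllGamma_eq h₃₁ h₃₂ (ellPoch_ne_zero_of_norm_lt_one (norm_e2pi_lt_one.2 (neg_div_im_pos h₃₁))
    (norm_e2pi_lt_one.2 (neg_div_im_pos h₃₂)) (norm_e2pi_lt_one.2 (by simpa using hu)))

lemma ellPoch_ne_zero_of_norm_eq_one {z p q : ℂ} (hp : ‖p‖ < 1) (hq : ‖q‖ < 1) (hz : ‖z‖ = 1)
    (hz1 : z ≠ 1) : ellPoch z p q ≠ 0 := by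
  rw [ellPoch_mul_left z hp hq, qPochInf_eq z hq]
  refine mul_ne_zero (mul_ne_zero (sub_ne_zero.2 hz1.symm) ?_) ?_
  · exact qPochInf_ne_zero_of_norm_lt_one hq (by rw [mul_comm]; exact norm_mul_lt_one hq hz.le)
  · exact ellPoch_ne_zero_of_norm_lt_one hp hq (by rw [mul_comm]; exact norm_mul_lt_one hp hz.le)

/-- Applied to z², this turns the denominator G(±2u) into the theta factor of `betaKernel`. At
argument 1 both sides are 0, by the convention for division by zero. -/
lemma inv_ellGamma_mul_ellGamma_inv {z p q : ℂ} (hp : ‖p‖ < 1) (hq : ‖q‖ < 1) (hz : ‖z‖ = 1) :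
    (ellGamma z p q * ellGamma z⁻¹ p q)⁻¹ = theta z p * theta z⁻¹ q := by
  have hn : ‖p * q‖ < 1 := norm_mul_lt_one hp hq.le
  have a1 := ellPoch_ne_zero_of_norm_lt_one hp hq (norm_mul_lt_one hn hz.le)
  have a2 := ellPoch_ne_zero_of_norm_lt_one hp hq (norm_div_lt_one hn hz.ge)
  have e1 : ellPoch z p q = qPochInf z p * (qPochInf (q * z) q * ellPoch (p * q * z) p q) := by
    rw [ellPoch_mul_right z hp hq, ellPoch_mul_left (z * q) hp hq, mul_comm z q,
      show q * z * p = p * q * z by ring]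
  have e2 : ellPoch z⁻¹ p q = qPochInf z⁻¹ q * (qPochInf (p / z) p * ellPoch (p * q / z) p q) := by
    rw [ellPoch_mul_left z⁻¹ hp hq, ellPoch_mul_right (z⁻¹ * p) hp hq,
      show z⁻¹ * p * q = p * q / z by ring, show z⁻¹ * p = p / z by ring]
  rw [ellGamma_eq, ellGamma_eq, theta, theta, div_inv_eq_mul, div_inv_eq_mul, e1, e2, mul_inv,
    inv_div, inv_div]
  generalize ellPoch (p * q * z) p q = a at *
  generalize ellPoch (p * q / z) p q = b at *
  generalize qPochInf z⁻¹ q = c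
  field_simp

end ModifiedGamma

/-! ### Cancellation of the cubic exponents -/

section Exponents

/-- The sum of cubic polynomials over pairs. -/
lemma sum_cubic_pairs (x : Fin 6 → ℂ) (s c u : ℂ) (hx : ∑ j, x j = 2 * s) {f : ℂ → ℂ}
    (hf : ∀ y, f y = (y - s) * ((y - s) ^ 2 - c)) :
    ∑ j, ∑ m ∈ Finset.Ioi j, f (x j + x m) =
      ∑ j, (f (x j + u) + f (x j - u)) - (f (2 * u) + f (-(2 * u))) + (s ^ 3 - c * s) := by
  have e : ∀ F : Fin 6 → Fin 6 → ℂ, ∑ j, ∑ m ∈ Finset.Ioi j, F j m =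
      F 0 1 + F 0 2 + F 0 3 + F 0 4 + F 0 5 + (F 1 2 + F 1 3 + F 1 4 + F 1 5) +
        (F 2 3 + F 2 4 + F 2 5) + (F 3 4 + F 3 5) + F 4 5 := by
    intro F
    rw [Fin.sum_univ_six, show Finset.Ioi (0 : Fin 6) = {1, 2, 3, 4, 5} by decide,
      show Finset.Ioi (1 : Fin 6) = {2, 3, 4, 5} by decide,
      show Finset.Ioi (2 : Fin 6) = {3, 4, 5} by decide,
      show Finset.Ioi (3 : Fin 6) = {4, 5} by decide,
      show Finset.Ioi (4 : Fin 6) = {5} by decide,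
      show Finset.Ioi (5 : Fin 6) = ∅ by decide]
    simp
    ring
  rw [e, Fin.sum_univ_six]
  rw [Fin.sum_univ_six] at hx
  have h5 : x 5 = 2 * s - (x 0 + x 1 + x 2 + x 3 + x 4) := by linear_combination hx
  simp only [hf, h5]
  ring

variable {ω₁ ω₂ ω₃ : ℂ}

/-- The balancing condition cancels the dependence on u, so the exponentials leave the integral. The
constant left over is the exponent produced by the modular transformations in `kappaTilde_mul`. -/
lemma sum_cubicP_pairs (h₁ : ω₁ ≠ 0) (h₂ : ω₂ ≠ 0) (h₃ : ω₃ ≠ 0) (g : Fin 6 → ℂ)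
    (hsum : ∑ j, g j = ω₁ + ω₂ + ω₃) (u : ℂ) :
    ∑ j, ∑ m ∈ Finset.Ioi j, cubicP ω₁ ω₂ ω₃ (g j + g m) =
      ∑ j, (cubicP ω₁ ω₂ ω₃ (g j + u) + cubicP ω₁ ω₂ ω₃ (g j - u)) -
        (cubicP ω₁ ω₂ ω₃ (2 * u) + cubicP ω₁ ω₂ ω₃ (-(2 * u))) +
      ((ω₁ / ω₂ + 1 / (ω₁ / ω₂) + (ω₃ / ω₂ + 1 / (ω₃ / ω₂)) + (ω₃ / ω₁ + 1 / (ω₃ / ω₁))) / 12 +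
        1 / 4) := by
  set D := 3 * ω₁ * ω₂ * ω₃ with hD
  have hD0 : D ≠ 0 := by simp [hD, h₁, h₂, h₃]
  set s := (ω₁ + ω₂ + ω₃) / 2 with hs
  set c := (ω₁ ^ 2 + ω₂ ^ 2 + ω₃ ^ 2) / 4 with hc
  have key := sum_cubic_pairs g s c u (f := fun y => (y - s) * ((y - s) ^ 2 - c))
    (by rw [hsum, hs]; ring) (fun _ => rfl)
  have e0 : ∀ y, cubicP ω₁ ω₂ ω₃ y = (y - s) * ((y - s) ^ 2 - c) / D := fun y => rfl
  have e1 : (ω₁ / ω₂ + 1 / (ω₁ / ω₂) + (ω₃ / ω₂ + 1 / (ω₃ / ω₂)) + (ω₃ / ω₁ + 1 / (ω₃ / ω₁))) / 12 +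
        1 / 4 = (s ^ 3 - c * s) / D := by
    rw [hs, hc, hD]; field_simp; ring
  rw [e1]
  simp only [e0, ← Finset.sum_div, ← add_div, ← sub_div]
  rw [key]

end Exponents

/-! ### Modular form of the constant κ̃ -/

section Constant

variable {ω₁ ω₂ ω₃ : ℂ}

/-- The closed form for Im τ > 0 is continuous on the slit plane, so it also gives the limit at real
τ; 0 ≤ Im τ makes the approach from the upper half-plane possible. -/
lemma pochRatio_eq {τ : ℂ} (hτ : 0 ≤ τ.im) (hs : τ ∈ slitPlane) :
    pochRatio τ = exp (Real.pi * I / 4 - log τ / 2 - Real.pi * I * (τ + 1 / τ) / 12) := by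
  rw [pochRatio]
  split_ifs with h
  · exact pochRatioUpper_eq h
  have : (𝓝[{σ : ℂ | 0 < σ.im}] τ).NeBot := by
    rw [← mem_closure_iff_nhdsWithin_neBot, closure_setOfPred_lt_im]
    exact hτ
  refine Tendsto.limUnder_eq ?_
  have hc : ContinuousAt (fun τ => exp (Real.pi * I / 4 - log τ / 2 -
      Real.pi * I * (τ + 1 / τ) / 12)) τ := by
    have h0 := slitPlane_ne_zero hs
    fun_prop (disch := assumption)
  refine (hc.tendsto.mono_left nhdsWithin_le_nhds).congr' ?_
  filter_upwards [self_mem_nhdsWithin] with σ hσ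
  exact (pochRatioUpper_eq hσ).symm

/-- If ω₁/ω₂ is real, it carries ω₃/ω₁ to ω₃/ω₂, both in the upper half-plane, so it is positive. -/
lemma div_mem_slitPlane (h₁₂ : 0 ≤ (ω₁ / ω₂).im) (h₃₁ : 0 < (ω₃ / ω₁).im)
    (h₃₂ : 0 < (ω₃ / ω₂).im) : ω₁ / ω₂ ∈ slitPlane := by
  rcases h₁₂.lt_or_eq with h | h
  · exact Or.inr h.ne'
  · left
    have h₁ := (ne_zero_of_div_im_pos h₃₁).2
    rw [show ω₃ / ω₂ = ω₃ / ω₁ * (ω₁ / ω₂) by field_simp, mul_im, ← h, mul_zero, zero_add] at h₃₂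
    exact (pos_iff_pos_of_mul_pos h₃₂).1 h₃₁

/-- The two sides differ by 2πin. All arguments lie in [0, π], and those of ω₃/ω₁ and ω₃/ω₂ are
below π, so the difference lies strictly between -π and 2π and n = 0. -/
lemma log_div_add_log_div (h₁₂ : 0 ≤ (ω₁ / ω₂).im) (h₃₁ : 0 < (ω₃ / ω₁).im)
    (h₃₂ : 0 < (ω₃ / ω₂).im) : log (ω₁ / ω₂) + log (ω₃ / ω₁) = log (ω₃ / ω₂) := by
  obtain ⟨h₃, h₁⟩ := ne_zero_of_div_im_pos h₃₁
  obtain ⟨-, h₂⟩ := ne_zero_of_div_im_pos h₃₂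
  have e : exp (log (ω₁ / ω₂) + log (ω₃ / ω₁)) = exp (log (ω₃ / ω₂)) := by
    rw [exp_add, exp_log (div_ne_zero h₁ h₂), exp_log (div_ne_zero h₃ h₁),
      exp_log (div_ne_zero h₃ h₂)]
    field_simp
  obtain ⟨n, hn⟩ := exp_eq_exp_iff_exists_int.1 e
  have him := congrArg im hn
  simp only [add_im, log_im, mul_im, intCast_re, intCast_im, zero_mul, add_zero] at him
  simp only [mul_re, re_ofNat, ofReal_re, im_ofNat, ofReal_im, I_im, I_re, mul_zero,
    mul_one, add_zero, zero_mul, sub_zero] at him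
  have a1 := arg_nonneg_iff.2 h₁₂
  have a2 := arg_nonneg_iff.2 h₃₁.le
  have a3 := arg_nonneg_iff.2 h₃₂.le
  have b1 := arg_le_pi (ω₁ / ω₂)
  have b2 := arg_lt_pi_iff.2 (Or.inr h₃₁.ne')
  have b3 := arg_lt_pi_iff.2 (Or.inr h₃₂.ne')
  have hpi := Real.pi_pos
  have hn0 : n = 0 := by
    have l1 : (-1 : ℝ) < n := by
      by_contra! hc
      nlinarith
    have l2 : (n : ℝ) < 1 := by
      by_contra! hc
      nlinarith
    have l1' : (-1 : ℤ) < n := by exact_mod_cast l1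
    have l2' : n < (1 : ℤ) := by exact_mod_cast l2
    omega
  rw [hn, hn0]; simp

/-- The transformation is applied with moduli ω₁/ω₂, ω₃/ω₂ and ω₃/ω₁. The halved logarithms add up
to log(ω₃/ω₂), which cancels the Jacobian ω₃/ω₂ of u = tω₃, and the sign -1 combines with e^{3πi/4}
to e^{-πi/4}. -/
lemma kappaTilde_mul (h₁₂ : 0 ≤ (ω₁ / ω₂).im) (h₃₁ : 0 < (ω₃ / ω₁).im)
    (h₃₂ : 0 < (ω₃ / ω₂).im) :
    kappaTilde ω₁ ω₂ ω₃ * (ω₃ / ω₂) =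
      qPochInf (e2pi (-(ω₁ / ω₃))) (e2pi (-(ω₁ / ω₃))) *
        qPochInf (e2pi (-(ω₂ / ω₃))) (e2pi (-(ω₂ / ω₃))) / 2 *
      exp (-(Real.pi * I * ((ω₁ / ω₂ + 1 / (ω₁ / ω₂) + (ω₃ / ω₂ + 1 / (ω₃ / ω₂)) +
        (ω₃ / ω₁ + 1 / (ω₃ / ω₁))) / 12 + 1 / 4))) := by
  obtain ⟨h₃, h₁⟩ := ne_zero_of_div_im_pos h₃₁
  obtain ⟨-, h₂⟩ := ne_zero_of_div_im_pos h₃₂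
  have n5 := norm_e2pi_lt_one.2 (neg_div_im_pos h₃₁)
  have n6 := norm_e2pi_lt_one.2 (neg_div_im_pos h₃₂)
  have q5 := qPochInf_ne_zero_of_norm_lt_one n5 n5
  have q6 := qPochInf_ne_zero_of_norm_lt_one n6 n6
  have r1 := pochRatioUpper_eq h₃₁
  have r2 := pochRatioUpper_eq h₃₂
  rw [pochRatioUpper, one_div_div, div_eq_iff q5] at r1
  rw [pochRatioUpper, one_div_div, div_eq_iff q6] at r2
  have hx : exp (log (ω₃ / ω₂)) = ω₃ / ω₂ := exp_log (div_ne_zero h₃ h₂)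
  have hm : (-1 : ℂ) = exp (-(Real.pi * I)) := by rw [exp_neg, exp_pi_mul_I]; norm_num
  have hL := log_div_add_log_div h₁₂ h₃₁ h₃₂
  have key : -1 * exp (Real.pi * I / 4 - log (ω₁ / ω₂) / 2 -
        Real.pi * I * (ω₁ / ω₂ + 1 / (ω₁ / ω₂)) / 12) *
      exp (Real.pi * I / 4 - log (ω₃ / ω₂) / 2 - Real.pi * I * (ω₃ / ω₂ + ω₂ / ω₃) / 12) *
      exp (Real.pi * I / 4 - log (ω₃ / ω₁) / 2 - Real.pi * I * (ω₃ / ω₁ + ω₁ / ω₃) / 12) *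
      exp (log (ω₃ / ω₂)) =
      exp (-(Real.pi * I * ((ω₁ / ω₂ + 1 / (ω₁ / ω₂) + (ω₃ / ω₂ + 1 / (ω₃ / ω₂)) +
        (ω₃ / ω₁ + 1 / (ω₃ / ω₁))) / 12 + 1 / 4))) := by
    conv_lhs => rw [hm, ← exp_add, ← exp_add, ← exp_add, ← exp_add]
    rw [one_div_div ω₃, one_div_div ω₃]
    congr 1
    linear_combination (-1 / 2 : ℂ) * hL
  rw [hx] at key
  rw [kappaTilde, pochRatio_eq h₁₂ (div_mem_slitPlane h₁₂ h₃₁ h₃₂), r1, r2, ← key]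
  ring

end Constant

/-! ### Reduction to the standard elliptic beta integral -/

section MainIntegral

variable {ω₁ ω₂ ω₃ : ℂ} {g : Fin 6 → ℂ}

lemma prod_modEllGamma_pairs (h₃₁ : 0 < (ω₃ / ω₁).im) (h₃₂ : 0 < (ω₃ / ω₂).im)
    (hg : ∀ j, (g j / ω₃).im < 0) :
    ∏ j : Fin 6, ∏ m ∈ Finset.Ioi j, modEllGamma ω₁ ω₂ ω₃ (g j + g m) =
      exp (-(Real.pi * I * ∑ j, ∑ m ∈ Finset.Ioi j, cubicP ω₁ ω₂ ω₃ (g j + g m))) *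
        pairProd (e2pi (-(ω₁ / ω₃))) (e2pi (-(ω₂ / ω₃))) fun j => e2pi (-(g j / ω₃)) := by
  have h : ∀ j m, modEllGamma ω₁ ω₂ ω₃ (g j + g m) =
      exp (-(Real.pi * I * cubicP ω₁ ω₂ ω₃ (g j + g m))) *
        ellGamma (e2pi (-(g j / ω₃)) * e2pi (-(g m / ω₃))) (e2pi (-(ω₁ / ω₃)))
          (e2pi (-(ω₂ / ω₃))) := by
    intro j m
    rw [modEllGamma_eq_of_im_neg h₃₁ h₃₂ (by rw [add_div, add_im]; linarith [hg j, hg m]),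
      ← e2pi_add, show -(g j / ω₃) + -(g m / ω₃) = -((g j + g m) / ω₃) by ring]
  simp only [h, Finset.prod_mul_distrib, ← exp_sum, pairProd, Finset.mul_sum,
    Finset.sum_neg_distrib]

/-- The points with z² = 1 are left out because `dualDen` vanishes at ±2u there and `modEllGamma_eq`
does not apply. They form a countable set of t and do not affect the integral. -/
lemma betaIntegrand_eq (h₃₁ : 0 < (ω₃ / ω₁).im) (h₃₂ : 0 < (ω₃ / ω₂).im)
    (hg : ∀ j, (g j / ω₃).im < 0) (hsum : ∑ j, g j = ω₁ + ω₂ + ω₃) {t : ℝ}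
    (ht : e2pi t ^ 2 ≠ 1) :
    betaIntegrand ω₁ ω₂ ω₃ g (t * ω₃) =
      exp (-(Real.pi * I * (∑ j, ∑ m ∈ Finset.Ioi j, cubicP ω₁ ω₂ ω₃ (g j + g m) -
        ((ω₁ / ω₂ + 1 / (ω₁ / ω₂) + (ω₃ / ω₂ + 1 / (ω₃ / ω₂)) + (ω₃ / ω₁ + 1 / (ω₃ / ω₁))) / 12 +
          1 / 4)))) *
        betaKernel (e2pi (-(ω₁ / ω₃))) (e2pi (-(ω₂ / ω₃))) (fun j => e2pi (-(g j / ω₃)))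
          (e2pi t) := by
  obtain ⟨h₃, h₁⟩ := ne_zero_of_div_im_pos h₃₁
  obtain ⟨-, h₂⟩ := ne_zero_of_div_im_pos h₃₂
  set P := e2pi (-(ω₁ / ω₃)) with hP
  set Q := e2pi (-(ω₂ / ω₃)) with hQ
  have hp : ‖P‖ < 1 := norm_e2pi_lt_one.2 (neg_div_im_pos h₃₁)
  have hq : ‖Q‖ < 1 := norm_e2pi_lt_one.2 (neg_div_im_pos h₃₂)
  set z := e2pi t with hz
  have hz1 : ‖z‖ = 1 := norm_e2pi_real t
  have hz2 : ‖z ^ 2‖ = 1 := by rw [norm_pow, hz1, one_pow]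
  have ez : e2pi (2 * t) = z ^ 2 := by rw [two_mul, e2pi_add, sq]
  have hplus : ∀ j, modEllGamma ω₁ ω₂ ω₃ (g j + t * ω₃) =
      exp (-(Real.pi * I * cubicP ω₁ ω₂ ω₃ (g j + t * ω₃))) *
        ellGamma (e2pi (-(g j / ω₃)) / z) P Q := by
    intro j
    have e : (g j + t * ω₃) / ω₃ = g j / ω₃ + t := by field_simp
    rw [modEllGamma_eq_of_im_neg h₃₁ h₃₂ (by rw [e]; simpa using hg j), e, hz, ← e2pi_sub,
      neg_add']
  have hminus : ∀ j, modEllGamma ω₁ ω₂ ω₃ (g j - t * ω₃) =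
      exp (-(Real.pi * I * cubicP ω₁ ω₂ ω₃ (g j - t * ω₃))) *
        ellGamma (e2pi (-(g j / ω₃)) * z) P Q := by
    intro j
    have e : (g j - t * ω₃) / ω₃ = g j / ω₃ - t := by field_simp
    rw [modEllGamma_eq_of_im_neg h₃₁ h₃₂ (by rw [e]; simpa using hg j), e, hz, ← e2pi_add,
      neg_sub', sub_neg_eq_add]
  have hd1 : modEllGamma ω₁ ω₂ ω₃ (2 * (t * ω₃)) =
      exp (-(Real.pi * I * cubicP ω₁ ω₂ ω₃ (2 * (t * ω₃)))) * ellGamma (z ^ 2)⁻¹ P Q := by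
    have e : e2pi (-(2 * (t * ω₃) / ω₃)) = (z ^ 2)⁻¹ := by
      rw [← ez, ← e2pi_neg]; congr 1; field_simp
    rw [modEllGamma_eq h₃₁ h₃₂, e]
    rw [dualDen, e]
    exact ellPoch_ne_zero_of_norm_eq_one hp hq (by rw [norm_inv, hz2, inv_one]) (by simpa using ht)
  have hd2 : modEllGamma ω₁ ω₂ ω₃ (-(2 * (t * ω₃))) =
      exp (-(Real.pi * I * cubicP ω₁ ω₂ ω₃ (-(2 * (t * ω₃))))) * ellGamma (z ^ 2) P Q := by
    have e : e2pi (-(-(2 * (t * ω₃)) / ω₃)) = z ^ 2 := by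
      rw [← ez]; congr 1; field_simp
    rw [modEllGamma_eq h₃₁ h₃₂, e]
    rw [dualDen, e]
    exact ellPoch_ne_zero_of_norm_eq_one hp hq hz2 ht
  have hS := sum_cubicP_pairs h₁ h₂ h₃ g hsum (t * ω₃)
  rw [betaIntegrand, hd1, hd2, betaKernel, ← inv_ellGamma_mul_ellGamma_inv hp hq hz2, hS,
    add_sub_cancel_right]
  simp only [hplus, hminus, Finset.prod_mul_distrib, ← exp_sum]
  have e1 : exp (-(Real.pi * I * (∑ j, (cubicP ω₁ ω₂ ω₃ (g j + t * ω₃) +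
      cubicP ω₁ ω₂ ω₃ (g j - t * ω₃)) -
        (cubicP ω₁ ω₂ ω₃ (2 * (t * ω₃)) + cubicP ω₁ ω₂ ω₃ (-(2 * (t * ω₃))))))) =
      exp (∑ j, -(Real.pi * I * cubicP ω₁ ω₂ ω₃ (g j + t * ω₃))) *
        exp (∑ j, -(Real.pi * I * cubicP ω₁ ω₂ ω₃ (g j - t * ω₃))) /
        (exp (-(Real.pi * I * cubicP ω₁ ω₂ ω₃ (2 * (t * ω₃)))) *
          exp (-(Real.pi * I * cubicP ω₁ ω₂ ω₃ (-(2 * (t * ω₃)))))) := by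
    rw [← exp_add, ← exp_add, ← exp_sub]
    congr 1
    simp only [Finset.sum_neg_distrib, ← Finset.mul_sum, Finset.sum_add_distrib]
    ring
  rw [e1]
  simp only [div_eq_mul_inv, mul_inv]
  ring

lemma ae_e2pi_sq_ne_one : ∀ᵐ t : ℝ, e2pi t ^ 2 ≠ 1 := by
  refine Set.Countable.ae_notMem (s := {t : ℝ | e2pi t ^ 2 = 1}) ?_ _
  refine (Set.countable_range fun n : ℤ => (n / 2 : ℝ)).mono fun t ht => ?_
  have h : e2pi (2 * t) = 1 := by rw [two_mul, e2pi_add, ← sq]; exact ht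
  obtain ⟨n, hn⟩ := e2pi_eq_one_iff.1 h
  refine ⟨n, ?_⟩
  have : 2 * t = n := by exact_mod_cast hn
  simp only
  linarith

/-- The elliptic beta integral in terms of the modified elliptic gamma function. -/
theorem modified_beta_integral (h₁₂ : 0 ≤ (ω₁ / ω₂).im) (h₃₁ : 0 < (ω₃ / ω₁).im)
    (h₃₂ : 0 < (ω₃ / ω₂).im) (hg : ∀ j, (g j / ω₃).im < 0) (hsum : ∑ j, g j = ω₁ + ω₂ + ω₃) :
    IntervalIntegrable (fun t : ℝ => betaIntegrand ω₁ ω₂ ω₃ g (t * ω₃))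
        MeasureTheory.volume (-(1 / 2)) (1 / 2) ∧
      kappaTilde ω₁ ω₂ ω₃ *
          ∫ t in (-(1 / 2) : ℝ)..(1 / 2), betaIntegrand ω₁ ω₂ ω₃ g (t * ω₃) * (ω₃ / ω₂) =
        ∏ j : Fin 6, ∏ m ∈ Finset.Ioi j, modEllGamma ω₁ ω₂ ω₃ (g j + g m) := by
  have h₃ := (ne_zero_of_div_im_pos h₃₁).1
  have hp := norm_e2pi_lt_one.2 (neg_div_im_pos h₃₁)
  have hq := norm_e2pi_lt_one.2 (neg_div_im_pos h₃₂)
  have ht : ∀ j, ‖e2pi (-(g j / ω₃))‖ < 1 := fun j => norm_e2pi_lt_one.2 (by simpa using hg j)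
  -- The exponents add up to -(ω₁ + ω₂)/ω₃ - 1, and the integer disappears under the exponential.
  have hprod : ∏ j, e2pi (-(g j / ω₃)) = e2pi (-(ω₁ / ω₃)) * e2pi (-(ω₂ / ω₃)) := by
    simp only [e2pi, ← exp_sum]
    rw [← Finset.mul_sum, Finset.sum_neg_distrib, ← Finset.sum_div, hsum, ← exp_add, ← mul_add]
    refine (e2pi_congr ?_).symm
    field_simp
    ring
  set K := betaKernel (e2pi (-(ω₁ / ω₃))) (e2pi (-(ω₂ / ω₃))) fun j => e2pi (-(g j / ω₃)) with hK
  have hKc : Continuous fun x : ℝ => K (e2pi x) :=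
    continuous_betaKernel hp hq (fun _ => e2pi_ne_zero _) ht
  set C := (ω₁ / ω₂ + 1 / (ω₁ / ω₂) + (ω₃ / ω₂ + 1 / (ω₃ / ω₂)) + (ω₃ / ω₁ + 1 / (ω₃ / ω₁))) / 12 +
    1 / 4 with hC
  set S := ∑ j, ∑ m ∈ Finset.Ioi j, cubicP ω₁ ω₂ ω₃ (g j + g m) with hS
  have hae : ∀ᵐ t : ℝ, betaIntegrand ω₁ ω₂ ω₃ g (t * ω₃) =
      exp (-(Real.pi * I * (S - C))) * K (e2pi t) := by
    filter_upwards [ae_e2pi_sq_ne_one] with t h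
    exact betaIntegrand_eq h₃₁ h₃₂ hg hsum h
  constructor
  · exact ((hKc.const_mul _).intervalIntegrable _ _).congr_ae
      (MeasureTheory.ae_restrict_of_ae (hae.mono fun t h => h.symm))
  -- Periodicity moves the interval from [-1/2, 1/2] to the interval [0, 1] of `betaInt`.
  have hper : Function.Periodic (fun x : ℝ => K (e2pi x)) 1 := fun x => by
    simp only [ofReal_add, ofReal_one, e2pi_add_one]
  have hint : ∫ t in (-(1 / 2) : ℝ)..(1 / 2), betaIntegrand ω₁ ω₂ ω₃ g (t * ω₃) * (ω₃ / ω₂) =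
      exp (-(Real.pi * I * (S - C))) *
        betaInt (e2pi (-(ω₁ / ω₃))) (e2pi (-(ω₂ / ω₃))) (fun j => e2pi (-(g j / ω₃))) *
        (ω₃ / ω₂) := by
    rw [intervalIntegral.integral_mul_const, intervalIntegral.integral_congr_ae
      (hae.mono fun t h _ => h), intervalIntegral.integral_const_mul, betaInt]
    have := hper.intervalIntegral_add_eq (-(1 / 2)) 0
    rw [zero_add, show (-(1 / 2) + 1 : ℝ) = 1 / 2 by norm_num] at this
    rw [this]
  have hκ := kappaTilde_mul h₁₂ h₃₁ h₃₂
  have q5 := qPochInf_ne_zero_of_norm_lt_one hp hp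
  have q6 := qPochInf_ne_zero_of_norm_lt_one hq hq
  rw [← hC] at hκ
  rw [hint, prod_modEllGamma_pairs h₃₁ h₃₂ hg, ← hS,
    betaInt_eq (e2pi_ne_zero _) hp (e2pi_ne_zero _) hq ht hprod]
  have e1 : exp (-(Real.pi * I * S)) =
      exp (-(Real.pi * I * C)) * exp (-(Real.pi * I * (S - C))) := by
    rw [← exp_add]; congr 1; ring
  rw [e1]
  generalize pairProd _ _ _ = X
  generalize exp (-(Real.pi * I * (S - C))) = Y
  calc _ = kappaTilde ω₁ ω₂ ω₃ * (ω₃ / ω₂) * (Y * (2 / (qPochInf (e2pi (-(ω₁ / ω₃)))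
        (e2pi (-(ω₁ / ω₃))) * qPochInf (e2pi (-(ω₂ / ω₃))) (e2pi (-(ω₂ / ω₃)))) * X)) := by ring
    _ = _ := by rw [hκ]; field_simp

end MainIntegral

end

end EllipticBeta

/-- The segment from `-ω₃/2` to `ω₃/2` is parametrized by `u = t ω₃`, `-1/2 ≤ t ≤ 1/2`. -/
theorem mainTheorem3 (ω₁ ω₂ ω₃ : ℂ) (g : Fin 6 → ℂ)
    (h₁₂ : 0 ≤ (ω₁ / ω₂).im) (h₃₁ : 0 < (ω₃ / ω₁).im) (h₃₂ : 0 < (ω₃ / ω₂).im)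
    (hg : ∀ j, (g j / ω₃).im < 0) (hsum : ∑ j, g j = ω₁ + ω₂ + ω₃) :
    IntervalIntegrable
        (fun t : ℝ => EllipticBeta.betaIntegrand ω₁ ω₂ ω₃ g (t * ω₃))
        MeasureTheory.volume (-(1 / 2)) (1 / 2) ∧
      EllipticBeta.kappaTilde ω₁ ω₂ ω₃ *
          ∫ t in (-(1 / 2) : ℝ)..(1 / 2),
            EllipticBeta.betaIntegrand ω₁ ω₂ ω₃ g (t * ω₃) * (ω₃ / ω₂) =
        ∏ j : Fin 6, ∏ m ∈ Finset.Ioi j, EllipticBeta.modEllGamma ω₁ ω₂ ω₃ (g j + g m) := by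
  exact EllipticBeta.modified_beta_integral h₁₂ h₃₁ h₃₂ hg hsum
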